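/- For an immersed $C^2$ curve $Y:\mathbb R\to\mathbb R^2$ let $T=Y'/\|Y'\|$, $N=JT$ with $J(a,b)=(-b,a)$, and $k=\det(Y',Y'')/\|Y'\|^3$, and consider the equation $$\left\langle \begin{pmatrix}0&0\\0&-1\end{pmatrix}Y+\begin{pmatrix}1\\0\end{pmatrix},\,N\right\rangle=k^{1/3},\qquad(\ast)$$ where $k^{1/3}$ is the real (odd) cube root. A solution of $(\ast)$ is called complete if it is not, up to an orientation-preserving $C^2$ change of parameter, a proper arc of another solution. Put $$A=2^{-3/4}\int_0^1(1-s^2)^{-3/4}\,ds,\qquad B=\sqrt2\int_0^1\frac{ds}{\sqrt{1-s^4}} .$$ Say that a function $f$ *oscillates along* three sequences $(x_n),(y_n),(z_n)$, $n\ge1$, in $(0,\infty)$ if each sequence strictly increases to $+\infty$ and for all $n\geq 1$: * $x_n<y_n<z_n<x_{n+1}$; * $x_n$ is a local maximum point of $f$ with $f(x_n)>0$ if $n$ is odd, and a local minimum point with $f(x_n)<0$ if $n$ is even; * $f$ is strictly monotone on $[x_n,x_{n+1}]$; * $|f(y_n)|=|f'(y_n)|$, and the sequences $|f(x_n)|$,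 $|f(y_n)|=|f'(y_n)|$ and $|f'(z_n)|$ strictly decrease to $0$; * $\displaystyle y_n-x_n<\frac{A}{\sqrt{|f'(y_n)|}}<x_{n+1}-y_n$ and $\displaystyle x_{n+1}-z_n<\frac{B}{|f(x_{n+1})|}<z_{n+1}-x_{n+1}$; moreover $x_{n+1}-y_n\to\infty$ and $z_{n+1}-x_{n+1}\to\infty$. **Theorem.** Every solution of $(\ast)$ is an arc of a complete one. Up to translation in the $x$-direction and reflection in the $x$-axis, the image of every complete solution is one of the following: 1. the line $y=0$; 2. the union of the graphs over $[0,\infty)$ of $f_1$ and $-f_2$, where $f_1,f_2:[0,\infty)\to\mathbb R$ are continuous, $C^2$ on $(0,\infty)$, and * $f_1(0)=-f_2(0)\ge0$ and $f_1'(0)=f_2'(0)=+\infty$; * each $f_i$ oscillates along sequences $(x^{(i)}_n),(y^{(i)}_n),(z^{(i)}_n)$, and the $y^{(i)}_n$ are all its inflection points (points where $f_i''$ changes sign) in $(0,\infty)$; * the $z^{(1)}_n$ are all the positive zeros of $f_1$; the $z^{(2)}_n$ are all the positive zeros of $f_2$ if $f_2(0)=0$, while if $f_2(0)<0$ then $f_2$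 has exactly one further positive zero, and it lies in $(0,x^{(2)}_1)$; * if $f_1(0)=0$, then $f_1=f_2$, that is, the curve is symmetric with respect to the $x$-axis; 3. the graph of a $C^2$ function $f:\mathbb R\to\mathbb R$ that oscillates along sequences $(x_n),(y_n),(z_n)$ in $(0,\infty)$, is strictly increasing on $(-\infty,x_1]$ with $f(x)\to-\infty$ as $x\to-\infty$, whose inflection points are exactly the $y_n$, and whose zeros greater than $x_1$ are exactly the $z_n$. All three kinds occur as images of complete solutions, the second one for every value $f_1(0)=a\ge0$. -/

import Mathlib

open Set Filter Topology

/-- The Euclidean plane. -/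
abbrev Plane : Type := EuclideanSpace ℝ (Fin 2)

noncomputable section

/-- Rotation by a right angle, `J (a, b) = (-b, a)`. -/
def rotJ (v : Plane) : Plane := !₂[-v 1, v 0]

/-- The unit tangent `T = Y' / ‖Y'‖`. -/
def unitTangent (Y : ℝ → Plane) (u : ℝ) : Plane := ‖deriv Y u‖⁻¹ • deriv Y u

/-- The unit normal `N = J T`. -/
def unitNormal (Y : ℝ → Plane) (u : ℝ) : Plane := rotJ (unitTangent Y u)

/-- The curvature with respect to `N`, `k = det (Y', Y'') / ‖Y'‖ ^ 3`. -/
def curvature (Y : ℝ → Plane) (u : ℝ) : ℝ :=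
  (deriv Y u 0 * deriv (deriv Y) u 1 - deriv Y u 1 * deriv (deriv Y) u 0) / ‖deriv Y u‖ ^ 3

/-- The real (odd) cube root `k ^ (1/3)`. -/
def cbrt (k : ℝ) : ℝ := Real.sign k * |k| ^ (1 / 3 : ℝ)

/-- `Y` is an immersed `C²` curve with `⟨B Y + C, N⟩ = k ^ (1/3)` at every parameter. -/
structure IsSolution (B : Matrix (Fin 2) (Fin 2) ℝ) (C : Plane) (Y : ℝ → Plane) : Prop where
  contDiff : ContDiff ℝ 2 Y
  immersed : ∀ u, deriv Y u ≠ 0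
  equation : ∀ u,
    inner ℝ (Matrix.toEuclideanLin B (Y u) + C) (unitNormal Y u) = cbrt (curvature Y u)

/-- `Y` runs, in the same direction, through an arc of the curve `Z`, with `φ` as the change of
parameter. The arc is all of `Z` when `φ` is surjective. -/
structure IsArcOf (Y Z : ℝ → Plane) (φ : ℝ → ℝ) : Prop where
  contDiff : ContDiff ℝ 2 φ
  deriv_pos : ∀ u, 0 < deriv φ u
  eq_comp : ∀ u, Y u = Z (φ u)

/-- A complete (inextendible) solution curve: one that is not a proper arc of another one. -/
structure IsMaximalSolution (B : Matrix (Fin 2) (Fin 2) ℝ) (C : Plane) (Y : ℝ → Plane) :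
    Prop where
  isSolution : IsSolution B C Y
  maximal : ∀ (Z : ℝ → Plane) (φ : ℝ → ℝ),
    IsSolution B C Z → IsArcOf Y Z φ → Function.Surjective φ

/-- The matrix `diag (0, -1)`. -/
def contractB : Matrix (Fin 2) (Fin 2) ℝ := !![0, 0; 0, -1]

/-- The vector `(1, 0)`. -/
def translateC : Plane := !₂[1, 0]

/-- For `ε = 1` the horizontal translation by `c`, for `ε = -1` the same followed by the reflection
in the `x`-axis. -/
def shiftReflect (c ε : ℝ) (p : Plane) : Plane := !₂[p 0 + c, ε * p 1]

/-- The graph of `f` over `s`. -/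
def graphOver (s : Set ℝ) (f : ℝ → ℝ) : Set Plane := {p | p 0 ∈ s ∧ p 1 = f (p 0)}

/-- `f''` changes its sign at `t`. -/
def IsInflectionPoint (f : ℝ → ℝ) (t : ℝ) : Prop :=
  ((∀ᶠ s in 𝓝[<] t, deriv (deriv f) s < 0) ∧ (∀ᶠ s in 𝓝[>] t, 0 < deriv (deriv f) s)) ∨
  ((∀ᶠ s in 𝓝[<] t, 0 < deriv (deriv f) s) ∧ (∀ᶠ s in 𝓝[>] t, deriv (deriv f) s < 0))

/-- `A = 2^(-3/4) ∫₀¹ (1 - s²)^(-3/4) ds`. -/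
def gapA : ℝ := (2 : ℝ) ^ (-(3 / 4) : ℝ) * ∫ s in (0 : ℝ)..1, (1 - s ^ 2) ^ (-(3 / 4) : ℝ)

/-- `B = √2 ∫₀¹ (1 - s⁴)^(-1/2) ds`. -/
def gapB : ℝ := √2 * ∫ s in (0 : ℝ)..1, 1 / √(1 - s ^ 4)

/-- The sequence is strictly increasing, positive, and tends to infinity. -/
structure IncreasesToInfinity (a : ℕ → ℝ) : Prop where
  pos : ∀ n, 0 < a n
  strictMono : StrictMono a
  tendsto : Tendsto a atTop atTop

/-- The sequence is strictly decreasing and tends to zero. -/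
structure DecreasesToZero (a : ℕ → ℝ) : Prop where
  strictAnti : StrictAnti a
  tendsto : Tendsto a atTop (𝓝 0)

/-- The behaviour of an oscillating function along its extrema `x`, inflection points `y` and
zeros `z`. The sequences are indexed from `0`, so `x 0` is the first maximum, and the maxima are
the `x n` with `n` even. -/
structure Oscillates (f : ℝ → ℝ) (x y z : ℕ → ℝ) : Prop where
  x_increases : IncreasesToInfinity x
  y_increases : IncreasesToInfinity y
  z_increases : IncreasesToInfinity z
  x_lt_y : ∀ n, x n < y n
  y_lt_z : ∀ n, y n < z n
  z_lt_x : ∀ n, z n < x (n + 1)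
  isLocalMax : ∀ n, Even n → IsLocalMax f (x n) ∧ 0 < f (x n)
  isLocalMin : ∀ n, Odd n → IsLocalMin f (x n) ∧ f (x n) < 0
  strictAntiOn : ∀ n, Even n → StrictAntiOn f (Icc (x n) (x (n + 1)))
  strictMonoOn : ∀ n, Odd n → StrictMonoOn f (Icc (x n) (x (n + 1)))
  abs_f_x : DecreasesToZero fun n => |f (x n)|
  abs_f_y_eq : ∀ n, |f (y n)| = |deriv f (y n)|
  abs_f_y : DecreasesToZero fun n => |f (y n)|
  abs_deriv_z : DecreasesToZero fun n => |deriv f (z n)|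
  gap_xy : ∀ n, y n - x n < gapA / √|deriv f (y n)| ∧
    gapA / √|deriv f (y n)| < x (n + 1) - y n
  gap_zx : ∀ n, x (n + 1) - z n < gapB / |f (x (n + 1))| ∧
    gapB / |f (x (n + 1))| < z (n + 1) - x (n + 1)
  gap_y_tendsto : Tendsto (fun n => x (n + 1) - y n) atTop atTop
  gap_x_tendsto : Tendsto (fun n => z (n + 1) - x (n + 1)) atTop atTop

/-- One branch of a two-branch curve: a function on `[0, ∞)` with `f' (0) = +∞` that oscillates;
`y` lists all its inflection points. (Values at negative arguments play no role.) -/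
structure IsBranch (f : ℝ → ℝ) (x y z : ℕ → ℝ) : Prop where
  continuousOn : ContinuousOn f (Ici 0)
  contDiffOn : ContDiffOn ℝ 2 f (Ioi 0)
  deriv_zero : Tendsto (fun t => (f t - f 0) / t) (𝓝[>] 0) atTop
  oscillates : Oscillates f x y z
  inflection : {t | 0 < t ∧ IsInflectionPoint f t} = range y

/-- The functions `f₁, f₂` of a two-branch curve (the union of the graphs of `f₁` and `-f₂` over
`[0, ∞)`, which meet at the point `(0, f₁ 0)`). -/
structure IsBranchPair (f₁ f₂ : ℝ → ℝ) : Prop where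
  start_nonneg : 0 ≤ f₁ 0
  start_eq : f₁ 0 = -f₂ 0
  /-- `f₁` oscillates and `z` lists all its positive zeros. -/
  branch₁ : ∃ x y z : ℕ → ℝ, IsBranch f₁ x y z ∧ {t | 0 < t ∧ f₁ t = 0} = range z
  /-- `f₂` oscillates and `z` lists all its positive zeros, except that there is one more zero,
  before the first maximum, when `f₂ 0 < 0`. -/
  branch₂ : ∃ x y z : ℕ → ℝ, IsBranch f₂ x y z ∧
    (f₂ 0 = 0 → {t | 0 < t ∧ f₂ t = 0} = range z) ∧
    (f₂ 0 < 0 → ∃ z₀, 0 < z₀ ∧ z₀ < x 0 ∧ {t | 0 < t ∧ f₂ t = 0} = insert z₀ (range z))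
  symmetric : f₁ 0 = 0 → EqOn f₁ f₂ (Ici 0)

/-- The function `f` on `ℝ` of a one-branch curve: it increases from `-∞` up to its first maximum
`x 0` and oscillates from there on; `y` lists all its inflection points and `z` all its zeros
after `x 0`. -/
structure IsOscillatingEntire (f : ℝ → ℝ) : Prop where
  contDiff : ContDiff ℝ 2 f
  tendsto_atBot : Tendsto f atBot atBot
  oscillates : ∃ x y z : ℕ → ℝ, Oscillates f x y z ∧
    StrictMonoOn f (Iic (x 0)) ∧
    {t | IsInflectionPoint f t} = range y ∧
    {t | x 0 < t ∧ f t = 0} = range z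

/-- The line `y = 0`. -/
def axisLine : Set Plane := {p | p 1 = 0}

/-- The union of the graphs of `f₁` and `-f₂` over `[0, ∞)`. -/
def twoBranchCurve (f₁ f₂ : ℝ → ℝ) : Set Plane :=
  graphOver (Ici 0) f₁ ∪ graphOver (Ici 0) (fun t => -f₂ t)

end

/-! Let `θ` be the tangent angle of a solution of unit speed. Then (∗) is the autonomous system `x'
= cos θ`, `y' = sin θ`, `θ' = -(sin θ + y cos θ)³`. As `|y'| ≤ 1`, its solutions exist for all
times, and by uniqueness every solution of (∗) is a reparametrized arc of one of them. These are the
complete curves (`IsSolution.exists_isFlow`, `IsFlow.isMaximalSolution`).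

At `θ = ±π/2` the angle moves with `θ' = ∓1`, so it enters the strip `|θ| < π/2` and cannot leave it
again (`IsFlow.angle_mem_of_lt`). After a vertical tangent the curve is therefore a graph. The part
before it becomes one of the same sort after reflection and reversal, which gives the two branches.
Without a vertical tangent the whole curve is one graph.

On a graph, `p = f'` and `w = f + f'` satisfy `p' = -w³`, `w' = p - w³`. Both `p²/2 + w⁴/4` and
`p²/2 + f⁴/4` are Lyapunov functions. Forwards the orbit is bounded and tends to the origin, but it
keeps turning: maximum, inflection point, zero and minimum follow each other
(`IsGraphSolution.exists_isArch`). The first function is `p²/2` at inflection points; the second is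
`f⁴/4` at extrema and `p²/2` at zeros. This yields the monotone sequences. Comparison with the
motion that would conserve the function yields the gaps `A / √|f'|` and `B / |f|`; a mean value
theorem for the primitives of the two integrands (`exists_mul_eq_comp_sub`) replaces the change of
variables.

Backwards the energy exceeds every bound. If the slope vanished at high energy, the orbit would be
caught in a region where `W' ≥ c W³` and would blow up within finite length
(`IsReversedSolution.not_trapped`), which is impossible for a curve of unit speed defined for all
times. So the slope keeps its sign, it grows at most exponentially, and the graph extends over all
of `ℝ` (`IsReversedSolution.exists_sign`): this is the third kind.

That the third kind occurs is a connectedness argument: initial data whose angle leaves the strip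
backwards through the top, or through the bottom, form two disjoint open sets exchanged by a
symmetry, and these cannot cover a line (`exists_isFlow_angle_mem`). -/

/-! ### Uniqueness and the global flow of the angle system. -/

/-- Solutions of `z' = σ(t) V(z)` with a locally Lipschitz `V` are unique on intervals. -/
theorem eqOn_Ioo_of_hasDerivAt_smul {E : Type*} [NormedAddCommGroup E] [NormedSpace ℝ E]
    [ProperSpace E] {V : E → E} (hV : LocallyLipschitz V) {σ : ℝ → ℝ} (hσ : Continuous σ)
    {f g : ℝ → E} {a b t₀ : ℝ} (ht₀ : t₀ ∈ Ioo a b)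
    (hf : ∀ t ∈ Ioo a b, HasDerivAt f (σ t • V (f t)) t)
    (hg : ∀ t ∈ Ioo a b, HasDerivAt g (σ t • V (g t)) t) (h : f t₀ = g t₀) :
    EqOn f g (Ioo a b) := by
  intro t ht
  obtain ⟨a', ha', ha''⟩ := exists_between (lt_min ht.1 ht₀.1)
  obtain ⟨b', hb', hb''⟩ := exists_between (max_lt ht.2 ht₀.2)
  have hsub : Icc a' b' ⊆ Ioo a b := fun s hs => ⟨ha'.trans_le hs.1, hs.2.trans_lt hb''⟩
  have hfc : ContinuousOn f (Icc a' b') := fun s hs =>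
    (hf s (hsub hs)).continuousAt.continuousWithinAt
  have hgc : ContinuousOn g (Icc a' b') := fun s hs =>
    (hg s (hsub hs)).continuousAt.continuousWithinAt
  obtain ⟨R₁, hR₁⟩ := (isCompact_Icc.image_of_continuousOn hfc).isBounded.subset_closedBall 0
  obtain ⟨R₂, hR₂⟩ := (isCompact_Icc.image_of_continuousOn hgc).isBounded.subset_closedBall 0
  obtain ⟨M, hM⟩ := (isCompact_Icc.image_of_continuousOn
    (hσ.continuousOn (s := Icc a' b'))).isBounded.subset_closedBall 0
  obtain ⟨K, hK⟩ := hV.locallyLipschitzOn.exists_lipschitzOnWith_of_compact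
    (isCompact_closedBall (0 : E) (max R₁ R₂))
  have hfs : ∀ s ∈ Icc a' b', f s ∈ Metric.closedBall (0 : E) (max R₁ R₂) := fun s hs =>
    Metric.closedBall_subset_closedBall (le_max_left _ _) (hR₁ (mem_image_of_mem f hs))
  have hgs : ∀ s ∈ Icc a' b', g s ∈ Metric.closedBall (0 : E) (max R₁ R₂) := fun s hs =>
    Metric.closedBall_subset_closedBall (le_max_right _ _) (hR₂ (mem_image_of_mem g hs))
  -- On a compact interval both curves stay in one ball, so a bound for `|σ|` times a Lipschitz
  -- constant of `V` on that ball serves for Grönwall.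
  have key := ODE_solution_unique_of_mem_Icc (v := fun s z => σ s • V z)
    (s := fun _ => Metric.closedBall (0 : E) (max R₁ R₂)) (K := M.toNNReal * K)
    (a := a') (b := b') (t₀ := t₀) (f := f) (g := g) (fun s hs => ?_)
    ⟨(lt_min_iff.1 ha'').2, (max_lt_iff.1 hb').2⟩ hfc
    (fun s hs => hf s (hsub (Ioo_subset_Icc_self hs)))
    (fun s hs => hfs s (Ioo_subset_Icc_self hs)) hgc
    (fun s hs => hg s (hsub (Ioo_subset_Icc_self hs)))
    (fun s hs => hgs s (Ioo_subset_Icc_self hs)) h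
  · exact key ⟨(lt_min_iff.1 ha'').1.le, (max_lt_iff.1 hb').1.le⟩
  · refine LipschitzOnWith.of_dist_le_mul fun x hx y hy => ?_
    have h1 : |σ s| ≤ M := by
      simpa using hM (mem_image_of_mem σ (Ioo_subset_Icc_self hs))
    have h2 := hK.dist_le_mul x hx y hy
    rw [dist_smul₀, Real.norm_eq_abs, NNReal.coe_mul, Real.coe_toNNReal _ ((abs_nonneg _).trans h1),
      mul_assoc]
    exact mul_le_mul h1 h2 dist_nonneg ((abs_nonneg _).trans h1)

theorem eq_of_hasDerivAt_smul {E : Type*} [NormedAddCommGroup E] [NormedSpace ℝ E]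
    [ProperSpace E] {V : E → E} (hV : LocallyLipschitz V) {σ : ℝ → ℝ} (hσ : Continuous σ)
    {f g : ℝ → E} {t₀ : ℝ}
    (hf : ∀ t, HasDerivAt f (σ t • V (f t)) t)
    (hg : ∀ t, HasDerivAt g (σ t • V (g t)) t) (h : f t₀ = g t₀) : f = g := by
  ext1 t
  refine eqOn_Ioo_of_hasDerivAt_smul hV hσ (a := min t t₀ - 1) (b := max t t₀ + 1) (t₀ := t₀)
    ⟨?_, ?_⟩ (fun t _ => hf t) (fun t _ => hg t) h ⟨?_, ?_⟩
  · linarith [min_le_right t t₀]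
  · linarith [le_max_right t t₀]
  · linarith [min_le_left t t₀]
  · linarith [le_max_left t t₀]

noncomputable section

/-- The vector field governing height and tangent angle of a solution of unit speed. -/
def angleField (z : ℝ × ℝ) : ℝ × ℝ :=
  (Real.sin z.2, -(Real.sin z.2 + z.1 * Real.cos z.2) ^ 3)

end

theorem contDiff_angleField : ContDiff ℝ 1 angleField := by
  unfold angleField
  fun_prop

theorem locallyLipschitz_angleField : LocallyLipschitz angleField :=
  contDiff_angleField.locallyLipschitz

/-- The local flow of the angle field, for arbitrary times. -/
theorem exists_local_flow_angleField (z₀ : ℝ × ℝ) {T : ℝ} (hT : 0 < T) :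
    ∃ α : ℝ × ℝ → ℝ → ℝ × ℝ, (∀ z ∈ Metric.closedBall z₀ 1, α z 0 = z ∧
      ∀ t ∈ Ioo (-T) T, HasDerivAt (α z) (angleField (α z t)) t) ∧
      ∀ t ∈ Ioo (-T) T, ContinuousOn (α · t) (Metric.closedBall z₀ 1) := by
  -- No height beyond `R` is reached within time `T` from the unit ball, because `|sin| ≤ 1`.
  -- Clamping the height to `[-R, R]` makes the field bounded, so that Picard–Lindelöf reaches any
  -- given `T`, and the clamp never acts along these solutions.
  set R : ℝ := |z₀.1| + 1 + T with hR
  have hR0 : 0 ≤ R := by positivity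
  set π : ℝ × ℝ → ℝ × ℝ := fun z => (max (-R) (min R z.1), z.2) with hπ
  have hπl : LipschitzWith 1 π := by
    have := ((LipschitzWith.prod_fst.const_min R).const_max (-R)).prodMk
      (LipschitzWith.prod_snd (α := ℝ) (β := ℝ))
    simpa using this
  have hVl : LocallyLipschitz (angleField ∘ π) :=
    locallyLipschitz_angleField.comp hπl.locallyLipschitz
  set L : NNReal := ⟨1 + (1 + R) ^ 3, by positivity⟩ with hL
  have hbound : ∀ z, ‖(angleField ∘ π) z‖ ≤ L := by
    intro z
    have h1 : |(π z).1| ≤ R := by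
      rw [abs_le]
      exact ⟨le_max_left _ _, max_le (by linarith) (min_le_left _ _)⟩
    have hs := Real.abs_sin_le_one (π z).2
    have hc := Real.abs_cos_le_one (π z).2
    have h2 : |Real.sin (π z).2 + (π z).1 * Real.cos (π z).2| ≤ 1 + R := by
      refine (abs_add_le _ _).trans (add_le_add hs ?_)
      rw [abs_mul]
      calc _ ≤ R * 1 := mul_le_mul h1 hc (abs_nonneg _) hR0
        _ = R := mul_one R
    simp only [Function.comp, angleField, Prod.norm_def, Real.norm_eq_abs, abs_neg, abs_pow]
    have h3 : |Real.sin (π z).2 + (π z).1 * Real.cos (π z).2| ^ 3 ≤ (1 + R) ^ 3 :=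
      pow_le_pow_left₀ (abs_nonneg _) h2 3
    have h4 : (0 : ℝ) ≤ (1 + R) ^ 3 := by positivity
    have h5 : (L : ℝ) = 1 + (1 + R) ^ 3 := rfl
    rw [h5]
    exact max_le (by linarith) (by linarith)
  obtain ⟨K, hK⟩ := hVl.locallyLipschitzOn.exists_lipschitzOnWith_of_compact
    (isCompact_closedBall z₀ (1 + L * T))
  have hPL : IsPicardLindelof (fun _ => angleField ∘ π) (tmin := -T) (tmax := T)
      ⟨0, by constructor <;> linarith⟩ z₀ (1 + L * T.toNNReal) 1 L K := by
    refine IsPicardLindelof.of_time_independent (fun z _ => hbound z) ?_ ?_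
    · simpa [Real.coe_toNNReal _ hT.le] using hK
    · simp [Real.coe_toNNReal _ hT.le]
  obtain ⟨α, hα, L', hL'⟩ :=
    hPL.exists_forall_mem_closedBall_eq_hasDerivWithinAt_lipschitzOnWith
  refine ⟨α, fun z hz => ⟨(hα z (by simpa using hz)).1, fun t ht => ?_⟩,
    fun t ht => by simpa using (hL' t (Ioo_subset_Icc_self ht)).continuousOn⟩
  obtain ⟨h0, h1⟩ := hα z (by simpa using hz)
  have hz1 : |z.1| ≤ |z₀.1| + 1 := by
    have h2 : |z.1 - z₀.1| ≤ 1 := by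
      have := (Metric.mem_closedBall.1 hz)
      rw [Prod.dist_eq] at this
      simpa [Real.dist_eq] using (le_max_left _ _).trans this
    have := abs_add_le z₀.1 (z.1 - z₀.1)
    rw [add_sub_cancel] at this
    linarith
  have hy : ∀ s ∈ Icc (-T) T, |(α z s).1| ≤ R := by
    intro s hs
    have hd : ∀ r ∈ Icc (-T) T, HasDerivWithinAt (fun r => (α z r).1)
        ((angleField ∘ π) (α z r)).1 (Icc (-T) T) r := fun r hr =>
      (ContinuousLinearMap.fst ℝ ℝ ℝ).hasFDerivAt.comp_hasDerivWithinAt r (h1 r hr)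
    have hle := (convex_Icc (-T) T).norm_image_sub_le_of_norm_hasDerivWithin_le (C := 1) hd
      (fun r _ => by
        simp only [Function.comp, angleField, Real.norm_eq_abs]
        exact Real.abs_sin_le_one _) (x := 0) (y := s) (by constructor <;> linarith) hs
    have h0' : α z 0 = z := h0
    rw [h0', Real.norm_eq_abs, Real.norm_eq_abs, sub_zero, one_mul] at hle
    have h3 : |s| ≤ T := abs_le.2 hs
    have := abs_add_le z.1 ((α z s).1 - z.1)
    rw [add_sub_cancel] at this
    linarith
  have hd := (h1 t (Ioo_subset_Icc_self ht)).hasDerivAt (Icc_mem_nhds ht.1 ht.2)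
  have hπt : π (α z t) = α z t := by
    have := abs_le.1 (hy t (Ioo_subset_Icc_self ht))
    simp only [hπ]
    rw [min_eq_right this.2, max_eq_right this.1]
  simpa [hπt] using hd

theorem exists_flow_angleField (z : ℝ × ℝ) :
    ∃ γ : ℝ → ℝ × ℝ, γ 0 = z ∧ ∀ t, HasDerivAt γ (angleField (γ t)) t := by
  have hex : ∀ n : ℕ, ∃ γ : ℝ → ℝ × ℝ, γ 0 = z ∧
      ∀ t ∈ Ioo (-(n + 1 : ℝ)) (n + 1), HasDerivAt γ (angleField (γ t)) t := fun n => by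
    obtain ⟨α, hα, -⟩ := exists_local_flow_angleField z (T := n + 1) (by positivity)
    exact ⟨α z, hα z (by simp)⟩
  choose γ h0 hγ using hex
  have huniq : ∀ m n : ℕ, m ≤ n → EqOn (γ m) (γ n) (Ioo (-(m + 1 : ℝ)) (m + 1)) := by
    intro m n hmn
    have hmn' : (m : ℝ) ≤ n := by exact_mod_cast hmn
    refine eqOn_Ioo_of_hasDerivAt_smul locallyLipschitz_angleField
      (σ := fun _ => 1) continuous_const (t₀ := 0) ⟨by linarith [m.cast_nonneg (α := ℝ)],
        by linarith [m.cast_nonneg (α := ℝ)]⟩ (fun t ht => by simpa using hγ m t ht)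
        (fun t ht => ?_) ((h0 m).trans (h0 n).symm)
    simpa using hγ n t ⟨by linarith [ht.1], by linarith [ht.2]⟩
  -- The index `⌈|t|⌉₊` is at least `|t|`, so `t` lies in the open interval of radius `⌈|t|⌉₊ + 1`
  -- on which that local solution is valid.
  refine ⟨fun t => γ ⌈|t|⌉₊ t, h0 _, fun t => ?_⟩
  have hlt : ∀ s : ℝ, |s| < ⌈|s|⌉₊ + 1 := fun s => (Nat.le_ceil _).trans_lt (lt_add_one _)
  set N := ⌈|t|⌉₊ with hN
  have hd := hγ N t (abs_lt.1 (hlt t))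
  refine hd.congr_of_eventuallyEq ?_
  filter_upwards [Ioo_mem_nhds (abs_lt.1 (hlt t)).1 (abs_lt.1 (hlt t)).2] with s hs
  rcases le_total ⌈|s|⌉₊ N with h | h
  · exact huniq _ _ h (abs_lt.1 (hlt s))
  · exact (huniq _ _ h hs).symm

/-- The flow of the angle field depends continuously on the initial value. -/
theorem continuous_flow_angleField {Φ : ℝ × ℝ → ℝ → ℝ × ℝ} (h0 : ∀ z, Φ z 0 = z)
    (hΦ : ∀ z t, HasDerivAt (Φ z) (angleField (Φ z t)) t) (t : ℝ) : Continuous fun z => Φ z t := by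
  rw [continuous_iff_continuousAt]
  intro z₀
  have hT : (0 : ℝ) < |t| + 1 := by positivity
  have ht : t ∈ Ioo (-(|t| + 1)) (|t| + 1) := abs_lt.1 (lt_add_one _)
  obtain ⟨α, hα, hc⟩ := exists_local_flow_angleField z₀ hT
  have hmem := Metric.closedBall_mem_nhds z₀ one_pos
  refine ((hc t ht).continuousAt hmem).congr ?_
  filter_upwards [hmem] with z hz
  exact eqOn_Ioo_of_hasDerivAt_smul locallyLipschitz_angleField (σ := fun _ => 1) continuous_const
    (t₀ := 0) ⟨by linarith, hT⟩ (fun s hs => by simpa using (hα z hz).2 s hs)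
    (fun s _ => by simpa using hΦ z s) (((hα z hz).1).trans (h0 z).symm) ht

/-! ### Solutions as arcs of complete curves of unit speed. -/

/-- A solution of unit speed, described by its coordinates and its tangent angle. -/
structure IsFlow (x y θ : ℝ → ℝ) : Prop where
  hasDerivAt_fst : ∀ s, HasDerivAt x (Real.cos (θ s)) s
  hasDerivAt_snd : ∀ s, HasDerivAt y (Real.sin (θ s)) s
  hasDerivAt_angle : ∀ s, HasDerivAt θ (-(Real.sin (θ s) + y s * Real.cos (θ s)) ^ 3) s

noncomputable section

/-- The plane curve with the given coordinate functions. -/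
def planeCurve (x y : ℝ → ℝ) (s : ℝ) : Plane := !₂[x s, y s]

end

@[simp] theorem planeCurve_zero (x y : ℝ → ℝ) (s : ℝ) : planeCurve x y s 0 = x s := rfl

@[simp] theorem planeCurve_one (x y : ℝ → ℝ) (s : ℝ) : planeCurve x y s 1 = y s := rfl

theorem Plane.ext {p q : Plane} (h0 : p 0 = q 0) (h1 : p 1 = q 1) : p = q := by
  ext i
  fin_cases i
  · exact h0
  · exact h1

theorem hasDerivAt_plane {Y : ℝ → Plane} {v : Plane} {u : ℝ} :
    HasDerivAt Y v u ↔
      HasDerivAt (fun u => Y u 0) (v 0) u ∧ HasDerivAt (fun u => Y u 1) (v 1) u := by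
  refine ⟨fun h => ⟨?_, ?_⟩, fun h => ?_⟩
  · exact (EuclideanSpace.proj (𝕜 := ℝ) (0 : Fin 2)).hasFDerivAt.comp_hasDerivAt u h
  · exact (EuclideanSpace.proj (𝕜 := ℝ) (1 : Fin 2)).hasFDerivAt.comp_hasDerivAt u h
  · have h2 : HasDerivAt (fun u => (Y u).ofLp) v.ofLp u :=
      hasDerivAt_pi.2 (Fin.forall_fin_two.2 h)
    exact (PiLp.continuousLinearEquiv 2 ℝ fun _ : Fin 2 => ℝ).symm.hasFDerivAt.comp_hasDerivAt u h2

theorem eq_of_hasDerivAt_zero {f : ℝ → ℝ} (h : ∀ u, HasDerivAt f 0 u) (u v : ℝ) : f u = f v :=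
  is_const_of_deriv_eq_zero (fun u => (h u).differentiableAt) (fun u => (h u).deriv) u v

/-- A unit vector field that turns with speed `k` has an angle function with derivative `k`. -/
theorem exists_angle {c d k : ℝ → ℝ} (hk : Continuous k) (hc : ∀ u, HasDerivAt c (-d u * k u) u)
    (hd : ∀ u, HasDerivAt d (c u * k u) u) (h : c 0 ^ 2 + d 0 ^ 2 = 1) :
    ∃ θ : ℝ → ℝ, (∀ u, HasDerivAt θ (k u) u) ∧ (∀ u, c u = Real.cos (θ u)) ∧
      ∀ u, d u = Real.sin (θ u) := by
  obtain ⟨θ₀, hθc, hθs⟩ : ∃ θ₀, Real.cos θ₀ = c 0 ∧ Real.sin θ₀ = d 0 := by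
    have hn : ‖(⟨c 0, d 0⟩ : ℂ)‖ = 1 := by
      rw [Complex.norm_def, Complex.normSq_mk, ← sq, ← sq, h, Real.sqrt_one]
    refine ⟨Complex.arg ⟨c 0, d 0⟩, ?_, ?_⟩
    · simpa [hn] using Complex.norm_mul_cos_arg ⟨c 0, d 0⟩
    · simpa [hn] using Complex.norm_mul_sin_arg ⟨c 0, d 0⟩
  set θ : ℝ → ℝ := fun u => θ₀ + ∫ r in (0 : ℝ)..u, k r with hθ
  have hθd : ∀ u, HasDerivAt θ (k u) u := fun u =>
    (hk.integral_hasStrictDerivAt 0 u).hasDerivAt.const_add θ₀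
  have hθ0 : θ 0 = θ₀ := by simp [hθ]
  -- The field `(c, d)` rotated back by `θ` has derivative zero and starts at `(1, 0)`.
  have hconst1 : ∀ u, c u * Real.cos (θ u) + d u * Real.sin (θ u) = 1 := fun u => by
    have hder : ∀ u, HasDerivAt (fun u => c u * Real.cos (θ u) + d u * Real.sin (θ u)) 0 u :=
      fun u => by
      convert! ((hc u).mul (hθd u).cos).add ((hd u).mul (hθd u).sin) using 1
      ring
    rw [eq_of_hasDerivAt_zero hder u 0, hθ0, hθc, hθs, ← h]
    ring
  have hconst2 : ∀ u, d u * Real.cos (θ u) - c u * Real.sin (θ u) = 0 := fun u => by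
    have hder : ∀ u, HasDerivAt (fun u => d u * Real.cos (θ u) - c u * Real.sin (θ u)) 0 u :=
      fun u => by
      convert! ((hd u).mul (hθd u).cos).sub ((hc u).mul (hθd u).sin) using 1
      ring
    rw [eq_of_hasDerivAt_zero hder u 0, hθ0, hθc, hθs]
    ring
  refine ⟨θ, hθd, fun u => ?_, fun u => ?_⟩
  · linear_combination Real.cos (θ u) * hconst1 u - Real.sin (θ u) * hconst2 u -
      c u * Real.sin_sq_add_cos_sq (θ u)
  · linear_combination Real.sin (θ u) * hconst1 u + Real.cos (θ u) * hconst2 u -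
      d u * Real.sin_sq_add_cos_sq (θ u)

theorem norm_plane (v : Plane) : ‖v‖ = √(v 0 ^ 2 + v 1 ^ 2) := by
  rw [EuclideanSpace.norm_eq, Fin.sum_univ_two]
  simp

theorem cbrt_pow_three (k : ℝ) : cbrt k ^ 3 = k := by
  unfold cbrt
  have h : (|k| ^ (1 / 3 : ℝ)) ^ 3 = |k| := by
    rw [← Real.rpow_natCast, ← Real.rpow_mul (abs_nonneg k)]
    norm_num
  rw [mul_pow, h]
  rcases lt_trichotomy k 0 with hk | hk | hk
  · rw [Real.sign_of_neg hk, abs_of_neg hk]; ring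
  · simp [hk]
  · rw [Real.sign_of_pos hk, abs_of_pos hk]; ring

theorem cbrt_of_pow_three (m : ℝ) : cbrt (m ^ 3) = m :=
  (Odd.strictMono_pow (by decide : Odd 3)).injective (cbrt_pow_three _)

/-- For `T = (cos θ, sin θ)` this turns (∗) into `k = -(sin θ + y cos θ)³`, the second component of
`angleField`. -/
theorem inner_contract_rotJ (p T : Plane) :
    inner ℝ (Matrix.toEuclideanLin contractB p + translateC) (rotJ T) =
      -(T 1 + p 1 * T 0) := by
  simp [rotJ, contractB, translateC, PiLp.inner_apply, Fin.sum_univ_two, Matrix.toLpLin_apply,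
    dotProduct]
  ring

namespace IsFlow

variable {x y θ : ℝ → ℝ}

theorem continuous_angle (h : IsFlow x y θ) : Continuous θ :=
  continuous_iff_continuousAt.2 fun s => (h.hasDerivAt_angle s).continuousAt

theorem continuous_fst (h : IsFlow x y θ) : Continuous x :=
  continuous_iff_continuousAt.2 fun s => (h.hasDerivAt_fst s).continuousAt

theorem continuous_snd (h : IsFlow x y θ) : Continuous y :=
  continuous_iff_continuousAt.2 fun s => (h.hasDerivAt_snd s).continuousAt

theorem hasDerivAt_pair (h : IsFlow x y θ) (s : ℝ) :
    HasDerivAt (fun s => (y s, θ s)) (angleField (y s, θ s)) s :=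
  (h.hasDerivAt_snd s).prodMk (h.hasDerivAt_angle s)

/-- The system for height and angle does not involve the abscissa, which is recovered by
integration. -/
theorem of_pair {z : ℝ → ℝ × ℝ} (hz : ∀ s, HasDerivAt z (angleField (z s)) s) (x₀ : ℝ) :
    IsFlow (fun s => x₀ + ∫ r in (0 : ℝ)..s, Real.cos (z r).2) (fun s => (z s).1)
      (fun s => (z s).2) := by
  have hc : Continuous z := continuous_iff_continuousAt.2 fun s => (hz s).continuousAt
  refine ⟨fun s => ?_, fun s => ?_, fun s => ?_⟩
  · exact ((Real.continuous_cos.comp (_root_.continuous_snd.comp hc)).integral_hasStrictDerivAt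
      0 s).hasDerivAt.const_add x₀
  · exact (ContinuousLinearMap.fst ℝ ℝ ℝ).hasFDerivAt.comp_hasDerivAt s (hz s)
  · exact (ContinuousLinearMap.snd ℝ ℝ ℝ).hasFDerivAt.comp_hasDerivAt s (hz s)

theorem exists_eq (x₀ y₀ θ₀ : ℝ) :
    ∃ x y θ, IsFlow x y θ ∧ x 0 = x₀ ∧ y 0 = y₀ ∧ θ 0 = θ₀ := by
  obtain ⟨z, h0, hz⟩ := exists_flow_angleField (y₀, θ₀)
  exact ⟨_, _, _, of_pair hz x₀, by simp, by simp [h0], by simp [h0]⟩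

theorem eq_of_pair_eq {x' y' θ' : ℝ → ℝ} (h : IsFlow x y θ) (h' : IsFlow x' y' θ') {s₀ : ℝ}
    (hy : y s₀ = y' s₀) (hθ : θ s₀ = θ' s₀) : y = y' ∧ θ = θ' := by
  have := eq_of_hasDerivAt_smul locallyLipschitz_angleField (σ := fun _ => 1) continuous_const
    (t₀ := s₀) (f := fun s => (y s, θ s)) (g := fun s => (y' s, θ' s))
    (fun s => by simpa using h.hasDerivAt_pair s) (fun s => by simpa using h'.hasDerivAt_pair s)
    (by simp [hy, hθ])
  exact ⟨funext fun s => congrArg Prod.fst (congrFun this s),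
    funext fun s => congrArg Prod.snd (congrFun this s)⟩

theorem fst_eq {x' y' : ℝ → ℝ} (h : IsFlow x y θ) (h' : IsFlow x' y' θ) {s₀ : ℝ}
    (hx : x s₀ = x' s₀) : x = x' := by
  have hd : ∀ s, HasDerivAt (fun s => x s - x' s) 0 s := fun s => by
    simpa using! (h.hasDerivAt_fst s).sub (h'.hasDerivAt_fst s)
  ext s
  linarith [eq_of_hasDerivAt_zero hd s s₀]

theorem hasDerivAt_planeCurve (h : IsFlow x y θ) (s : ℝ) :
    HasDerivAt (planeCurve x y) !₂[Real.cos (θ s), Real.sin (θ s)] s := by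
  rw [hasDerivAt_plane]
  exact ⟨h.hasDerivAt_fst s, h.hasDerivAt_snd s⟩

theorem deriv_planeCurve (h : IsFlow x y θ) :
    deriv (planeCurve x y) = fun s => !₂[Real.cos (θ s), Real.sin (θ s)] :=
  funext fun s => (h.hasDerivAt_planeCurve s).deriv

theorem norm_deriv_planeCurve (h : IsFlow x y θ) (s : ℝ) : ‖deriv (planeCurve x y) s‖ = 1 := by
  rw [h.deriv_planeCurve, norm_plane]
  simp

theorem isSolution (h : IsFlow x y θ) : IsSolution contractB translateC (planeCurve x y) := by
  have hθd : ∀ s, HasDerivAt θ (-(Real.sin (θ s) + y s * Real.cos (θ s)) ^ 3) s :=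
    h.hasDerivAt_angle
  have hθ1 : ContDiff ℝ 1 θ := by
    rw [contDiff_one_iff_deriv]
    refine ⟨fun s => (hθd s).differentiableAt, ?_⟩
    rw [funext fun s => (hθd s).deriv]
    have := h.continuous_angle
    have := h.continuous_snd
    fun_prop
  refine ⟨?_, fun u hu => ?_, fun u => ?_⟩
  · rw [show (2 : WithTop ℕ∞) = 1 + 1 by norm_num, contDiff_succ_iff_deriv]
    refine ⟨fun s => (h.hasDerivAt_planeCurve s).differentiableAt, by simp, ?_⟩
    rw [h.deriv_planeCurve, contDiff_euclidean, Fin.forall_fin_two]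
    exact ⟨Real.contDiff_cos.comp hθ1, Real.contDiff_sin.comp hθ1⟩
  · have := h.norm_deriv_planeCurve u
    rw [hu, norm_zero] at this
    exact zero_ne_one this
  · have hd2 : deriv (deriv (planeCurve x y)) u =
        !₂[-Real.sin (θ u) * -(Real.sin (θ u) + y u * Real.cos (θ u)) ^ 3,
          Real.cos (θ u) * -(Real.sin (θ u) + y u * Real.cos (θ u)) ^ 3] := by
      rw [h.deriv_planeCurve]
      refine HasDerivAt.deriv (hasDerivAt_plane.2 ⟨?_, ?_⟩)
      · exact (hθd u).cos
      · exact (hθd u).sin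
    have hk : curvature (planeCurve x y) u =
        (-(Real.sin (θ u) + y u * Real.cos (θ u))) ^ 3 := by
      unfold curvature
      rw [hd2, h.norm_deriv_planeCurve, h.deriv_planeCurve]
      simp
      linear_combination (-(Real.sin (θ u) + y u * Real.cos (θ u)) ^ 3) *
        Real.sin_sq_add_cos_sq (θ u)
    rw [unitNormal, inner_contract_rotJ, hk, cbrt_of_pow_three, unitTangent,
      h.norm_deriv_planeCurve, h.deriv_planeCurve]
    simp

end IsFlow

/-- Every solution is an arc of a curve of unit speed defined for all times. -/
theorem IsSolution.exists_isFlow {Y : ℝ → Plane} (hY : IsSolution contractB translateC Y) :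
    ∃ x y θ φ, IsFlow x y θ ∧ IsArcOf Y (planeCurve x y) φ := by
  have h1 : ContDiff ℝ 1 (deriv Y) := by
    have := hY.contDiff
    rw [show (2 : WithTop ℕ∞) = 1 + 1 by norm_num, contDiff_succ_iff_deriv] at this
    exact this.2.2
  have h2 : Continuous (deriv (deriv Y)) := (contDiff_one_iff_deriv.1 h1).2
  have hd1 : ∀ u, HasDerivAt Y (deriv Y u) u := fun u =>
    (hY.contDiff.differentiable (by norm_num) u).hasDerivAt
  have hd2 : ∀ u, HasDerivAt (deriv Y) (deriv (deriv Y) u) u := fun u =>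
    (h1.differentiable (by norm_num) u).hasDerivAt
  set σ : ℝ → ℝ := fun u => ‖deriv Y u‖ with hσ
  have hσ1 : ContDiff ℝ 1 σ := h1.norm ℝ hY.immersed
  have hσpos : ∀ u, 0 < σ u := fun u => norm_pos_iff.2 (hY.immersed u)
  have hσsq : ∀ u, σ u ^ 2 = deriv Y u 0 ^ 2 + deriv Y u 1 ^ 2 := fun u => by
    rw [hσ]
    simp only [norm_plane]
    exact Real.sq_sqrt (by positivity)
  have hσd : ∀ u, HasDerivAt σ ((deriv Y u 0 * deriv (deriv Y) u 0 +
      deriv Y u 1 * deriv (deriv Y) u 1) / σ u) u := fun u => by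
    obtain ⟨ha, hb⟩ := hasDerivAt_plane.1 (hd2 u)
    have hpos := hσsq u ▸ pow_pos (hσpos u) 2
    have := ((ha.pow 2).add (hb.pow 2)).sqrt hpos.ne'
    have e : σ = fun u => √(deriv Y u 0 ^ 2 + deriv Y u 1 ^ 2) := funext fun u => norm_plane _
    have e' : σ u = √(deriv Y u 0 ^ 2 + deriv Y u 1 ^ 2) := norm_plane _
    rw [e', e]
    convert! this using 1
    simp
    field_simp
  set c : ℝ → ℝ := fun u => deriv Y u 0 / σ u with hc
  set d : ℝ → ℝ := fun u => deriv Y u 1 / σ u with hd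
  set κ : ℝ → ℝ := curvature Y with hκ
  have hcd : ∀ u, c u ^ 2 + d u ^ 2 = 1 := fun u => by
    simp only [hc, hd, div_pow, ← add_div, ← hσsq]
    exact div_self (pow_pos (hσpos u) 2).ne'
  have hκeq : ∀ u, κ u = -(d u + Y u 1 * c u) ^ 3 := fun u => by
    have := hY.equation u
    rw [unitNormal, inner_contract_rotJ] at this
    rw [hκ, ← cbrt_pow_three (curvature Y u), ← this, unitTangent]
    simp [hc, hd, hσ, div_eq_inv_mul]
    ring
  -- Frenet equations for the unit tangent `(c, d)`: it turns at the rate `σ κ`.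
  have hcder : ∀ u, HasDerivAt c (-d u * (σ u * κ u)) u := fun u => by
    obtain ⟨ha, hb⟩ := hasDerivAt_plane.1 (hd2 u)
    convert! ha.div (hσd u) (hσpos u).ne' using 1
    have h0 := (hσpos u).ne'
    have hn : ‖deriv Y u‖ = σ u := rfl
    simp only [hd, hκ, curvature, hn]
    field_simp
    linear_combination (-deriv (deriv Y) u 0) * hσsq u
  have hdder : ∀ u, HasDerivAt d (c u * (σ u * κ u)) u := fun u => by
    obtain ⟨ha, hb⟩ := hasDerivAt_plane.1 (hd2 u)
    convert! hb.div (hσd u) (hσpos u).ne' using 1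
    have h0 := (hσpos u).ne'
    have hn : ‖deriv Y u‖ = σ u := rfl
    simp only [hc, hκ, curvature, hn]
    field_simp
    linear_combination (-deriv (deriv Y) u 1) * hσsq u
  have hcc : Continuous c := continuous_iff_continuousAt.2 fun u => (hcder u).continuousAt
  have hdc : Continuous d := continuous_iff_continuousAt.2 fun u => (hdder u).continuousAt
  have hσc : Continuous σ := hσ1.continuous
  have hYc : Continuous fun u => Y u 1 := continuous_iff_continuousAt.2 fun u =>
    (hasDerivAt_plane.1 (hd1 u)).2.continuousAt
  have hκc : Continuous κ := by
    rw [funext hκeq]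
    exact ((hdc.add (hYc.mul hcc)).pow 3).neg
  obtain ⟨θ, hθd, hceq, hdeq⟩ := exists_angle (hσc.mul hκc) hcder hdder (hcd 0)
  obtain ⟨x, y, ϑ, hF, hx0, hy0, hϑ0⟩ := IsFlow.exists_eq (Y 0 0) (Y 0 1) (θ 0)
  set φ : ℝ → ℝ := fun u => ∫ r in (0 : ℝ)..u, σ r with hφ
  have hφd : ∀ u, HasDerivAt φ (σ u) u := fun u =>
    (hσc.integral_hasStrictDerivAt 0 u).hasDerivAt
  have hφ0 : φ 0 = 0 := by simp [hφ]
  have hY0 : ∀ u, HasDerivAt (fun u => Y u 0) (σ u * Real.cos (θ u)) u := fun u => by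
    convert! (hasDerivAt_plane.1 (hd1 u)).1 using 1
    rw [← hceq]
    exact mul_div_cancel₀ _ (hσpos u).ne'
  have hY1 : ∀ u, HasDerivAt (fun u => Y u 1) (σ u * Real.sin (θ u)) u := fun u => by
    convert! (hasDerivAt_plane.1 (hd1 u)).2 using 1
    rw [← hdeq]
    exact mul_div_cancel₀ _ (hσpos u).ne'
  -- In the original parameter both pairs solve `z' = σ(u) V(z)`, where the time factor is the speed
  -- `σ`; no inverse of the arc length function is needed.
  have hpair : (fun u => (Y u 1, θ u)) = fun u => (y (φ u), ϑ (φ u)) := by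
    refine eq_of_hasDerivAt_smul locallyLipschitz_angleField hσc (t₀ := 0) (fun u => ?_)
      (fun u => ?_) (by simp [hφ0, hy0, hϑ0])
    · have hθu : HasDerivAt θ (σ u * κ u) u := hθd u
      have := (hY1 u).prodMk hθu
      rw [hκeq, hceq, hdeq] at this
      simpa [angleField] using this
    · simpa only [Function.comp_def] using! (hF.hasDerivAt_pair (φ u)).scomp u (hφd u)
  have hfst : ∀ u, Y u 0 = x (φ u) := fun u => by
    have hder : ∀ u, HasDerivAt (fun u => Y u 0 - x (φ u)) 0 u := fun u => by
      convert! (hY0 u).sub ((hF.hasDerivAt_fst (φ u)).comp u (hφd u)) using 1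
      rw [show θ u = ϑ (φ u) from congrArg Prod.snd (congrFun hpair u)]
      ring
    have := eq_of_hasDerivAt_zero hder u 0
    rw [hφ0, hx0] at this
    linarith
  refine ⟨x, y, ϑ, φ, hF, ?_, fun u => ?_, fun u => Plane.ext (hfst u)
    (congrArg Prod.fst (congrFun hpair u))⟩
  · rw [show (2 : WithTop ℕ∞) = 1 + 1 by norm_num, contDiff_succ_iff_deriv]
    refine ⟨fun s => (hφd s).differentiableAt, by simp, ?_⟩
    rw [funext fun s => (hφd s).deriv]
    exact hσ1
  · rw [(hφd u).deriv]
    exact hσpos u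

/-- If the curve is an arc of `W` via `φ`, and `W` is an arc of another flow curve via `ψ`, then
equality of the two unit speeds forces `(ψ ∘ φ)' = 1`. So `ψ ∘ φ` is a translation, and injectivity
of `ψ` makes `φ` surjective. -/
theorem IsFlow.isMaximalSolution {x y θ : ℝ → ℝ} (h : IsFlow x y θ) :
    IsMaximalSolution contractB translateC (planeCurve x y) := by
  refine ⟨h.isSolution, fun W φ hW hφ => ?_⟩
  obtain ⟨x', y', θ', ψ, hV, hψ⟩ := hW.exists_isFlow
  have hdφ : ∀ u, HasDerivAt φ (deriv φ u) u := fun u =>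
    (hφ.contDiff.differentiable (by norm_num) u).hasDerivAt
  have hdψ : ∀ u, HasDerivAt ψ (deriv ψ u) u := fun u =>
    (hψ.contDiff.differentiable (by norm_num) u).hasDerivAt
  have hχ : ∀ u, HasDerivAt (fun u => ψ (φ u)) (deriv ψ (φ u) * deriv φ u) u := fun u =>
    (hdψ (φ u)).comp u (hdφ u)
  have heq : planeCurve x y = fun u => planeCurve x' y' (ψ (φ u)) := funext fun u => by
    rw [hφ.eq_comp, hψ.eq_comp]
  have hone : ∀ u, deriv ψ (φ u) * deriv φ u = 1 := fun u => by
    have hpos := mul_pos (hψ.deriv_pos (φ u)) (hφ.deriv_pos u)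
    have h1 := (hV.hasDerivAt_planeCurve (ψ (φ u))).scomp u (hχ u)
    have h2 := h.norm_deriv_planeCurve u
    rw [heq] at h2
    have h3 := h1.deriv
    simp only [Function.comp_def] at h3
    rw [h3, norm_smul, ← congrFun hV.deriv_planeCurve, hV.norm_deriv_planeCurve, mul_one,
      Real.norm_eq_abs, abs_of_pos hpos] at h2
    exact h2
  have hder : ∀ u, HasDerivAt (fun u => ψ (φ u) - u) 0 u := fun u => by
    simpa [hone u] using! (hχ u).sub (hasDerivAt_id u)
  have hlin : ∀ u, ψ (φ u) = u + ψ (φ 0) := fun u => by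
    linarith [eq_of_hasDerivAt_zero hder u 0]
  have hinj : Function.Injective ψ := (strictMono_of_deriv_pos hψ.deriv_pos).injective
  intro v
  refine ⟨ψ v - ψ (φ 0), hinj ?_⟩
  rw [hlin]
  ring

theorem IsMaximalSolution.exists_isFlow {Y : ℝ → Plane}
    (hY : IsMaximalSolution contractB translateC Y) :
    ∃ x y θ, IsFlow x y θ ∧ range Y = range (planeCurve x y) := by
  obtain ⟨x, y, θ, φ, hF, hφ⟩ := hY.isSolution.exists_isFlow
  refine ⟨x, y, θ, hF, ?_⟩
  rw [show Y = planeCurve x y ∘ φ from funext hφ.eq_comp]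
  exact (hY.maximal _ _ hF.isSolution hφ).range_comp _

/-! ### Calculus lemmas -/

theorem lt_of_hasDerivAt_pos {g g' : ℝ → ℝ} {a b : ℝ} (hab : a < b)
    (hg : ∀ t ∈ Icc a b, HasDerivAt g (g' t) t) (h : ∀ t ∈ Ioo a b, 0 < g' t) : g a < g b := by
  have hmono : StrictMonoOn g (Icc a b) :=
    strictMonoOn_of_hasDerivWithinAt_pos (convex_Icc a b)
      (fun t ht => (hg t ht).continuousAt.continuousWithinAt)
      (f' := g') (fun t ht => (hg t (interior_subset ht)).hasDerivWithinAt)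
      (fun t ht => h t (by rwa [interior_Icc] at ht))
  exact hmono (left_mem_Icc.2 hab.le) (right_mem_Icc.2 hab.le) hab

theorem lt_of_hasDerivAt_neg {g g' : ℝ → ℝ} {a b : ℝ} (hab : a < b)
    (hg : ∀ t ∈ Icc a b, HasDerivAt g (g' t) t) (h : ∀ t ∈ Ioo a b, g' t < 0) : g b < g a := by
  have := lt_of_hasDerivAt_pos hab (g := fun t => -g t) (fun t ht => (hg t ht).neg)
    (fun t ht => neg_pos.2 (h t ht))
  simpa using this

theorem mul_sub_le_of_le_hasDerivAt {g g' : ℝ → ℝ} {a b c : ℝ} (hab : a ≤ b)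
    (hg : ∀ t ∈ Icc a b, HasDerivAt g (g' t) t) (h : ∀ t ∈ Ioo a b, c ≤ g' t) :
    c * (b - a) ≤ g b - g a := by
  rcases hab.eq_or_lt with rfl | hab
  · simp
  obtain ⟨t, ht, h1⟩ := exists_hasDerivAt_eq_slope g g' hab
    (fun t ht => (hg t ht).continuousAt.continuousWithinAt)
    (fun t ht => hg t (Ioo_subset_Icc_self ht))
  have h2 := h t ht
  rw [h1, le_div_iff₀ (sub_pos.2 hab)] at h2
  exact h2

theorem le_of_hasDerivAt_nonneg {g g' : ℝ → ℝ} {a b : ℝ} (hab : a ≤ b)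
    (hg : ∀ t ∈ Icc a b, HasDerivAt g (g' t) t) (h : ∀ t ∈ Ioo a b, 0 ≤ g' t) : g a ≤ g b := by
  have := mul_sub_le_of_le_hasDerivAt hab hg h
  linarith

theorem le_of_hasDerivAt_nonpos {g g' : ℝ → ℝ} {a b : ℝ} (hab : a ≤ b)
    (hg : ∀ t ∈ Icc a b, HasDerivAt g (g' t) t) (h : ∀ t ∈ Ioo a b, g' t ≤ 0) : g b ≤ g a := by
  have := le_of_hasDerivAt_nonneg hab (g := fun t => -g t) (fun t ht => (hg t ht).neg)
    (fun t ht => neg_nonneg.2 (h t ht))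
  simpa using this

theorem eventually_lt_left_of_hasDerivAt_pos {g : ℝ → ℝ} {g' m : ℝ} (hg : HasDerivAt g g' m)
    (h : 0 < g') : ∀ᶠ s in 𝓝[<] m, g s < g m := by
  have h1 := (hasDerivAt_iff_tendsto_slope.1 hg).mono_left
    (nhdsWithin_mono m (fun s (hs : s < m) => hs.ne))
  filter_upwards [h1.eventually (lt_mem_nhds h), self_mem_nhdsWithin] with s hs hsm
  rw [slope_def_field] at hs
  have hsm' : s - m < 0 := sub_neg.2 hsm
  rcases div_pos_iff.1 hs with h2 | h2 <;> linarith [h2.1, h2.2]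

theorem eventually_gt_right_of_hasDerivAt_pos {g : ℝ → ℝ} {g' m : ℝ} (hg : HasDerivAt g g' m)
    (h : 0 < g') : ∀ᶠ s in 𝓝[>] m, g m < g s := by
  have h1 := (hasDerivAt_iff_tendsto_slope.1 hg).mono_left
    (nhdsWithin_mono m (fun s (hs : m < s) => hs.ne'))
  filter_upwards [h1.eventually (lt_mem_nhds h), self_mem_nhdsWithin] with s hs hsm
  rw [slope_def_field] at hs
  have hsm' : 0 < s - m := sub_pos.2 hsm
  rcases div_pos_iff.1 hs with h2 | h2 <;> linarith [h2.1, h2.2]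

theorem exists_first_zero_Icc {g : ℝ → ℝ} {a b : ℝ} (hab : a ≤ b) (hg : ContinuousOn g (Icc a b))
    (h0 : 0 < g a) (h : g b ≤ 0) : ∃ t ∈ Ioc a b, g t = 0 ∧ ∀ s ∈ Ico a t, 0 < g s := by
  have hcl : IsCompact (Icc a b ∩ g ⁻¹' Iic 0) :=
    isCompact_Icc.of_isClosed_subset (hg.preimage_isClosed_of_isClosed isClosed_Icc isClosed_Iic)
      inter_subset_left
  obtain ⟨t, ht, hleast⟩ := hcl.exists_isLeast ⟨b, right_mem_Icc.2 hab, h⟩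
  have hlt : a < t := ht.1.1.lt_of_ne (by rintro rfl; exact absurd ht.2 (not_le.2 h0))
  have hpos : ∀ s ∈ Ico a t, 0 < g s := fun s hs => by
    by_contra! hneg
    exact absurd (hleast ⟨⟨hs.1, hs.2.le.trans ht.1.2⟩, hneg⟩) (not_le.2 hs.2)
  obtain ⟨c, hc, hgc0⟩ := intermediate_value_Icc' hlt.le (hg.mono (Icc_subset_Icc_right ht.1.2))
    ⟨ht.2, h0.le⟩
  rcases hc.2.eq_or_lt with rfl | hlt'
  · exact ⟨c, ⟨hlt, ht.1.2⟩, hgc0, hpos⟩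
  · exact absurd hgc0 (hpos c ⟨hc.1, hlt'⟩).ne'

theorem exists_first_zero {g : ℝ → ℝ} {t₀ : ℝ} (hg : ContinuousOn g (Ici t₀)) (h0 : 0 < g t₀)
    (h : ∃ t, t₀ ≤ t ∧ g t ≤ 0) : ∃ t₁, t₀ < t₁ ∧ g t₁ = 0 ∧ ∀ t ∈ Ico t₀ t₁, 0 < g t := by
  obtain ⟨b, hb, hgb⟩ := h
  obtain ⟨t, ht, h1, h2⟩ := exists_first_zero_Icc hb (hg.mono Icc_subset_Ici_self) h0 hgb
  exact ⟨t, ht.1, h1, h2⟩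

/-- A function that increases at each of its zeros stays positive. -/
theorem pos_of_hasDerivAt_of_barrier {g g' : ℝ → ℝ} {a b : ℝ}
    (hg : ∀ t ∈ Icc a b, HasDerivAt g (g' t) t) (h0 : 0 ≤ g a)
    (h : ∀ t ∈ Icc a b, g t = 0 → 0 < g' t) : ∀ t ∈ Ioc a b, 0 < g t := by
  intro t ht
  by_contra! hneg
  obtain ⟨a', ha', hpos⟩ : ∃ a' ∈ Ico a t, 0 < g a' := by
    rcases h0.eq_or_lt with h1 | h1
    · have ha : a ∈ Icc a b := ⟨le_rfl, ht.1.le.trans ht.2⟩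
      have := eventually_gt_right_of_hasDerivAt_pos (hg a ha) (h a ha h1.symm)
      obtain ⟨s, hs, hs'⟩ := (this.and (Ioo_mem_nhdsGT ht.1)).exists
      exact ⟨s, ⟨hs'.1.le, hs'.2⟩, h1 ▸ hs⟩
    · exact ⟨a, ⟨le_rfl, ht.1⟩, h1⟩
  obtain ⟨s, hs, hs0, hspos⟩ := exists_first_zero_Icc ha'.2.le (fun s hs =>
    (hg s ⟨ha'.1.trans hs.1, hs.2.trans ht.2⟩).continuousAt.continuousWithinAt) hpos hneg
  have hsab : s ∈ Icc a b := ⟨ha'.1.trans hs.1.le, hs.2.trans ht.2⟩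
  have hev := eventually_lt_left_of_hasDerivAt_pos (hg s hsab) (h s hsab hs0)
  obtain ⟨r, hr, hr'⟩ := (hev.and (Ioo_mem_nhdsLT hs.1)).exists
  rw [hs0] at hr
  exact absurd (hspos r ⟨hr'.1.le, hr'.2⟩) (not_lt.2 hr.le)

/-- If a function with bounded second derivative converges, then its derivative tends to `0`. -/
theorem tendsto_deriv_zero_of_tendsto {V V' V'' : ℝ → ℝ} {a C l : ℝ}
    (hV : ∀ t, a ≤ t → HasDerivAt V (V' t) t) (hV' : ∀ t, a ≤ t → HasDerivAt V' (V'' t) t)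
    (hC : ∀ t, a ≤ t → |V'' t| ≤ C) (hl : Tendsto V atTop (𝓝 l)) : Tendsto V' atTop (𝓝 0) := by
  have hC0 : 0 ≤ C := (abs_nonneg _).trans (hC a le_rfl)
  rw [Metric.tendsto_atTop]
  intro ε hε
  -- Within a step of length `δ` the derivative changes by at most `C δ < ε / 2`, and convergence of
  -- `V` makes it smaller than `ε / 2` somewhere in that step.
  set δ : ℝ := ε / (2 * (C + 1)) with hδ
  have hδ0 : 0 < δ := by positivity
  have hCδ : C * δ < ε / 2 := by
    rw [hδ, mul_div_assoc', div_lt_div_iff₀ (by positivity) (by norm_num)]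
    nlinarith
  have h1 : Tendsto (fun t => V (t + δ) - V t) atTop (𝓝 0) := by
    simpa using (hl.comp (tendsto_atTop_add_const_right _ δ tendsto_id)).sub hl
  obtain ⟨N, hN⟩ := (Metric.tendsto_atTop.1 h1) (ε / 2 * δ) (by positivity)
  refine ⟨max N a, fun t ht => ?_⟩
  have hta : a ≤ t := (le_max_right _ _).trans ht
  have h2 := hN t ((le_max_left _ _).trans ht)
  obtain ⟨s, hs, h3⟩ := exists_hasDerivAt_eq_slope V V' (lt_add_of_pos_right t hδ0)
    (fun r hr => (hV r (hta.trans hr.1)).continuousAt.continuousWithinAt)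
    (fun r hr => hV r (hta.trans hr.1.le))
  rw [add_sub_cancel_left] at h3
  have h4 : |V' s| < ε / 2 := by
    rw [Real.dist_eq, sub_zero] at h2
    rw [h3, abs_div, abs_of_pos hδ0, div_lt_iff₀ hδ0]
    exact h2
  have h5 : |V' s - V' t| ≤ C * (s - t) := by
    have := (convex_Icc t s).norm_image_sub_le_of_norm_hasDerivWithin_le (C := C) (f := V')
      (fun r hr => (hV' r (hta.trans hr.1)).hasDerivWithinAt)
      (fun r hr => hC r (hta.trans hr.1)) (left_mem_Icc.2 hs.1.le) (right_mem_Icc.2 hs.1.le)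
    rwa [Real.norm_eq_abs, Real.norm_eq_abs, abs_of_pos (sub_pos.2 hs.1)] at this
  have h6 : C * (s - t) ≤ C * δ := mul_le_mul_of_nonneg_left (by linarith [hs.2]) hC0
  rw [Real.dist_eq, sub_zero]
  rw [abs_lt] at h4 ⊢
  rw [abs_le] at h5
  constructor <;> linarith [h4.1, h4.2, h5.1, h5.2]

/-- A form of the mean value theorem for `Φ ∘ g`. -/
theorem exists_mul_eq_comp_sub {Φ φ g g' : ℝ → ℝ} {a b : ℝ} (hΦ : ContinuousOn Φ (Icc 0 1))
    (hΦ' : ∀ τ ∈ Ioo (0 : ℝ) 1, HasDerivAt Φ (φ τ) τ) (hab : a < b)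
    (hg : ∀ t ∈ Icc a b, HasDerivAt g (g' t) t) (hgm : ∀ t ∈ Icc a b, g t ∈ Icc (0 : ℝ) 1)
    (hgo : ∀ t ∈ Ioo a b, g t ∈ Ioo (0 : ℝ) 1) :
    ∃ t ∈ Ioo a b, φ (g t) * g' t * (b - a) = Φ (g b) - Φ (g a) := by
  obtain ⟨t, ht, h⟩ := exists_hasDerivAt_eq_slope (fun t => Φ (g t)) (fun t => φ (g t) * g' t) hab
    (hΦ.comp (fun t ht => (hg t ht).continuousAt.continuousWithinAt) hgm)
    (fun t ht => (hΦ' (g t) (hgo t ht)).comp t (hg t (Ioo_subset_Icc_self ht)))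
  refine ⟨t, ht, ?_⟩
  rw [h, div_mul_cancel₀ _ (sub_pos.2 hab).ne']

theorem intervalIntegrable_one_sub_rpow {r : ℝ} (hr : -1 < r) :
    IntervalIntegrable (fun s : ℝ => (1 - s) ^ r) MeasureTheory.volume 0 1 := by
  have := (intervalIntegral.intervalIntegrable_rpow' (a := 0) (b := 1) hr).comp_sub_left 1
  simpa using this.symm

/-- An improper integral with an integrable singularity at `1` and its dependence on the upper
limit. -/
theorem primitive_of_le_one_sub_rpow {u : ℝ → ℝ} {r : ℝ} (hr : -1 < r)
    (hu : ∀ s ∈ Ico (0 : ℝ) 1, ContinuousAt u s) (hu0 : ∀ s ∈ Ioo (0 : ℝ) 1, |u s| ≤ (1 - s) ^ r) :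
    ContinuousOn (fun τ => ∫ s in (0 : ℝ)..τ, u s) (Icc 0 1) ∧
      ∀ τ ∈ Ioo (0 : ℝ) 1, HasDerivAt (fun τ => ∫ s in (0 : ℝ)..τ, u s) (u τ) τ := by
  have hint : IntervalIntegrable u MeasureTheory.volume 0 1 := by
    have h1 := intervalIntegrable_one_sub_rpow hr
    rw [intervalIntegrable_iff_integrableOn_Ioo_of_le zero_le_one] at h1 ⊢
    refine h1.mono' ?_ ?_
    · exact ContinuousOn.aestronglyMeasurable
        (fun s hs => (hu s (Ioo_subset_Ico_self hs)).continuousWithinAt) measurableSet_Ioo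
    · exact (MeasureTheory.ae_restrict_iff' measurableSet_Ioo).2 (.of_forall hu0)
  refine ⟨?_, fun τ hτ => ?_⟩
  · rw [intervalIntegrable_iff_integrableOn_Icc_of_le zero_le_one,
      ← uIcc_of_le zero_le_one] at hint
    rw [← uIcc_of_le (zero_le_one (α := ℝ))]
    exact intervalIntegral.continuousOn_primitive_interval hint
  · have hsub : IntervalIntegrable u MeasureTheory.volume 0 τ := hint.mono_set (by
      rw [uIcc_of_le hτ.1.le, uIcc_of_le zero_le_one]
      exact Icc_subset_Icc_right hτ.2.le)
    refine intervalIntegral.integral_hasDerivAt_right hsub ?_ (hu τ (Ioo_subset_Ico_self hτ))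
    exact ContinuousOn.stronglyMeasurableAtFilter isOpen_Ioo
      (fun s hs => (hu s (Ioo_subset_Ico_self hs)).continuousWithinAt) τ hτ

/-- From `s ^ 4 ≤ s` on the unit interval, the integrand is at most `(1 - s) ^ (-1/2)`. -/
theorem primitive_gapB :
    ContinuousOn (fun τ => ∫ s in (0 : ℝ)..τ, 1 / √(1 - s ^ 4)) (Icc 0 1) ∧
      ∀ τ ∈ Ioo (0 : ℝ) 1,
        HasDerivAt (fun τ => ∫ s in (0 : ℝ)..τ, 1 / √(1 - s ^ 4)) (1 / √(1 - τ ^ 4)) τ := by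
  refine primitive_of_le_one_sub_rpow (r := -(1 / 2)) (by norm_num) (fun s hs => ?_)
    fun s hs => ?_
  · have h1 : 0 < 1 - s ^ 4 := sub_pos.2 (pow_lt_one₀ hs.1 hs.2 (by norm_num))
    have : √(1 - s ^ 4) ≠ 0 := (Real.sqrt_pos.2 h1).ne'
    fun_prop (disch := assumption)
  · have h0 : 0 < 1 - s := by linarith [hs.2]
    have h1 : s ^ 4 ≤ s := pow_le_of_le_one hs.1.le hs.2.le (by norm_num)
    rw [abs_of_nonneg (by positivity), Real.rpow_neg h0.le, ← Real.sqrt_eq_rpow, one_div]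
    exact inv_anti₀ (Real.sqrt_pos.2 h0) (Real.sqrt_le_sqrt (by linarith))

theorem primitive_gapA :
    ContinuousOn (fun τ => ∫ s in (0 : ℝ)..τ, (1 - s ^ 2) ^ (-(3 / 4) : ℝ)) (Icc 0 1) ∧
      ∀ τ ∈ Ioo (0 : ℝ) 1, HasDerivAt (fun τ => ∫ s in (0 : ℝ)..τ, (1 - s ^ 2) ^ (-(3 / 4) : ℝ))
        ((1 - τ ^ 2) ^ (-(3 / 4) : ℝ)) τ := by
  refine primitive_of_le_one_sub_rpow (r := -(3 / 4)) (by norm_num) (fun s hs => ?_)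
    fun s hs => ?_
  · have h1 : 0 < 1 - s ^ 2 := sub_pos.2 (pow_lt_one₀ hs.1 hs.2 (by norm_num))
    exact ContinuousAt.rpow_const (by fun_prop) (Or.inl h1.ne')
  · have h0 : 0 < 1 - s := by linarith [hs.2]
    have h1 : s ^ 2 ≤ s := pow_le_of_le_one hs.1.le hs.2.le (by norm_num)
    rw [abs_of_nonneg (Real.rpow_nonneg (by linarith) _)]
    exact Real.rpow_le_rpow_of_nonpos h0 (by linarith) (by norm_num)

/-! ### Solutions that are graphs over an interval -/

/-- `f` is a nontrivial solution of `f'' = -(f + f')³` on `I`, with derivative `p`. -/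
structure IsGraphSolution (f p : ℝ → ℝ) (I : Set ℝ) : Prop where
  hasDerivAt_fun : ∀ t ∈ I, HasDerivAt f (p t) t
  hasDerivAt_deriv : ∀ t ∈ I, HasDerivAt p (-(f t + p t) ^ 3) t
  ne_zero : ∀ t ∈ I, ¬(f t = 0 ∧ p t = 0)

namespace IsGraphSolution

variable {f p : ℝ → ℝ} {I : Set ℝ} {a b : ℝ}

theorem mono {J : Set ℝ} (h : IsGraphSolution f p I) (hJ : J ⊆ I) : IsGraphSolution f p J :=
  ⟨fun t ht => h.1 t (hJ ht), fun t ht => h.2 t (hJ ht), fun t ht => h.3 t (hJ ht)⟩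

theorem neg (h : IsGraphSolution f p I) :
    IsGraphSolution (fun t => -f t) (fun t => -p t) I := by
  refine ⟨fun t ht => (h.1 t ht).neg, fun t ht => ?_, fun t ht h0 => h.3 t ht ?_⟩
  · convert! (h.2 t ht).neg using 1
    ring
  · simpa using h0

theorem hasDerivAt_add (h : IsGraphSolution f p I) {t : ℝ} (ht : t ∈ I) :
    HasDerivAt (fun t => f t + p t) (p t - (f t + p t) ^ 3) t := by
  convert! (h.1 t ht).add (h.2 t ht) using 1

/-- With `w = f + p` the system is `p' = -w³`, `w' = p - w³`: a Hamiltonian motion with a damping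
term, which makes this energy decrease. -/
theorem hasDerivAt_energy (h : IsGraphSolution f p I) {t : ℝ} (ht : t ∈ I) :
    HasDerivAt (fun t => p t ^ 2 / 2 + (f t + p t) ^ 4 / 4) (-(f t + p t) ^ 6) t := by
  convert! (((h.2 t ht).pow 2).div_const 2).add (((h.hasDerivAt_add ht).pow 4).div_const 4) using 1
  simp
  ring

/-- A second decreasing function, for comparisons at extrema and zeros, where `p` or `f` vanishes.
The form `3 f² + 3 f p + p²` is positive definite. -/
theorem hasDerivAt_height_energy (h : IsGraphSolution f p I) {t : ℝ} (ht : t ∈ I) :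
    HasDerivAt (fun t => p t ^ 2 / 2 + f t ^ 4 / 4)
      (-(p t ^ 2 * (3 * f t ^ 2 + 3 * f t * p t + p t ^ 2))) t := by
  convert! (((h.2 t ht).pow 2).div_const 2).add (((h.1 t ht).pow 4).div_const 4) using 1
  simp
  ring

theorem energy_lt (h : IsGraphSolution f p (Icc a b)) (hab : a < b)
    (hw : ∀ t ∈ Ioo a b, f t + p t ≠ 0) :
    p b ^ 2 / 2 + (f b + p b) ^ 4 / 4 < p a ^ 2 / 2 + (f a + p a) ^ 4 / 4 :=
  lt_of_hasDerivAt_neg hab (fun _ ht => h.hasDerivAt_energy ht)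
    (fun t ht => neg_lt_zero.2 ((by decide : Even 6).pow_pos (hw t ht)))

theorem energy_le (h : IsGraphSolution f p (Icc a b)) (hab : a ≤ b) :
    p b ^ 2 / 2 + (f b + p b) ^ 4 / 4 ≤ p a ^ 2 / 2 + (f a + p a) ^ 4 / 4 :=
  le_of_hasDerivAt_nonpos hab (fun _ ht => h.hasDerivAt_energy ht)
    (fun t _ => neg_nonpos.2 ((by decide : Even 6).pow_nonneg _))

theorem height_energy_lt (h : IsGraphSolution f p (Icc a b)) (hab : a < b)
    (hp : ∀ t ∈ Ioo a b, p t ≠ 0) :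
    p b ^ 2 / 2 + f b ^ 4 / 4 < p a ^ 2 / 2 + f a ^ 4 / 4 := by
  refine lt_of_hasDerivAt_neg hab (fun _ ht => h.hasDerivAt_height_energy ht)
    (fun t ht => neg_lt_zero.2 (mul_pos (sq_pos_of_ne_zero (hp t ht)) ?_))
  nlinarith [sq_nonneg (2 * f t + p t), sq_pos_of_ne_zero (hp t ht)]

/-- While the slope is positive, so is `f + f'`. -/
theorem add_pos_of_pos (h : IsGraphSolution f p (Icc a b)) (hw : 0 ≤ f a + p a)
    (hp : ∀ t ∈ Ico a b, 0 < p t) : ∀ t ∈ Ico a b, a < t → 0 < f t + p t := by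
  intro t ht hat
  refine pos_of_hasDerivAt_of_barrier (g := fun t => f t + p t) (a := a) (b := t)
    (fun s hs => h.hasDerivAt_add ⟨hs.1, hs.2.trans ht.2.le⟩) hw (fun s hs h0 => ?_) t ⟨hat, le_rfl⟩
  rw [show f s + p s = 0 from h0]
  simpa using hp s ⟨hs.1, hs.2.trans_lt ht.2⟩

/-- A solution with positive slope and `f + f' ≥ 0` runs up to a positive maximum. -/
theorem exists_max (h : IsGraphSolution f p (Ici a)) (hw : 0 ≤ f a + p a) (hp : 0 < p a) :
    ∃ b, a < b ∧ p b = 0 ∧ 0 < f b ∧ (∀ t ∈ Ico a b, 0 < p t) ∧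
      ∀ t ∈ Ioc a b, 0 < f t + p t := by
  have hpc : ContinuousOn p (Ici a) := fun t ht => (h.2 t ht).continuousAt.continuousWithinAt
  have hex : ∃ t, a ≤ t ∧ p t ≤ 0 := by
    by_contra! hpos
    have hwpos : ∀ t, a < t → 0 < f t + p t := fun t ht =>
      (h.mono (J := Icc a (t + 1)) Icc_subset_Ici_self).add_pos_of_pos hw
        (fun s hs => hpos s hs.1) t ⟨ht.le, lt_add_one t⟩ ht
    obtain ⟨c, hac, hc⟩ : ∃ c, a < c ∧ 0 < f c := by
      by_contra! hf
      -- here `1 / p - f` is decreasing, so that the slope is bounded below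
      set C := 1 / p (a + 1) - f (a + 1) with hC
      have hCb : ∀ t, a + 1 ≤ t → 1 / p t ≤ C := by
        intro t ht
        have := le_of_hasDerivAt_nonpos ht (g := fun t => (p t)⁻¹ - f t)
          (fun s hs => ((h.2 s (by simp; linarith [hs.1])).inv
            (hpos s (by linarith [hs.1])).ne').sub (h.1 s (by simp; linarith [hs.1])))
          (fun s hs => ?_)
        · have h1 := hf t (by linarith)
          rw [hC, one_div, one_div]
          linarith
        · have hs' : a < s := by linarith [hs.1]
          have h1 := hpos s hs'.le
          have h2 := hwpos s hs'
          have h3 : (f s + p s) ^ 3 ≤ p s ^ 3 :=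
            pow_le_pow_left₀ h2.le (by linarith [hf s hs']) 3
          rw [neg_neg, sub_nonpos, div_le_iff₀ (by positivity)]
          linarith
      have hCpos : 0 < C := lt_of_lt_of_le (one_div_pos.2 (hpos (a + 1) (by linarith)))
        (hCb (a + 1) le_rfl)
      have hlow : ∀ t, a + 1 ≤ t → 1 / C ≤ p t := fun t ht => by
        have := hpos t (by linarith)
        rw [div_le_iff₀ hCpos]
        have h2 := hCb t ht
        rwa [div_le_iff₀ this, mul_comm] at h2
      set T := a + 1 + (-f (a + 1) + 1) * C with hT
      have hT' : a + 1 ≤ T := by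
        have := hf (a + 1) (by linarith)
        have : 0 ≤ (-f (a + 1) + 1) * C := mul_nonneg (by linarith) hCpos.le
        linarith
      have := mul_sub_le_of_le_hasDerivAt hT' (g := f) (c := 1 / C)
        (fun s hs => h.1 s (by simp; linarith [hs.1])) (fun s hs => hlow s hs.1.le)
      have h3 : 1 / C * (T - (a + 1)) = -f (a + 1) + 1 := by
        rw [hT]
        field_simp
        ring
      linarith [hf T (by linarith)]
    -- here the slope decreases at least linearly
    have hlow : ∀ t, c ≤ t → f c ≤ f t := fun t ht =>
      le_of_hasDerivAt_nonneg ht (fun s hs => h.1 s (hac.le.trans hs.1))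
        (fun s hs => (hpos s (hac.le.trans hs.1.le)).le)
    have hc3 : 0 < f c ^ 3 := by positivity
    set T := c + p c / f c ^ 3 with hT
    have hcT : c ≤ T := by
      have := hpos c hac.le
      have : 0 < p c / f c ^ 3 := by positivity
      linarith
    have := mul_sub_le_of_le_hasDerivAt hcT (g := fun t => -p t) (c := f c ^ 3)
      (fun s hs => (h.2 s (hac.le.trans hs.1)).neg) (fun s hs => ?_)
    · have h3 : f c ^ 3 * (T - c) = p c := by
        rw [hT]
        field_simp
        ring
      linarith [hpos T (hac.le.trans hcT)]
    · have h4 := hlow s hs.1.le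
      have h5 := hpos s (hac.le.trans hs.1.le)
      rw [neg_neg]
      exact pow_le_pow_left₀ hc.le (by linarith) 3
  obtain ⟨b, hab, hpb, hpos⟩ := exists_first_zero hpc hp hex
  have hw1 : ∀ t ∈ Ico a b, a < t → 0 < f t + p t :=
    (h.mono Icc_subset_Ici_self).add_pos_of_pos hw hpos
  have hfb : 0 < f b := by
    have hge : 0 ≤ f b + p b := by
      have hc : ContinuousWithinAt (fun t => f t + p t) (Ioo a b) b :=
        (h.hasDerivAt_add hab.le).continuousAt.continuousWithinAt
      have : (𝓝[Ioo a b] b).NeBot := by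
        rw [← mem_closure_iff_nhdsWithin_neBot, closure_Ioo hab.ne]
        exact right_mem_Icc.2 hab.le
      refine ge_of_tendsto hc ?_
      filter_upwards [self_mem_nhdsWithin] with t ht
      exact (hw1 t ⟨ht.1.le, ht.2⟩ ht.1).le
    refine lt_of_le_of_ne (by linarith) fun h0 => h.3 b hab.le ⟨h0.symm, hpb⟩
  refine ⟨b, hab, hpb, hfb, hpos, fun t ht => ?_⟩
  rcases ht.2.eq_or_lt with rfl | hlt
  · linarith
  · exact hw1 t ⟨ht.1.le, hlt⟩ ht.1

/-- After a positive maximum there is an inflection point. -/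
theorem exists_inflection (h : IsGraphSolution f p (Ici a)) (hp : p a = 0) (hf : 0 < f a) :
    ∃ b, a < b ∧ f b + p b = 0 ∧ (∀ t ∈ Ico a b, 0 < f t + p t) ∧ ∀ t ∈ Ioc a b, p t < 0 := by
  have hwc : ContinuousOn (fun t => f t + p t) (Ici a) := fun t ht =>
    (h.hasDerivAt_add ht).continuousAt.continuousWithinAt
  have hanti : ∀ b, (∀ t ∈ Ico a b, 0 < f t + p t) → ∀ s t, a ≤ s → s < t → t ≤ b →
      p t < p s := fun b hb s t has hst htb =>
    lt_of_hasDerivAt_neg hst (fun r hr => h.2 r (has.trans hr.1))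
      (fun r hr => neg_lt_zero.2 (pow_pos (hb r ⟨has.trans hr.1.le, hr.2.trans_le htb⟩) 3))
  have hex : ∃ t, a ≤ t ∧ f t + p t ≤ 0 := by
    by_contra! hpos
    have hanti' : ∀ s t, a ≤ s → s < t → p t < p s := fun s t has hst =>
      hanti t (fun r hr => hpos r hr.1) s t has hst le_rfl
    have hneg : p (a + 1) < 0 := hp ▸ hanti' a (a + 1) le_rfl (lt_add_one a)
    -- The slope vanishes at `a` and is strictly negative from `a + 1` on. By time `T` the height
    -- has dropped by at least `|f (a + 1)|`, which contradicts `f + p > 0`.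
    set T := a + 1 + |f (a + 1)| / (-p (a + 1)) with hT
    have hle : a + 1 ≤ T := by
      have : 0 ≤ |f (a + 1)| / (-p (a + 1)) := div_nonneg (abs_nonneg _) (by linarith)
      linarith
    have hle' : ∀ t, a + 1 ≤ t → p t ≤ p (a + 1) := fun t ht => by
      rcases ht.eq_or_lt with rfl | hlt
      · exact le_rfl
      · exact (hanti' (a + 1) t (by linarith) hlt).le
    have := mul_sub_le_of_le_hasDerivAt hle (g := fun t => -f t) (c := -p (a + 1))
      (fun s hs => (h.1 s (by simp; linarith [hs.1])).neg)
      (fun s hs => neg_le_neg (hle' s hs.1.le))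
    have h3 : -p (a + 1) * (T - (a + 1)) = |f (a + 1)| := by
      rw [hT]
      have : p (a + 1) ≠ 0 := hneg.ne
      field_simp
      ring
    linarith [hpos T (by linarith), hle' T hle, le_abs_self (f (a + 1))]
  obtain ⟨b, hab, hb, hpos⟩ := exists_first_zero hwc (by simpa [hp] using hf) hex
  exact ⟨b, hab, hb, hpos, fun t ht => hp ▸ hanti b hpos a t le_rfl ht.1 ht.2⟩

end IsGraphSolution

/-! ### Arches between consecutive extrema and their gap estimates. -/

/-- The part of a solution between a positive maximum `a` and the next minimum `b`, with inflection
point `y` and zero `z`. -/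
structure IsArch (f p : ℝ → ℝ) (a y z b : ℝ) : Prop where
  lt_inflection : a < y
  inflection_lt : y < z
  lt_end : z < b
  slope_start : p a = 0
  start_pos : 0 < f a
  add_pos : ∀ t ∈ Ico a y, 0 < f t + p t
  add_eq_zero : f y + p y = 0
  add_neg : ∀ t ∈ Ioc y b, f t + p t < 0
  slope_neg : ∀ t ∈ Ioo a b, p t < 0
  slope_end : p b = 0
  end_neg : f b < 0
  zero : f z = 0

/-- From the inflection point on, `-f` has positive slope and vanishing `f + f'`, so `exists_max`
applied to `-f` supplies the minimum. -/
theorem IsGraphSolution.exists_isArch {f p : ℝ → ℝ} {a : ℝ} (h : IsGraphSolution f p (Ici a))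
    (hp : p a = 0) (hf : 0 < f a) : ∃ y z b, IsArch f p a y z b := by
  obtain ⟨y, hay, hy, hw, hpy⟩ := h.exists_inflection hp hf
  obtain ⟨b, hyb, hpb, hfb, hpb', hwb⟩ := (h.mono (Ici_subset_Ici.2 hay.le)).neg.exists_max
    (by linarith) (neg_pos.2 (hpy y (right_mem_Ioc.2 hay)))
  have hfy : 0 < f y := by linarith [hpy y (right_mem_Ioc.2 hay)]
  have hfc : ContinuousOn f (Icc y b) := fun t ht =>
    (h.1 t (hay.le.trans ht.1)).continuousAt.continuousWithinAt
  obtain ⟨z, hz, hz0⟩ := intermediate_value_Ioo' hyb.le hfc (show (0 : ℝ) ∈ Ioo (f b) (f y) from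
    ⟨by linarith, hfy⟩)
  refine ⟨y, z, b, hay, hz.1, hz.2, hp, hf, hw, hy, fun t ht => ?_, fun t ht => ?_, by linarith,
    by linarith, hz0⟩
  · linarith [hwb t ht]
  · rcases le_or_gt t y with hty | hty
    · exact hpy t ⟨ht.1, hty⟩
    · linarith [hpb' t ⟨hty.le, ht.2⟩]

namespace IsArch

variable {f p : ℝ → ℝ} {a y z b : ℝ}

theorem start_lt_end (h : IsArch f p a y z b) : a < b :=
  h.lt_inflection.trans (h.inflection_lt.trans h.lt_end)

theorem strictAntiOn (h : IsArch f p a y z b) (hs : IsGraphSolution f p (Icc a b)) :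
    StrictAntiOn f (Icc a b) := fun _ hs' _ ht hst =>
  lt_of_hasDerivAt_neg hst (fun r hr => hs.1 r ⟨hs'.1.trans hr.1, hr.2.trans ht.2⟩)
    (fun r hr => h.slope_neg r ⟨hs'.1.trans_lt hr.1, hr.2.trans_le ht.2⟩)

theorem slope_inflection_neg (h : IsArch f p a y z b) : p y < 0 :=
  h.slope_neg y ⟨h.lt_inflection, h.inflection_lt.trans h.lt_end⟩

end IsArch

/-- With `u = 1 - (p / P) ^ 2`, the number `r` is the value that `|f + p|` would have at slope `p`
if the energy `P ^ 2 / 2` of the inflection point were conserved. The last identity reconciles the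
powers `3 / 4` in the integrand of `A`. -/
theorem rpow_three_fourths_mul {P u : ℝ} (hP : 0 < P) (hu : 0 < u) :
    ∃ r, 0 < r ∧ r ^ 4 = 2 * P ^ 2 * u ∧
      (2 : ℝ) ^ (-(3 / 4) : ℝ) * u ^ (-(3 / 4) : ℝ) * r ^ 3 = P * √P := by
  have h0 : 0 < 2 * P ^ 2 * u := by positivity
  refine ⟨(2 * P ^ 2 * u) ^ (1 / 4 : ℝ), by positivity, ?_, ?_⟩
  · rw [← Real.rpow_natCast, ← Real.rpow_mul h0.le]
    norm_num
  · have e1 : ((2 * P ^ 2 * u) ^ (1 / 4 : ℝ)) ^ 3 =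
        (2 : ℝ) ^ (3 / 4 : ℝ) * (P * √P) * u ^ (3 / 4 : ℝ) := by
      rw [← Real.rpow_natCast, ← Real.rpow_mul h0.le, Real.mul_rpow (by positivity) hu.le,
        Real.mul_rpow (by norm_num) (by positivity), Real.sqrt_eq_rpow]
      norm_num
      left
      rw [← Real.rpow_natCast, ← Real.rpow_mul hP.le]
      nth_rewrite 2 [← Real.rpow_one P]
      rw [← Real.rpow_add hP]
      norm_num
    rw [e1, Real.rpow_neg (by norm_num), Real.rpow_neg hu.le]
    have h1 : (2 : ℝ) ^ (3 / 4 : ℝ) ≠ 0 := (Real.rpow_pos_of_pos (by norm_num) _).ne'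
    have h2 : u ^ (3 / 4 : ℝ) ≠ 0 := (Real.rpow_pos_of_pos hu _).ne'
    field_simp

namespace IsArch

variable {f p : ℝ → ℝ} {a y z b : ℝ}

/-- Since `p' = -(f + p)³` changes sign at `y`, the slope is steepest there. Thus `p / p y` can
serve as integration variable on either side. -/
theorem slope_lt_slope (h : IsArch f p a y z b) (hs : IsGraphSolution f p (Icc a b)) {t : ℝ}
    (ht : t ∈ Icc a b) (hty : t ≠ y) : p y < p t := by
  rcases lt_or_gt_of_ne hty with hlt | hlt
  · exact lt_of_hasDerivAt_neg hlt (fun r hr => hs.2 r ⟨ht.1.trans hr.1,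
      hr.2.trans (h.inflection_lt.trans h.lt_end).le⟩)
      (fun r hr => neg_lt_zero.2 (pow_pos (h.add_pos r ⟨ht.1.trans hr.1.le, hr.2⟩) 3))
  · exact lt_of_hasDerivAt_pos hlt (fun r hr => hs.2 r ⟨h.lt_inflection.le.trans hr.1,
      hr.2.trans ht.2⟩)
      (fun r hr => neg_pos.2 ((by decide : Odd 3).pow_neg (h.add_neg r ⟨hr.1, hr.2.le.trans ht.2⟩)))

/-- Before `y` the energy exceeds its value `P² / 2` at `y`, so `f + p` exceeds the `r` of the
conserved motion, and `-p / P` rises from `0` to `1` faster than in that motion, which takes the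
time `A / √P`. -/
theorem inflection_gap_left (h : IsArch f p a y z b) (hs : IsGraphSolution f p (Icc a b)) :
    y - a < gapA / √|p y| := by
  have hyb : y < b := h.inflection_lt.trans h.lt_end
  have hpy := h.slope_inflection_neg
  rw [abs_of_neg hpy]
  set P := -p y with hP
  have hP0 : 0 < P := neg_pos.2 hpy
  have hmem : ∀ t ∈ Ioo a y, -p t / P ∈ Ioo (0 : ℝ) 1 := fun t ht =>
    ⟨div_pos (neg_pos.2 (h.slope_neg t ⟨ht.1, ht.2.trans hyb⟩)) hP0, (div_lt_one hP0).2
      (neg_lt_neg (h.slope_lt_slope hs ⟨ht.1.le, (ht.2.trans hyb).le⟩ ht.2.ne))⟩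
  have ea : -p a / P = 0 := by simp [h.slope_start]
  have ey : -p y / P = 1 := div_self hP0.ne'
  have hmem' : ∀ t ∈ Icc a y, -p t / P ∈ Icc (0 : ℝ) 1 := fun t ht => by
    rcases ht.1.eq_or_lt with rfl | hat
    · simp [ea]
    · rcases ht.2.eq_or_lt with rfl | hty
      · simp [ey]
      · exact Ioo_subset_Icc_self (hmem t ⟨hat, hty⟩)
  obtain ⟨t, ht, e⟩ := exists_mul_eq_comp_sub (g := fun t => -p t / P) primitive_gapA.1 primitive_gapA.2 h.lt_inflection
    (fun t ht => ((hs.2 t ⟨ht.1, ht.2.trans hyb.le⟩).neg.div_const P)) hmem' hmem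
  rw [ea, ey, intervalIntegral.integral_same, sub_zero, neg_neg] at e
  obtain ⟨r, hr0, hr4, hr3⟩ := rpow_three_fourths_mul hP0
    (u := 1 - (-p t / P) ^ 2) (by nlinarith [(hmem t ht).1, (hmem t ht).2])
  have hG := (hs.mono (Icc_subset_Icc ht.1.le hyb.le)).energy_lt ht.2
    (fun s hs => (h.add_pos s ⟨ht.1.le.trans hs.1.le, hs.2⟩).ne')
  have hw := h.add_pos t ⟨ht.1.le, ht.2⟩
  have h4 : r ^ 4 < (f t + p t) ^ 4 := by
    have e2 : 2 * P ^ 2 * (1 - (-p t / P) ^ 2) = 2 * (p y ^ 2 - p t ^ 2) := by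
      have hP2 : P ^ 2 = p y ^ 2 := by rw [hP]; ring
      rw [div_pow, ← hP2]
      field_simp
    rw [hr4, e2]
    rw [h.add_eq_zero] at hG
    linarith
  have h3 : r ^ 3 < (f t + p t) ^ 3 :=
    pow_lt_pow_left₀ (lt_of_pow_lt_pow_left₀ 4 hw.le h4) hr0.le (by norm_num)
  rw [lt_div_iff₀ (Real.sqrt_pos.2 hP0), gapA, ← e]
  set c := (1 - (-p t / P) ^ 2) ^ (-(3 / 4) : ℝ) with hc
  have hc0 : 0 < c := Real.rpow_pos_of_pos (by nlinarith [(hmem t ht).1, (hmem t ht).2]) _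
  have h20 : (0 : ℝ) < 2 ^ (-(3 / 4) : ℝ) := Real.rpow_pos_of_pos (by norm_num) _
  have e3 : (2 : ℝ) ^ (-(3 / 4) : ℝ) * (c * ((f t + p t) ^ 3 / P) * (y - a)) =
      2 ^ (-(3 / 4) : ℝ) * c * (f t + p t) ^ 3 / P * (y - a) := by ring
  rw [e3, mul_comm]
  refine mul_lt_mul_of_pos_right ?_ (sub_pos.2 h.lt_inflection)
  rw [lt_div_iff₀ hP0, mul_comm, ← hr3]
  exact mul_lt_mul_of_pos_left h3 (mul_pos h20 hc0)

/-- After `y` the energy is below `P² / 2`, which reverses the comparison: the slope takes longer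
than `A / √P` to return to `0`. -/
theorem inflection_gap_right (h : IsArch f p a y z b) (hs : IsGraphSolution f p (Icc a b)) :
    gapA / √|p y| < b - y := by
  have hyb : y < b := h.inflection_lt.trans h.lt_end
  have hpy := h.slope_inflection_neg
  rw [abs_of_neg hpy]
  set P := -p y with hP
  have hP0 : 0 < P := neg_pos.2 hpy
  have hmem : ∀ t ∈ Ioo y b, -p t / P ∈ Ioo (0 : ℝ) 1 := fun t ht =>
    ⟨div_pos (neg_pos.2 (h.slope_neg t ⟨h.lt_inflection.trans ht.1, ht.2⟩)) hP0,
      (div_lt_one hP0).2 (neg_lt_neg (h.slope_lt_slope hs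
        ⟨(h.lt_inflection.trans ht.1).le, ht.2.le⟩ ht.1.ne'))⟩
  have eb : -p b / P = 0 := by simp [h.slope_end]
  have ey : -p y / P = 1 := div_self hP0.ne'
  have hmem' : ∀ t ∈ Icc y b, -p t / P ∈ Icc (0 : ℝ) 1 := fun t ht => by
    rcases ht.2.eq_or_lt with rfl | htb
    · simp [eb]
    · rcases ht.1.eq_or_lt with rfl | hty
      · simp [ey]
      · exact Ioo_subset_Icc_self (hmem t ⟨hty, htb⟩)
  obtain ⟨t, ht, e⟩ := exists_mul_eq_comp_sub (g := fun t => -p t / P) primitive_gapA.1 primitive_gapA.2 hyb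
    (fun t ht => ((hs.2 t ⟨h.lt_inflection.le.trans ht.1, ht.2⟩).neg.div_const P))
    hmem' hmem
  rw [eb, ey, intervalIntegral.integral_same, zero_sub, neg_neg] at e
  obtain ⟨r, hr0, hr4, hr3⟩ := rpow_three_fourths_mul hP0
    (u := 1 - (-p t / P) ^ 2) (by nlinarith [(hmem t ht).1, (hmem t ht).2])
  have hG := (hs.mono (Icc_subset_Icc h.lt_inflection.le ht.2.le)).energy_lt ht.1
    (fun s hs => (h.add_neg s ⟨hs.1, hs.2.le.trans ht.2.le⟩).ne)
  have hw := h.add_neg t ⟨ht.1, ht.2.le⟩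
  have h4 : (-(f t + p t)) ^ 4 < r ^ 4 := by
    have e2 : 2 * P ^ 2 * (1 - (-p t / P) ^ 2) = 2 * (p y ^ 2 - p t ^ 2) := by
      have hP2 : P ^ 2 = p y ^ 2 := by rw [hP]; ring
      rw [div_pow, ← hP2]
      field_simp
    rw [hr4, e2, (by decide : Even 4).neg_pow]
    rw [h.add_eq_zero] at hG
    linarith
  have h3 : (-(f t + p t)) ^ 3 < r ^ 3 :=
    pow_lt_pow_left₀ (lt_of_pow_lt_pow_left₀ 4 hr0.le h4) (neg_pos.2 hw).le (by norm_num)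
  rw [div_lt_iff₀ (Real.sqrt_pos.2 hP0), gapA]
  set c := (1 - (-p t / P) ^ 2) ^ (-(3 / 4) : ℝ) with hc
  have hc0 : 0 < c := Real.rpow_pos_of_pos (by nlinarith [(hmem t ht).1, (hmem t ht).2]) _
  have h20 : (0 : ℝ) < 2 ^ (-(3 / 4) : ℝ) := Real.rpow_pos_of_pos (by norm_num) _
  have e4 : (∫ s in (0 : ℝ)..1, (1 - s ^ 2) ^ (-(3 / 4) : ℝ)) =
      c * ((-(f t + p t)) ^ 3 / P) * (b - y) := by
    rw [← neg_inj, ← e]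
    ring
  rw [e4]
  have e3 : (2 : ℝ) ^ (-(3 / 4) : ℝ) * (c * ((-(f t + p t)) ^ 3 / P) * (b - y)) =
      2 ^ (-(3 / 4) : ℝ) * c * (-(f t + p t)) ^ 3 / P * (b - y) := by ring
  rw [e3, mul_comm (b - y)]
  refine mul_lt_mul_of_pos_right ?_ (sub_pos.2 hyb)
  rw [div_lt_iff₀ hP0, mul_comm (√P), ← hr3]
  exact mul_lt_mul_of_pos_left h3 (mul_pos h20 hc0)

/-- After the maximum `p² / 2 + f⁴ / 4` is below its initial value `f(a)⁴ / 4`. The descent is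
slower than in the motion that conserves this function, which needs the time `B / f a` to reach
height `0`. -/
theorem zero_gap_left (h : IsArch f p a y z b) (hs : IsGraphSolution f p (Icc a b)) :
    gapB / |f a| < z - a := by
  have haz : a < z := h.lt_inflection.trans h.inflection_lt
  have hα := h.start_pos
  have hanti := h.strictAntiOn hs
  rw [abs_of_pos hα]
  have hmem : ∀ t ∈ Ioo a z, f t / f a ∈ Ioo (0 : ℝ) 1 := fun t ht => by
    have hta : t ∈ Icc a b := ⟨ht.1.le, (ht.2.trans h.lt_end).le⟩
    have h1 := hanti (left_mem_Icc.2 h.start_lt_end.le) hta ht.1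
    have h2 := hanti hta ⟨haz.le, h.lt_end.le⟩ ht.2
    rw [h.zero] at h2
    exact ⟨div_pos h2 hα, (div_lt_one hα).2 h1⟩
  have ea : f a / f a = 1 := div_self hα.ne'
  have ez : f z / f a = 0 := by simp [h.zero]
  have hmem' : ∀ t ∈ Icc a z, f t / f a ∈ Icc (0 : ℝ) 1 := fun t ht => by
    rcases ht.1.eq_or_lt with rfl | hat
    · simp [ea]
    · rcases ht.2.eq_or_lt with rfl | htz
      · simp [ez]
      · exact Ioo_subset_Icc_self (hmem t ⟨hat, htz⟩)
  obtain ⟨t, ht, e⟩ := exists_mul_eq_comp_sub (g := fun t => f t / f a) primitive_gapB.1 primitive_gapB.2 haz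
    (fun t ht => ((hs.1 t ⟨ht.1, ht.2.trans h.lt_end.le⟩).div_const (f a))) hmem' hmem
  rw [ea, ez, intervalIntegral.integral_same, zero_sub] at e
  have htb : t < b := ht.2.trans h.lt_end
  have hH := (hs.mono (Icc_subset_Icc_right htb.le)).height_energy_lt ht.1
    (fun s hs => (h.slope_neg s ⟨hs.1, hs.2.trans htb⟩).ne)
  rw [h.slope_start] at hH
  obtain ⟨hm0, hm1⟩ := hmem t ht
  have hu : 0 < 1 - (f t / f a) ^ 4 := sub_pos.2 (pow_lt_one₀ hm0.le hm1 (by norm_num))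
  have hp := h.slope_neg t ⟨ht.1, htb⟩
  have hlt : √2 * -p t < f a ^ 2 * √(1 - (f t / f a) ^ 4) := by
    refine lt_of_pow_lt_pow_left₀ 2 (by positivity) ?_
    rw [mul_pow, mul_pow, Real.sq_sqrt hu.le, Real.sq_sqrt (by norm_num)]
    field_simp
    linarith
  rw [div_lt_iff₀ hα, gapB]
  have e2 : (∫ s in (0 : ℝ)..1, 1 / √(1 - s ^ 4)) =
      -p t / (f a * √(1 - (f t / f a) ^ 4)) * (z - a) := by
    rw [← neg_inj, ← e]
    field_simp
  rw [e2, ← mul_assoc, mul_comm (z - a)]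
  refine mul_lt_mul_of_pos_right ?_ (sub_pos.2 haz)
  have hsu := Real.sqrt_pos.2 hu
  rw [mul_div_assoc', div_lt_iff₀ (by positivity)]
  linarith

/-- Before the minimum `p² / 2 + f⁴ / 4` is still above its final value `f(b)⁴ / 4`, so the descent
from the zero is faster than in the conserved motion. -/
theorem zero_gap_right (h : IsArch f p a y z b) (hs : IsGraphSolution f p (Icc a b)) :
    b - z < gapB / |f b| := by
  have haz : a < z := h.lt_inflection.trans h.inflection_lt
  have hanti := h.strictAntiOn hs
  rw [abs_of_neg h.end_neg]
  set β := -f b with hβ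
  have hβ0 : 0 < β := neg_pos.2 h.end_neg
  have hmem : ∀ t ∈ Ioo z b, -f t / β ∈ Ioo (0 : ℝ) 1 := fun t ht => by
    have htb : t ∈ Icc a b := ⟨(haz.trans ht.1).le, ht.2.le⟩
    have h1 := hanti htb (right_mem_Icc.2 h.start_lt_end.le) ht.2
    have h2 := hanti ⟨haz.le, h.lt_end.le⟩ htb ht.1
    rw [h.zero] at h2
    exact ⟨div_pos (neg_pos.2 h2) hβ0, (div_lt_one hβ0).2 (neg_lt_neg h1)⟩
  have eb : -f b / β = 1 := div_self hβ0.ne'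
  have ez : -f z / β = 0 := by simp [h.zero]
  have hmem' : ∀ t ∈ Icc z b, -f t / β ∈ Icc (0 : ℝ) 1 := fun t ht => by
    rcases ht.2.eq_or_lt with rfl | htb
    · simp [eb]
    · rcases ht.1.eq_or_lt with rfl | htz
      · simp [ez]
      · exact Ioo_subset_Icc_self (hmem t ⟨htz, htb⟩)
  obtain ⟨t, ht, e⟩ := exists_mul_eq_comp_sub (g := fun t => -f t / β) primitive_gapB.1 primitive_gapB.2 h.lt_end
    (fun t ht => ((hs.1 t ⟨haz.le.trans ht.1, ht.2⟩).neg.div_const β)) hmem' hmem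
  rw [eb, ez, intervalIntegral.integral_same, sub_zero] at e
  have hat : a < t := haz.trans ht.1
  have hH := (hs.mono (Icc_subset_Icc_left hat.le)).height_energy_lt ht.2
    (fun s hs => (h.slope_neg s ⟨hat.trans hs.1, hs.2⟩).ne)
  rw [h.slope_end] at hH
  obtain ⟨hm0, hm1⟩ := hmem t ht
  have hu : 0 < 1 - (-f t / β) ^ 4 := sub_pos.2 (pow_lt_one₀ hm0.le hm1 (by norm_num))
  have hp := h.slope_neg t ⟨hat, ht.2⟩
  have hβ4 : β ^ 4 = f b ^ 4 := by rw [hβ]; ring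
  have hlt : β ^ 2 * √(1 - (-f t / β) ^ 4) < √2 * -p t := by
    refine lt_of_pow_lt_pow_left₀ 2 (mul_nonneg (Real.sqrt_nonneg _) (by linarith)) ?_
    rw [mul_pow, mul_pow, Real.sq_sqrt hu.le, Real.sq_sqrt (by norm_num)]
    have e3 : (β ^ 2) ^ 2 * (1 - (-f t / β) ^ 4) = β ^ 4 - f t ^ 4 := by
      field_simp
    rw [e3, hβ4]
    linarith
  rw [lt_div_iff₀ hβ0, gapB, ← e]
  have hsu := Real.sqrt_pos.2 hu
  have e2 : √2 * (1 / √(1 - (-f t / β) ^ 4) * (-p t / β) * (b - z)) =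
      √2 * -p t / (√(1 - (-f t / β) ^ 4) * β) * (b - z) := by
    field_simp
  rw [e2, mul_comm (b - z)]
  refine mul_lt_mul_of_pos_right ?_ (sub_pos.2 h.lt_end)
  rw [lt_div_iff₀ (by positivity)]
  linarith

end IsArch

/-! ### Convergence and oscillation -/

/-- A crude bound that avoids roots: `2 E + 2` dominates both `(2 E)^(1/2)` and `(4 E)^(1/4)`. -/
theorem abs_le_of_energy_le {p w E : ℝ} (h : p ^ 2 / 2 + w ^ 4 / 4 ≤ E) :
    |p| ≤ 2 * E + 2 ∧ |w| ≤ 2 * E + 2 := by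
  have h1 := sq_nonneg p
  have h2 := sq_nonneg (w ^ 2)
  have h3 : w ^ 4 = (w ^ 2) ^ 2 := by ring
  have hE : 0 ≤ E := by linarith
  have h4 : w ^ 2 ≤ 2 * E + 2 := by
    refine abs_le_of_sq_le_sq' (a := w ^ 2) ?_ (by linarith) |>.2
    nlinarith
  constructor
  · exact abs_le_of_sq_le_sq (by nlinarith) (by linarith)
  · exact abs_le_of_sq_le_sq (by nlinarith) (by linarith)

theorem tendsto_zero_of_pow {α : Type*} {l : Filter α} {g : α → ℝ} {n : ℕ}
    (h : Tendsto (fun t => g t ^ n) l (𝓝 0)) : Tendsto g l (𝓝 0) := by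
  rw [Metric.tendsto_nhds] at h ⊢
  intro ε hε
  filter_upwards [h (ε ^ n) (pow_pos hε n)] with t ht
  rw [Real.dist_eq, sub_zero] at ht ⊢
  rw [abs_pow] at ht
  exact lt_of_pow_lt_pow_left₀ n hε.le ht

/-- A bounded orbit of the system `p' = -w³`, `w' = p - w³` tends to the origin, forwards and
backwards in time. -/
theorem tendsto_zero_of_bounded {p w : ℝ → ℝ} {a e M : ℝ} (he : e = 1 ∨ e = -1)
    (hp : ∀ t, a ≤ t → HasDerivAt p (e * -(w t) ^ 3) t)
    (hw : ∀ t, a ≤ t → HasDerivAt w (e * (p t - w t ^ 3)) t)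
    (hM : ∀ t, a ≤ t → |p t| ≤ M ∧ |w t| ≤ M) :
    Tendsto p atTop (𝓝 0) ∧ Tendsto w atTop (𝓝 0) := by
  have he2 : e * e = 1 := by rcases he with rfl | rfl <;> norm_num
  have heabs : |e| = 1 := by rcases he with rfl | rfl <;> norm_num
  have hM0 : 0 ≤ M := (abs_nonneg _).trans (hM a le_rfl).1
  -- The sign `e` gives `V' = -w⁶` in both directions of time.
  set V : ℝ → ℝ := fun t => e * (p t ^ 2 / 2 + w t ^ 4 / 4) with hV
  have hVd : ∀ t, a ≤ t → HasDerivAt V (-(w t) ^ 6) t := fun t ht => by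
    convert! ((((hp t ht).pow 2).div_const 2).add (((hw t ht).pow 4).div_const 4)).const_mul e
      using 1
    simp
    linear_combination (w t ^ 6) * he2
  have hVanti : ∀ s t, a ≤ s → s ≤ t → V t ≤ V s := fun s t has hst =>
    le_of_hasDerivAt_nonpos hst (fun r hr => hVd r (has.trans hr.1))
      (fun r _ => neg_nonpos.2 ((by decide : Even 6).pow_nonneg _))
  have hVlow : ∀ t, a ≤ t → -(M ^ 2 / 2 + M ^ 4 / 4) ≤ V t := fun t ht => by
    obtain ⟨h1, h2⟩ := hM t ht
    have h3 : p t ^ 2 ≤ M ^ 2 := sq_le_sq' (abs_le.1 h1).1 (abs_le.1 h1).2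
    have h4 : w t ^ 4 ≤ M ^ 4 := by
      rw [← (by decide : Even 4).pow_abs]
      exact pow_le_pow_left₀ (abs_nonneg _) h2 4
    have h5 : 0 ≤ p t ^ 2 / 2 + w t ^ 4 / 4 := by positivity
    rcases he with rfl | rfl <;> simp only [hV] <;> linarith
  have hlim : ∃ l, Tendsto V atTop (𝓝 l) := by
    have hanti : Antitone fun t => V (max a t) := fun s t hst =>
      hVanti _ _ (le_max_left _ _) (max_le_max_left a hst)
    have hb : BddBelow (range fun t => V (max a t)) :=
      ⟨-(M ^ 2 / 2 + M ^ 4 / 4), by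
        rintro _ ⟨t, rfl⟩
        exact hVlow _ (le_max_left _ _)⟩
    refine ⟨_, (tendsto_atTop_ciInf hanti hb).congr' ?_⟩
    filter_upwards [eventually_ge_atTop a] with t ht
    rw [max_eq_right ht]
  obtain ⟨l, hl⟩ := hlim
  have hbd : ∀ t, a ≤ t → |e * (p t - w t ^ 3)| ≤ M + M ^ 3 := fun t ht => by
    obtain ⟨h1, h2⟩ := hM t ht
    rw [abs_mul, heabs, one_mul]
    refine (abs_sub _ _).trans (add_le_add h1 ?_)
    rw [abs_pow]
    exact pow_le_pow_left₀ (abs_nonneg _) h2 3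
  have hw6 : Tendsto (fun t => -(w t) ^ 6) atTop (𝓝 0) := by
    refine tendsto_deriv_zero_of_tendsto (C := 6 * M ^ 5 * (M + M ^ 3)) hVd
      (fun t ht => ((hw t ht).pow 6).neg) (fun t ht => ?_) hl
    rw [abs_neg, abs_mul, abs_mul, abs_pow]
    refine mul_le_mul ?_ (hbd t ht) (abs_nonneg _) (by positivity)
    have := pow_le_pow_left₀ (abs_nonneg _) (hM t ht).2 5
    simpa using this
  have hw0 : Tendsto w atTop (𝓝 0) := by
    refine tendsto_zero_of_pow (n := 6) ?_
    simpa using hw6.neg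
  have hwd : Tendsto (fun t => e * (p t - w t ^ 3)) atTop (𝓝 0) := by
    refine tendsto_deriv_zero_of_tendsto (C := M ^ 3 + 3 * M ^ 2 * (M + M ^ 3)) hw
      (fun t ht => ((hp t ht).sub ((hw t ht).pow 3)).const_mul e) (fun t ht => ?_) hw0
    obtain ⟨h1, h2⟩ := hM t ht
    rw [abs_mul, heabs, one_mul]
    refine (abs_sub _ _).trans (add_le_add ?_ ?_)
    · rw [abs_mul, heabs, one_mul, abs_neg, abs_pow]
      exact pow_le_pow_left₀ (abs_nonneg _) h2 3
    · rw [abs_mul, abs_mul, abs_pow]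
      refine mul_le_mul ?_ (hbd t ht) (abs_nonneg _) (by positivity)
      have := pow_le_pow_left₀ (abs_nonneg _) h2 2
      simpa using this
  refine ⟨?_, hw0⟩
  have := (hwd.const_mul e).add (hw0.pow 3)
  simp only [mul_zero, ne_eq, OfNat.ofNat_ne_zero, not_false_eq_true, zero_pow, add_zero] at this
  refine this.congr fun t => ?_
  linear_combination (p t - w t ^ 3) * he2

namespace IsGraphSolution

variable {f p : ℝ → ℝ} {I : Set ℝ} {a b : ℝ}

theorem tendsto_zero (h : IsGraphSolution f p (Ici a)) :
    Tendsto f atTop (𝓝 0) ∧ Tendsto p atTop (𝓝 0) := by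
  have := tendsto_zero_of_bounded (p := p) (w := fun t => f t + p t) (a := a) (e := 1)
    (M := 2 * (p a ^ 2 / 2 + (f a + p a) ^ 4 / 4) + 2) (Or.inl rfl)
    (fun t ht => by simpa using h.2 t ht) (fun t ht => by simpa using h.hasDerivAt_add ht)
    (fun t ht => abs_le_of_energy_le ((h.mono Icc_subset_Ici_self).energy_le ht))
  refine ⟨?_, this.1⟩
  simpa using this.2.sub this.1

theorem sign_mul (h : IsGraphSolution f p I) (n : ℕ) :
    IsGraphSolution (fun t => (-1) ^ n * f t) (fun t => (-1) ^ n * p t) I := by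
  rcases n.even_or_odd with hn | hn
  · simpa [hn.neg_one_pow] using h
  · simpa [hn.neg_one_pow] using h.neg

/-- The factor `(-1) ^ n` turns each minimum into a maximum, so one arch can follow another without
a separate case. -/
theorem exists_arches (h : IsGraphSolution f p (Ici a)) (hp : p a = 0) (hf : 0 < f a) :
    ∃ x y z : ℕ → ℝ, x 0 = a ∧ ∀ n, IsArch (fun t => (-1) ^ n * f t) (fun t => (-1) ^ n * p t)
      (x n) (y n) (z n) (x (n + 1)) := by
  have step : ∀ (n : ℕ) (t : ℝ), (a ≤ t ∧ p t = 0 ∧ 0 < (-1) ^ n * f t) → ∃ y z b,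
      IsArch (fun t => (-1) ^ n * f t) (fun t => (-1) ^ n * p t) t y z b ∧
        a ≤ b ∧ p b = 0 ∧ 0 < (-1) ^ (n + 1) * f b := by
    rintro n t ⟨hat, hpt, hft⟩
    obtain ⟨y, z, b, hA⟩ := ((h.mono (Ici_subset_Ici.2 hat)).sign_mul n).exists_isArch
      (by simp [hpt]) hft
    refine ⟨y, z, b, hA, hat.trans hA.start_lt_end.le, by simpa using hA.slope_end, ?_⟩
    have := hA.end_neg
    rw [pow_succ]
    linarith
  choose! Y Z B hB using step
  set x : ℕ → ℝ := fun n => Nat.rec a (fun n t => B n t) n with hx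
  have hinv : ∀ n, a ≤ x n ∧ p (x n) = 0 ∧ 0 < (-1) ^ n * f (x n) := by
    intro n
    induction n with
    | zero => exact ⟨le_rfl, hp, by simpa [hx] using hf⟩
    | succ n ih => exact (hB n (x n) ih).2
  exact ⟨x, fun n => Y n (x n), fun n => Z n (x n), rfl, fun n => (hB n (x n) (hinv n)).1⟩

end IsGraphSolution

theorem abs_neg_one_pow_mul (n : ℕ) (c : ℝ) : |(-1) ^ n * c| = |c| := by simp [abs_mul]

/-- A solution together with its consecutive arches. -/
structure IsArchSequence (f p : ℝ → ℝ) (x y z : ℕ → ℝ) : Prop where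
  isGraphSolution : IsGraphSolution f p (Ici (x 0))
  isArch : ∀ n, IsArch (fun t => (-1) ^ n * f t) (fun t => (-1) ^ n * p t)
    (x n) (y n) (z n) (x (n + 1))

namespace IsArchSequence

variable {f p : ℝ → ℝ} {x y z : ℕ → ℝ}

theorem strictMono_x (h : IsArchSequence f p x y z) : StrictMono x :=
  strictMono_nat_of_lt_succ fun n => (h.isArch n).start_lt_end

theorem start_le (h : IsArchSequence f p x y z) (n : ℕ) : x 0 ≤ x n :=
  h.strictMono_x.monotone n.zero_le

theorem slope_x (h : IsArchSequence f p x y z) (n : ℕ) : p (x n) = 0 := by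
  simpa using (h.isArch n).slope_start

theorem graph_Icc (h : IsArchSequence f p x y z) (n : ℕ) {s t : ℝ} (hs : x n ≤ s) :
    IsGraphSolution f p (Icc s t) :=
  h.isGraphSolution.mono fun _ hr => ((h.start_le n).trans hs).trans hr.1

/-- If the extrema accumulated at `L`, so would the inflection points between them; then `p` and `f
+ p` would both vanish at `L`, which is excluded for a nontrivial solution. -/
theorem tendsto_x (h : IsArchSequence f p x y z) : Tendsto x atTop atTop := by
  rcases tendsto_atTop_of_monotone h.strictMono_x.monotone with ht | ⟨L, hL⟩
  · exact ht
  · exfalso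
    have hxL : x 0 ≤ L := h.strictMono_x.monotone.ge_of_tendsto hL 0
    have hy : Tendsto y atTop (𝓝 L) :=
      tendsto_of_tendsto_of_tendsto_of_le_of_le hL (hL.comp (tendsto_add_atTop_nat 1))
        (fun n => (h.isArch n).lt_inflection.le)
        (fun n => ((h.isArch n).inflection_lt.trans (h.isArch n).lt_end).le)
    have hp0 : p L = 0 := by
      refine tendsto_nhds_unique ((h.isGraphSolution.2 L hxL).continuousAt.tendsto.comp hL) ?_
      simp [Function.comp_def, h.slope_x]
    have hw0 : f L + p L = 0 := by
      refine tendsto_nhds_unique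
        ((h.isGraphSolution.hasDerivAt_add hxL).continuousAt.tendsto.comp hy) ?_
      have : ∀ n, f (y n) + p (y n) = 0 := fun n => by
        have := (h.isArch n).add_eq_zero
        rw [← mul_add] at this
        simpa using this
      simp [Function.comp_def, this]
    exact h.isGraphSolution.3 L hxL ⟨by linarith, hp0⟩

theorem exists_mem_Ico (h : IsArchSequence f p x y z) {t : ℝ} (ht : x 0 ≤ t) :
    ∃ n, t ∈ Ico (x n) (x (n + 1)) := by
  have hex : ∃ n, t < x n := (h.tendsto_x.eventually_gt_atTop t).exists
  classical
  set N := Nat.find hex with hN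
  have hN0 : N ≠ 0 := fun h0 => by
    have := Nat.find_spec hex
    rw [← hN, h0] at this
    exact absurd this (not_lt.2 ht)
  obtain ⟨m, hm⟩ := Nat.exists_eq_succ_of_ne_zero hN0
  refine ⟨m, not_lt.1 (Nat.find_min hex (m := m) (by omega)), ?_⟩
  have := Nat.find_spec hex
  rwa [← hN, hm] at this

theorem strictAntiOn_sign (h : IsArchSequence f p x y z) (n : ℕ) :
    StrictAntiOn (fun t => (-1) ^ n * f t) (Icc (x n) (x (n + 1))) :=
  (h.isArch n).strictAntiOn ((h.graph_Icc n le_rfl).sign_mul n)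

theorem slope_ne_zero (h : IsArchSequence f p x y z) (n : ℕ) {t : ℝ}
    (ht : t ∈ Ioo (x n) (x (n + 1))) : p t ≠ 0 := fun h0 => by
  have := (h.isArch n).slope_neg t ht
  rw [h0, mul_zero] at this
  exact lt_irrefl _ this

theorem add_ne_zero (h : IsArchSequence f p x y z) (n : ℕ) {t : ℝ}
    (ht : t ∈ Icc (x n) (x (n + 1))) (hty : t ≠ y n) : f t + p t ≠ 0 := fun h0 => by
  have e : (-1) ^ n * f t + (-1) ^ n * p t = 0 := by rw [← mul_add, h0, mul_zero]
  rcases lt_or_gt_of_ne hty with hlt | hlt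
  · exact ((h.isArch n).add_pos t ⟨ht.1, hlt⟩).ne' e
  · exact ((h.isArch n).add_neg t ⟨hlt, ht.2⟩).ne e

theorem add_y (h : IsArchSequence f p x y z) (n : ℕ) : f (y n) + p (y n) = 0 := by
  have := (h.isArch n).add_eq_zero
  rw [← mul_add] at this
  simpa using this

theorem fun_z (h : IsArchSequence f p x y z) (n : ℕ) : f (z n) = 0 := by
  simpa using (h.isArch n).zero

theorem y_mem (h : IsArchSequence f p x y z) (n : ℕ) : y n ∈ Ioo (x n) (x (n + 1)) :=
  ⟨(h.isArch n).lt_inflection, (h.isArch n).inflection_lt.trans (h.isArch n).lt_end⟩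

theorem z_mem (h : IsArchSequence f p x y z) (n : ℕ) : z n ∈ Ioo (x n) (x (n + 1)) :=
  ⟨(h.isArch n).lt_inflection.trans (h.isArch n).inflection_lt, (h.isArch n).lt_end⟩

theorem add_eq_zero_iff (h : IsArchSequence f p x y z) {t : ℝ} (ht : x 0 ≤ t) :
    f t + p t = 0 ↔ t ∈ range y := by
  constructor
  · intro h0
    obtain ⟨n, hn⟩ := h.exists_mem_Ico ht
    by_contra hty
    exact h.add_ne_zero n (Ico_subset_Icc_self hn) (fun e => hty ⟨n, e.symm⟩) h0
  · rintro ⟨n, rfl⟩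
    exact h.add_y n

theorem zeros_eq (h : IsArchSequence f p x y z) : {t | x 0 < t ∧ f t = 0} = range z := by
  ext t
  constructor
  · rintro ⟨ht, h0⟩
    obtain ⟨n, hn⟩ := h.exists_mem_Ico ht.le
    refine ⟨n, (h.strictAntiOn_sign n).injOn (Ioo_subset_Icc_self (h.z_mem n))
      (Ico_subset_Icc_self hn) ?_⟩
    simp [h0, h.fun_z]
  · rintro ⟨n, rfl⟩
    exact ⟨(h.start_le n).trans_lt (h.z_mem n).1, h.fun_z n⟩

/-- The three decreasing sequences come from evaluating a Lyapunov function where one of its terms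
vanishes: `f⁴ / 4` at extrema, and `p² / 2` at inflection points (energy) and at zeros (height
energy). -/
theorem abs_fun_x_lt (h : IsArchSequence f p x y z) (n : ℕ) : |f (x (n + 1))| < |f (x n)| := by
  have := (h.graph_Icc n le_rfl).height_energy_lt (h.isArch n).start_lt_end
    (fun t ht => h.slope_ne_zero n ht)
  rw [h.slope_x, h.slope_x] at this
  refine lt_of_pow_lt_pow_left₀ 4 (abs_nonneg _) ?_
  rw [(by decide : Even 4).pow_abs, (by decide : Even 4).pow_abs]
  linarith

theorem abs_slope_y_lt (h : IsArchSequence f p x y z) (n : ℕ) : |p (y (n + 1))| < |p (y n)| := by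
  have h1 := (h.graph_Icc n (h.y_mem n).1.le).energy_lt (h.y_mem n).2
    (fun t ht => h.add_ne_zero n ⟨(h.y_mem n).1.le.trans ht.1.le, ht.2.le⟩ ht.1.ne')
  have h2 := (h.graph_Icc (n + 1) le_rfl).energy_lt (h.y_mem (n + 1)).1
    (fun t ht => h.add_ne_zero (n + 1) ⟨ht.1.le, ht.2.le.trans (h.y_mem (n + 1)).2.le⟩ ht.2.ne)
  rw [h.add_y] at h1 h2
  refine lt_of_pow_lt_pow_left₀ 2 (abs_nonneg _) ?_
  rw [sq_abs, sq_abs]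
  linarith

theorem abs_slope_z_lt (h : IsArchSequence f p x y z) (n : ℕ) : |p (z (n + 1))| < |p (z n)| := by
  have h1 := (h.graph_Icc n (h.z_mem n).1.le).height_energy_lt (h.z_mem n).2
    (fun t ht => h.slope_ne_zero n ⟨(h.z_mem n).1.trans ht.1, ht.2⟩)
  have h2 := (h.graph_Icc (n + 1) le_rfl).height_energy_lt (h.z_mem (n + 1)).1
    (fun t ht => h.slope_ne_zero (n + 1) ⟨ht.1, ht.2.trans (h.z_mem (n + 1)).2⟩)
  rw [h.fun_z] at h1 h2
  refine lt_of_pow_lt_pow_left₀ 2 (abs_nonneg _) ?_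
  rw [sq_abs, sq_abs]
  linarith

/-- The hypothesis `hev` provides `f'` on both sides of the first maximum, as the second derivative
test there requires. -/
theorem oscillates (h : IsArchSequence f p x y z) (h0 : 0 < x 0)
    (hev : deriv f =ᶠ[𝓝 (x 0)] p) : Oscillates f x y z := by
  have hd : ∀ {t}, x 0 ≤ t → deriv f t = p t := fun ht => (h.isGraphSolution.1 _ ht).deriv
  have hyle : ∀ n, x 0 ≤ y n := fun n => (h.start_le n).trans (h.y_mem n).1.le
  have hzle : ∀ n, x 0 ≤ z n := fun n => (h.start_le n).trans (h.z_mem n).1.le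
  have htx := h.tendsto_x
  have hty : Tendsto y atTop atTop := tendsto_atTop_mono (fun n => (h.y_mem n).1.le) htx
  have htz : Tendsto z atTop atTop := tendsto_atTop_mono (fun n => (h.z_mem n).1.le) htx
  obtain ⟨hf0, hp0⟩ := h.isGraphSolution.tendsto_zero
  have hafx : DecreasesToZero fun n => |f (x n)| :=
    ⟨strictAnti_nat_of_succ_lt h.abs_fun_x_lt, by simpa using (hf0.comp htx).abs⟩
  have hapy : DecreasesToZero fun n => |p (y n)| :=
    ⟨strictAnti_nat_of_succ_lt h.abs_slope_y_lt, by simpa using (hp0.comp hty).abs⟩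
  have hfy : ∀ n, |f (y n)| = |p (y n)| := fun n => by
    rw [eq_neg_of_add_eq_zero_left (h.add_y n), abs_neg]
  have hAB : ∀ n, IsGraphSolution (fun t => (-1) ^ n * f t) (fun t => (-1) ^ n * p t)
      (Icc (x n) (x (n + 1))) := fun n => (h.graph_Icc n le_rfl).sign_mul n
  have hgapy : ∀ n, y n - x n < gapA / √|deriv f (y n)| ∧
      gapA / √|deriv f (y n)| < x (n + 1) - y n := fun n => by
    rw [hd (hyle n), ← abs_neg_one_pow_mul n]
    exact ⟨(h.isArch n).inflection_gap_left (hAB n), (h.isArch n).inflection_gap_right (hAB n)⟩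
  have hgapz : ∀ n, x (n + 1) - z n < gapB / |f (x (n + 1))| ∧
      gapB / |f (x (n + 1))| < z (n + 1) - x (n + 1) := fun n => by
    constructor
    · rw [← abs_neg_one_pow_mul n]
      exact (h.isArch n).zero_gap_right (hAB n)
    · rw [← abs_neg_one_pow_mul (n + 1)]
      exact (h.isArch (n + 1)).zero_gap_left (hAB (n + 1))
  have hpyne : ∀ n, p (y n) ≠ 0 := fun n => h.slope_ne_zero n (h.y_mem n)
  have hfxne : ∀ n, f (x n) ≠ 0 := fun n hn =>
    h.isGraphSolution.3 _ (h.start_le n) ⟨hn, h.slope_x n⟩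
  -- No integral has to be estimated: the upper bound for a positive gap already forces the constant
  -- to be positive.
  have hA0 : 0 < gapA := by
    have := (sub_pos.2 (h.y_mem 0).1).trans (hgapy 0).1
    exact (div_pos_iff_of_pos_right (Real.sqrt_pos.2 (abs_pos.2 (by
      rw [hd (hyle 0)]; exact hpyne 0)))).1 this
  have hB0 : 0 < gapB := by
    have := (sub_pos.2 (h.z_mem 0).2).trans (hgapz 0).1
    exact (div_pos_iff_of_pos_right (abs_pos.2 (hfxne 1))).1 this
  have hsecond : ∀ n, deriv (deriv f) (x n) = -(f (x n)) ^ 3 := fun n => by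
    have hevn : deriv f =ᶠ[𝓝 (x n)] p := by
      rcases n.eq_zero_or_pos with rfl | hn
      · exact hev
      · filter_upwards [Ioi_mem_nhds (h.strictMono_x hn)] with t ht
        exact hd (le_of_lt ht)
    rw [hevn.deriv_eq, (h.isGraphSolution.2 _ (h.start_le n)).deriv, h.slope_x, add_zero]
  have hcont : ∀ n, ContinuousAt f (x n) := fun n =>
    (h.isGraphSolution.1 _ (h.start_le n)).continuousAt
  have hdx : ∀ n, deriv f (x n) = 0 := fun n => (hd (h.start_le n)).trans (h.slope_x n)
  refine ⟨⟨fun n => h0.trans_le (h.start_le n), h.strictMono_x, htx⟩,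
    ⟨fun n => h0.trans_le (hyle n), strictMono_nat_of_lt_succ fun n =>
      (h.y_mem n).2.trans (h.y_mem (n + 1)).1, hty⟩,
    ⟨fun n => h0.trans_le (hzle n), strictMono_nat_of_lt_succ fun n =>
      (h.z_mem n).2.trans (h.z_mem (n + 1)).1, htz⟩,
    fun n => (h.y_mem n).1, fun n => (h.isArch n).inflection_lt, fun n => (h.z_mem n).2,
    fun n hn => ?_, fun n hn => ?_, fun n hn => ?_, fun n hn => ?_, hafx,
    fun n => (hfy n).trans (congrArg _ (hd (hyle n)).symm), ?_, ?_, hgapy, hgapz, ?_, ?_⟩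
  · have hpos : 0 < f (x n) := by simpa [hn.neg_one_pow] using (h.isArch n).start_pos
    refine ⟨isLocalMax_of_deriv_deriv_neg ?_ (hdx n) (hcont n), hpos⟩
    rw [hsecond]
    exact neg_lt_zero.2 (pow_pos hpos 3)
  · have hneg : f (x n) < 0 := by simpa [hn.neg_one_pow] using (h.isArch n).start_pos
    refine ⟨isLocalMin_of_deriv_deriv_pos ?_ (hdx n) (hcont n), hneg⟩
    rw [hsecond]
    exact neg_pos.2 ((by decide : Odd 3).pow_neg hneg)
  · simpa [hn.neg_one_pow] using h.strictAntiOn_sign n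
  · have := (h.strictAntiOn_sign n).neg
    simpa [hn.neg_one_pow, Pi.neg_def] using this
  · simpa only [hfy] using hapy
  · simp only [hd (hzle _)]
    exact ⟨strictAnti_nat_of_succ_lt h.abs_slope_z_lt, by simpa using (hp0.comp htz).abs⟩
  -- The lower bounds for the gaps diverge because their denominators tend to zero.
  · refine tendsto_atTop_mono (fun n => (hgapy n).2.le) ?_
    simp only [hd (hyle _)]
    refine Tendsto.const_mul_atTop hA0 (tendsto_inv_nhdsGT_zero.comp ?_)
    refine tendsto_nhdsWithin_iff.2 ⟨?_, .of_forall fun n => Real.sqrt_pos.2 (abs_pos.2 (hpyne n))⟩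
    simpa [Function.comp_def] using (Real.continuous_sqrt.tendsto 0).comp hapy.tendsto
  · refine tendsto_atTop_mono (fun n => (hgapz n).2.le) ?_
    refine Tendsto.const_mul_atTop hB0 (tendsto_inv_nhdsGT_zero.comp ?_)
    exact tendsto_nhdsWithin_iff.2 ⟨hafx.tendsto.comp (tendsto_add_atTop_nat 1),
      .of_forall fun n => abs_pos.2 (hfxne (n + 1))⟩

end IsArchSequence

/-! ### Inflection points and the oscillation of a graph. -/

namespace IsGraphSolution

variable {f p : ℝ → ℝ} {I : Set ℝ} {a : ℝ}

theorem eventually_deriv_deriv_eq (h : IsGraphSolution f p I) (hI : IsOpen I) {t : ℝ}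
    (ht : t ∈ I) : ∀ᶠ s in 𝓝 t, deriv (deriv f) s = -(f s + p s) ^ 3 := by
  have hev : deriv f =ᶠ[𝓝 t] p := by
    filter_upwards [hI.mem_nhds ht] with s hs
    exact (h.1 s hs).deriv
  filter_upwards [hev.deriv, hI.mem_nhds ht] with s hs hsI
  rw [hs, (h.2 s hsI).deriv]

/-- As `f'' = -(f + f')³`, a change of sign needs a zero of `f + f'`. At such a zero the derivative
of `f + f'` is `f'`, which is nonzero for a nontrivial solution, so the sign does change. -/
theorem isInflectionPoint_iff (h : IsGraphSolution f p I) (hI : IsOpen I) {t : ℝ} (ht : t ∈ I) :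
    IsInflectionPoint f t ↔ f t + p t = 0 := by
  have hev := h.eventually_deriv_deriv_eq hI ht
  have hl : ∀ᶠ s in 𝓝[<] t, deriv (deriv f) s = -(f s + p s) ^ 3 := nhdsWithin_le_nhds hev
  have hr : ∀ᶠ s in 𝓝[>] t, deriv (deriv f) s = -(f s + p s) ^ 3 := nhdsWithin_le_nhds hev
  have hc := (h.hasDerivAt_add ht).continuousAt
  have hcl : Tendsto (fun t => f t + p t) (𝓝[<] t) (𝓝 (f t + p t)) := hc.tendsto.mono_left
    nhdsWithin_le_nhds
  have hcr : Tendsto (fun t => f t + p t) (𝓝[>] t) (𝓝 (f t + p t)) := hc.tendsto.mono_left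
    nhdsWithin_le_nhds
  have hneg : ∀ c : ℝ, -c ^ 3 < 0 ↔ 0 < c := fun c => by
    rw [neg_lt_zero, (by decide : Odd 3).pow_pos_iff]
  have hpos : ∀ c : ℝ, 0 < -c ^ 3 ↔ c < 0 := fun c => by
    rw [neg_pos, (by decide : Odd 3).pow_neg_iff]
  constructor
  · rintro (⟨h1, h2⟩ | ⟨h1, h2⟩)
    · refine le_antisymm (le_of_tendsto hcr ?_) (ge_of_tendsto hcl ?_)
      · filter_upwards [h2, hr] with s hs e
        exact ((hpos _).1 (e ▸ hs)).le
      · filter_upwards [h1, hl] with s hs e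
        exact ((hneg _).1 (e ▸ hs)).le
    · refine le_antisymm (le_of_tendsto hcl ?_) (ge_of_tendsto hcr ?_)
      · filter_upwards [h1, hl] with s hs e
        exact ((hpos _).1 (e ▸ hs)).le
      · filter_upwards [h2, hr] with s hs e
        exact ((hneg _).1 (e ▸ hs)).le
  · intro h0
    have hd := h.hasDerivAt_add ht
    have hd' := hd.neg
    rw [h0] at hd hd'
    simp only [ne_eq, OfNat.ofNat_ne_zero, not_false_eq_true, zero_pow, sub_zero] at hd hd'
    have hp : p t ≠ 0 := fun hp => h.3 t ht ⟨by linarith, hp⟩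
    rcases lt_or_gt_of_ne hp with hp | hp
    · left
      constructor
      · filter_upwards [hl, eventually_lt_left_of_hasDerivAt_pos hd' (neg_pos.2 hp)] with s e hs
        rw [e, hneg]
        simp only [Pi.neg_apply, h0] at hs
        linarith
      · filter_upwards [hr, eventually_gt_right_of_hasDerivAt_pos hd' (neg_pos.2 hp)] with s e hs
        rw [e, hpos]
        simp only [Pi.neg_apply, h0] at hs
        linarith
    · right
      constructor
      · filter_upwards [hl, eventually_lt_left_of_hasDerivAt_pos hd hp] with s e hs
        rw [e, hpos]
        simpa [h0] using hs
      · filter_upwards [hr, eventually_gt_right_of_hasDerivAt_pos hd hp] with s e hs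
        rw [e, hneg]
        simpa [h0] using hs

/-- A solution that rises up to its first maximum at `a` oscillates from there on. -/
theorem exists_oscillates (h : IsGraphSolution f p I) (hI : IsOpen I) (haI : Ici a ⊆ I)
    (ha : 0 < a) (hp : p a = 0) (hf : 0 < f a) (hlt : ∀ t ∈ I, t < a → 0 < f t + p t) :
    ∃ x y z : ℕ → ℝ, x 0 = a ∧ Oscillates f x y z ∧ {t | t ∈ I ∧ IsInflectionPoint f t} = range y ∧
      {t | a < t ∧ f t = 0} = range z := by
  obtain ⟨x, y, z, rfl, hA⟩ := (h.mono haI).exists_arches hp hf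
  have hS : IsArchSequence f p x y z := ⟨h.mono haI, hA⟩
  refine ⟨x, y, z, rfl, hS.oscillates ha ?_, ?_, hS.zeros_eq⟩
  · filter_upwards [hI.mem_nhds (haI (mem_Ici.2 le_rfl))] with t ht
    exact (h.1 t ht).deriv
  · ext t
    constructor
    · rintro ⟨ht, hinf⟩
      rw [h.isInflectionPoint_iff hI ht] at hinf
      refine (hS.add_eq_zero_iff (not_lt.1 fun hta => ?_)).1 hinf
      exact (hlt t ht hta).ne' hinf
    · rintro ⟨n, rfl⟩
      have hI' : y n ∈ I := haI ((hS.start_le n).trans (hS.y_mem n).1.le)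
      exact ⟨hI', (h.isInflectionPoint_iff hI hI').2 (hS.add_y n)⟩

end IsGraphSolution

/-! ### The behaviour of solutions backwards -/

/-- A nontrivial orbit of `P' = W³`, `W' = W³ - P` on a half-line `J`, the time-reversed equation
for the slope `P` and the sum `W` of height and slope; the curve that it describes is infinitely
long. -/
structure IsReversedSolution (P W : ℝ → ℝ) (J : Set ℝ) : Prop where
  mem_of_le : ∀ r ∈ J, ∀ r' ≤ r, r' ∈ J
  nonempty : J.Nonempty
  hasDerivAt_slope : ∀ r ∈ J, HasDerivAt P (W r ^ 3) r
  hasDerivAt_sum : ∀ r ∈ J, HasDerivAt W (W r ^ 3 - P r) r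
  ne_zero : ∀ r ∈ J, ¬(P r = 0 ∧ W r = 0)
  -- The element of length `√(1 + P²)` is at most `1 + |P|`, so a function `Λ` of this kind grows at
  -- least like the length. Quantifying over `Λ` lets each estimate exhibit an explicit bounded
  -- function.
  not_bddAbove : ∀ R ∈ J, ∀ Λ Λ' : ℝ → ℝ,
    (∀ r ∈ J, R ≤ r → HasDerivAt Λ (Λ' r) r ∧ 1 + |P r| ≤ Λ' r) →
      ¬BddAbove (Λ '' {r | r ∈ J ∧ R ≤ r})

namespace IsReversedSolution

variable {P W : ℝ → ℝ} {J : Set ℝ} {R : ℝ}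

theorem neg (h : IsReversedSolution P W J) :
    IsReversedSolution (fun r => -P r) (fun r => -W r) J := by
  refine ⟨h.1, h.2, fun r hr => ?_, fun r hr => ?_, fun r hr h0 => h.5 r hr (by simpa using h0),
    fun R hR Λ Λ' hΛ => h.6 R hR Λ Λ' (by simpa using hΛ)⟩
  · convert! (h.3 r hr).neg using 1
    ring
  · convert! (h.4 r hr).neg using 1
    ring

/-- Bounded slope on a bounded stretch means finite length: the test function is `(1 + M) r`. -/
theorem univ_of_bounded (h : IsReversedSolution P W J) (hR : R ∈ J) {M : ℝ}
    (hM : ∀ r ∈ J, R ≤ r → |P r| ≤ M) : J = univ := by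
  by_contra hne
  obtain ⟨m, hm⟩ := (ne_univ_iff_exists_notMem J).1 hne
  have hM0 : 0 ≤ M := (abs_nonneg _).trans (hM R hR le_rfl)
  refine h.not_bddAbove R hR (fun r => (1 + M) * r) (fun _ => 1 + M) (fun r hr hRr => ⟨?_, ?_⟩) ?_
  · simpa using (hasDerivAt_id r).const_mul (1 + M)
  · linarith [hM r hr hRr]
  · refine ⟨(1 + M) * m, ?_⟩
    rintro _ ⟨r, ⟨hr, -⟩, rfl⟩
    have : r ≤ m := not_lt.1 fun hlt => hm (h.mem_of_le r hr m hlt.le)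
    exact mul_le_mul_of_nonneg_left this (by linarith)

theorem hasDerivAt_energy (h : IsReversedSolution P W J) {r : ℝ} (hr : r ∈ J) :
    HasDerivAt (fun r => P r ^ 2 / 2 + W r ^ 4 / 4) (W r ^ 6) r := by
  convert! (((h.3 r hr).pow 2).div_const 2).add (((h.4 r hr).pow 4).div_const 4) using 1
  simp
  ring

theorem energy_le (h : IsReversedSolution P W J) {r s : ℝ} (hs : s ∈ J) (hrs : r ≤ s) :
    P r ^ 2 / 2 + W r ^ 4 / 4 ≤ P s ^ 2 / 2 + W s ^ 4 / 4 :=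
  le_of_hasDerivAt_nonneg hrs (fun t ht => h.hasDerivAt_energy (h.mem_of_le s hs t ht.2))
    (fun _ _ => (by decide : Even 6).pow_nonneg _)

/-- With bounded energy the orbit would tend to the origin, where the energy is zero. But in
reversed time the energy does not decrease, so it would vanish throughout. -/
theorem exists_energy_gt (h : IsReversedSolution P W J) (E : ℝ) :
    ∃ r ∈ J, E < P r ^ 2 / 2 + W r ^ 4 / 4 := by
  by_contra! hE
  obtain ⟨R, hR⟩ := h.nonempty
  have hJ : J = univ := h.univ_of_bounded hR fun r hr _ => (abs_le_of_energy_le (hE r hr)).1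
  subst hJ
  have hlim := tendsto_zero_of_bounded (p := P) (w := W) (a := R) (e := -1) (M := 2 * E + 2)
    (Or.inr rfl) (fun r _ => by simpa using h.3 r trivial) (fun r _ => by simpa using h.4 r trivial)
    (fun r _ => abs_le_of_energy_le (hE r trivial))
  have h0 : Tendsto (fun r => P r ^ 2 / 2 + W r ^ 4 / 4) atTop (𝓝 0) := by
    simpa using ((hlim.1.pow 2).div_const 2).add ((hlim.2.pow 4).div_const 4)
  have hle : P R ^ 2 / 2 + W R ^ 4 / 4 ≤ 0 :=
    ge_of_tendsto h0 ((eventually_ge_atTop R).mono fun r hr => h.energy_le trivial hr)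
  have h1 := sq_nonneg (P R)
  have h2 := (by decide : Even 4).pow_nonneg (W R)
  exact h.ne_zero R hR ⟨pow_eq_zero_iff (by norm_num) |>.1 (by linarith : P R ^ 2 = 0),
    pow_eq_zero_iff (by norm_num) |>.1 (by linarith : W R ^ 4 = 0)⟩

theorem hasDerivAt_speed (h : IsReversedSolution P W J) {r : ℝ} (hr : r ∈ J) :
    HasDerivAt (fun r => W r ^ 3 - P r) (W r ^ 2 * (3 * (W r ^ 3 - P r) - W r)) r := by
  convert! ((h.4 r hr).pow 3).sub (h.3 r hr) using 1
  simp
  ring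

/-- The region `W > 1`, `W³ - P > W` cannot be left. -/
theorem trapped (h : IsReversedSolution P W J) (h1 : 1 < W R)
    (h2 : W R < W R ^ 3 - P R) {r : ℝ} (hr : r ∈ J) (hRr : R ≤ r) :
    1 < W r ∧ W r < W r ^ 3 - P r := by
  have hJ : ∀ s ∈ Icc R r, s ∈ J := fun s hs => h.mem_of_le r hr s hs.2
  have hDd : ∀ s ∈ Icc R r, HasDerivAt (fun s => W s ^ 3 - P s - W s)
      (W s ^ 2 * (3 * (W s ^ 3 - P s) - W s) - (W s ^ 3 - P s)) s := fun s hs =>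
    (h.hasDerivAt_speed (hJ s hs)).sub (h.4 s (hJ s hs))
  by_contra hcon
  set g : ℝ → ℝ := fun s => min (W s - 1) (W s ^ 3 - P s - W s) with hg
  have hgc : ContinuousOn g (Icc R r) := by
    refine ContinuousOn.inf (fun s hs => ?_) fun s hs => ?_
    · exact ((h.4 s (hJ s hs)).sub_const 1).continuousAt.continuousWithinAt
    · exact (hDd s hs).continuousAt.continuousWithinAt
  have hgr : g r ≤ 0 := by
    by_contra! hpos
    rw [hg, lt_min_iff] at hpos
    exact hcon ⟨by linarith [hpos.1], by linarith [hpos.2]⟩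
  obtain ⟨t, ht, ht0, hpos⟩ := exists_first_zero_Icc hRr hgc
    (lt_min (by linarith) (by linarith)) hgr
  have hpos' : ∀ s ∈ Ico R t, 1 < W s ∧ W s < W s ^ 3 - P s := fun s hs => by
    have := lt_min_iff.1 (hpos s hs)
    constructor <;> linarith [this.1, this.2]
  have hWt : W R < W t := lt_of_hasDerivAt_pos ht.1
    (fun s hs => h.4 s (hJ s ⟨hs.1, hs.2.trans ht.2⟩))
    (fun s hs => by linarith [hpos' s ⟨hs.1.le, hs.2⟩])
  have hDt : W t ^ 3 - P t - W t = 0 := by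
    rcases min_choice (W t - 1) (W t ^ 3 - P t - W t) with e | e
    · have : W t - 1 = 0 := by rw [← e]; exact ht0
      linarith
    · rw [← e]; exact ht0
  -- Since `W` has grown, the exit could only be through `W' = W`. There `W' - W` has derivative `2
  -- W³ - W > 0`, so it was negative just before.
  have hder := hDd t ⟨ht.1.le, ht.2⟩
  have hev := eventually_lt_left_of_hasDerivAt_pos hder (by
    have e : W t ^ 3 - P t = W t := by linarith
    have hW1 : 1 < W t := h1.trans hWt
    rw [e]
    nlinarith [mul_pos (sub_pos.2 hW1) (sub_pos.2 hW1), pow_pos (by linarith : 0 < W t) 3])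
  obtain ⟨s, hs, hs'⟩ := (hev.and (Ioo_mem_nhdsLT ht.1)).exists
  have := hpos' s ⟨hs'.1.le, hs'.2⟩
  linarith [this.2]

/-- An orbit in the region `W > 1`, `W³ - P > W` has finite length. -/
theorem not_trapped (h : IsReversedSolution P W J) (hR : R ∈ J) :
    ¬(1 < W R ∧ W R < W R ^ 3 - P R) := by
  rintro ⟨h1, h2⟩
  have htr : ∀ r ∈ J, R ≤ r → 1 < W r ∧ W r < W r ^ 3 - P r := fun r hr hRr =>
    h.trapped h1 h2 hr hRr
  have hWR : 0 < W R ^ 3 := pow_pos (by linarith) 3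
  -- The second entry of the minimum gives `W' ≥ c W³` at `R`; `c ≤ 2 / 3` keeps `W' - c W³`
  -- nondecreasing, because its derivative is `W² ((W' - W) + (2 - 3 c) W')`.
  set c : ℝ := min (2 / 3) ((W R ^ 3 - P R) / W R ^ 3) with hc
  have hc0 : 0 < c := lt_min (by norm_num) (div_pos (by linarith) hWR)
  have hc1 : c ≤ 2 / 3 := min_le_left _ _
  have hspeed : ∀ r ∈ J, R ≤ r → c * W r ^ 3 ≤ W r ^ 3 - P r := fun r hr hRr => by
    have := le_of_hasDerivAt_nonneg hRr (g := fun r => W r ^ 3 - P r - c * W r ^ 3)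
      (fun s hs => (h.hasDerivAt_speed (h.mem_of_le r hr s hs.2)).sub
        (((h.4 s (h.mem_of_le r hr s hs.2)).pow 3).const_mul c)) (fun s hs => ?_)
    · have h3 : c * W R ^ 3 ≤ W R ^ 3 - P R := by
        rw [← le_div_iff₀ hWR]
        exact min_le_right _ _
      linarith
    · obtain ⟨h4, h5⟩ := htr s (h.mem_of_le r hr s hs.2.le) hs.1.le
      have e : W s ^ 2 * (3 * (W s ^ 3 - P s) - W s) -
          c * (((3 : ℕ) : ℝ) * W s ^ (3 - 1) * (W s ^ 3 - P s)) =
          W s ^ 2 * ((W s ^ 3 - P s - W s) + (2 - 3 * c) * (W s ^ 3 - P s)) := by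
        push_cast
        ring
      rw [e]
      have h6 : 0 ≤ (2 - 3 * c) * (W s ^ 3 - P s) := mul_nonneg (by linarith) (by linarith)
      exact mul_nonneg (sq_nonneg _) (by linarith)
  -- A bound for the blow-up time: `-W⁻²` grows at least at the rate `2 c`, stays negative, and is
  -- at least `-1` at `R`.
  set m : ℝ := R + 1 / (2 * c) with hm
  have hbound : ∀ r ∈ J, R ≤ r → r ≤ m := fun r hr hRr => by
    have := mul_sub_le_of_le_hasDerivAt hRr (g := fun r => -(W r ^ 2)⁻¹) (c := 2 * c)
      (fun s hs => (((h.4 s (h.mem_of_le r hr s hs.2)).pow 2).inv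
        (pow_pos (by linarith [(htr s (h.mem_of_le r hr s hs.2) hs.1).1]) 2).ne').neg)
      (fun s hs => ?_)
    · have h3 : (W R ^ 2)⁻¹ ≤ 1 := inv_le_one_of_one_le₀ (one_le_pow₀ h1.le)
      have h4 : 0 < (W r ^ 2)⁻¹ :=
        inv_pos.2 (pow_pos (by linarith [(htr r hr hRr).1]) 2)
      have h5 : r - R ≤ 1 / (2 * c) := by
        rw [le_div_iff₀ (by positivity)]
        linarith
      linarith
    · obtain ⟨h4, h5⟩ := htr s (h.mem_of_le r hr s hs.2.le) hs.1.le
      have h6 := hspeed s (h.mem_of_le r hr s hs.2.le) hs.1.le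
      have hW0 : 0 < W s := by linarith
      rw [neg_div, neg_neg]
      simp only [Nat.cast_ofNat, Nat.add_one_sub_one, pow_one, Pi.pow_apply]
      rw [le_div_iff₀ (by positivity)]
      nlinarith
  have hP : ∀ r ∈ J, R ≤ r → 1 + |P r| ≤ W r / c + (1 + |P R|) := fun r hr hRr => by
    have hlow : P R ≤ P r := le_of_hasDerivAt_nonneg hRr
      (fun s hs => h.3 s (h.mem_of_le r hr s hs.2))
      (fun s hs => (pow_pos (by linarith [(htr s (h.mem_of_le r hr s hs.2.le) hs.1.le).1]) 3).le)
    have hup := le_of_hasDerivAt_nonneg hRr (g := fun r => W r / c - P r)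
      (fun s hs => ((h.4 s (h.mem_of_le r hr s hs.2)).div_const c).sub
        (h.3 s (h.mem_of_le r hr s hs.2))) (fun s hs => by
        have := hspeed s (h.mem_of_le r hr s hs.2.le) hs.1.le
        rw [sub_nonneg, le_div_iff₀ hc0]
        linarith)
    have h3 : 0 < W R / c := div_pos (by linarith) hc0
    have h4 : 0 < W r / c := div_pos (by linarith [(htr r hr hRr).1]) hc0
    have h5 : |P r| ≤ W r / c + |P R| := by
      rw [abs_le]
      constructor
      · linarith [neg_abs_le (P R)]
      · linarith [le_abs_self (P R)]
    linarith
  -- Here `1 + |P| ≤ W / c + (1 + |P R|)`, and `W / c ≤ W' / (c² W²)` is bounded by the derivative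
  -- of `-W⁻¹ / c²`, which stays negative.
  refine h.not_bddAbove R hR (fun r => (1 + |P R|) * r - (W r)⁻¹ / c ^ 2)
    (fun r => (1 + |P R|) - (-(W r ^ 3 - P r) / W r ^ 2) / c ^ 2) (fun r hr hRr => ⟨?_, ?_⟩) ?_
  · have h3 := (htr r hr hRr).1
    convert! ((hasDerivAt_id r).const_mul (1 + |P R|)).sub
      (((h.4 r hr).inv (by linarith : W r ≠ 0)).div_const (c ^ 2)) using 1
    ring
  · refine (hP r hr hRr).trans ?_
    have h3 := (htr r hr hRr).1
    have hW0 : 0 < W r := by linarith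
    have h4 : W r / c ≤ (W r ^ 3 - P r) / W r ^ 2 / c ^ 2 := by
      rw [div_div, div_le_div_iff₀ hc0 (by positivity)]
      have := mul_le_mul_of_nonneg_right (hspeed r hr hRr) hc0.le
      nlinarith
    rw [neg_div, neg_div]
    linarith
  · refine ⟨(1 + |P R|) * m, ?_⟩
    rintro _ ⟨r, ⟨hr, hRr⟩, rfl⟩
    have h3 : 0 < (W r)⁻¹ / c ^ 2 :=
      div_pos (inv_pos.2 (by linarith [(htr r hr hRr).1])) (by positivity)
    have h4 := mul_le_mul_of_nonneg_left (hbound r hr hRr) (by positivity : 0 ≤ 1 + |P R|)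
    simp only
    linarith

/-- If `W ≤ 0` at some point, then `W` becomes and stays negative and drives `P` below zero. With `W
> 0`, staying outside the trapping region gives `W³ ≤ 2 P + 8`, hence `P' ≤ 2 (P + 4)`: the slope
grows at most exponentially, and `J` cannot end. -/
theorem eventually_pos_of_slope_pos (h : IsReversedSolution P W J) (hR : R ∈ J)
    (hP : ∀ r ∈ J, R ≤ r → 0 < P r) : J = univ ∧ ∀ r, R ≤ r → 0 < W r := by
  have hW : ∀ r ∈ J, R ≤ r → 0 < W r := by
    intro R' hR' hRR'
    by_contra! hW0
    have hWneg : ∀ r ∈ J, R' < r → W r < 0 := fun r hr hr' => by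
      have := pos_of_hasDerivAt_of_barrier (g := fun r => -W r) (a := R') (b := r)
        (fun s hs => (h.4 s (h.mem_of_le r hr s hs.2)).neg) (by linarith) (fun s hs h0 => by
          rw [neg_eq_zero.1 h0]
          simpa using hP s (h.mem_of_le r hr s hs.2) (hRR'.trans hs.1)) r ⟨hr', le_rfl⟩
      linarith
    have hanti : ∀ r ∈ J, R' ≤ r → P r ≤ P R' := fun r hr hr' =>
      le_of_hasDerivAt_nonpos hr' (fun s hs => h.3 s (h.mem_of_le r hr s hs.2))
        (fun s hs => ((by decide : Odd 3).pow_neg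
          (hWneg s (h.mem_of_le r hr s hs.2.le) hs.1)).le)
    have hJ : J = univ := h.univ_of_bounded hR' (M := P R') fun r hr hr' => by
      rw [abs_of_pos (hP r hr (hRR'.trans hr'))]
      exact hanti r hr hr'
    subst hJ
    have hneg := hWneg (R' + 1) trivial (lt_add_one R')
    have hWanti : ∀ r, R' + 1 ≤ r → W r ≤ W (R' + 1) := fun r hr =>
      le_of_hasDerivAt_nonpos hr (fun s _ => h.4 s trivial) (fun s hs => by
        have h1 := (by decide : Odd 3).pow_neg (hWneg s trivial (by linarith [hs.1]))
        have h2 := hP s trivial (by linarith [hs.1])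
        linarith)
    have hc : 0 < (-W (R' + 1)) ^ 3 := pow_pos (by linarith) 3
    have hP1 := hP (R' + 1) trivial (by linarith)
    set T := R' + 1 + P (R' + 1) / (-W (R' + 1)) ^ 3 with hT
    have hle : R' + 1 ≤ T := by
      have : 0 < P (R' + 1) / (-W (R' + 1)) ^ 3 := div_pos hP1 hc
      linarith
    have := mul_sub_le_of_le_hasDerivAt hle (g := fun r => -P r) (c := (-W (R' + 1)) ^ 3)
      (fun s _ => (h.3 s trivial).neg) (fun s hs => by
        have h1 := pow_le_pow_left₀ (by linarith : 0 ≤ -W (R' + 1))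
          (neg_le_neg (hWanti s hs.1.le)) 3
        calc (-W (R' + 1)) ^ 3 ≤ (-W s) ^ 3 := h1
          _ = -W s ^ 3 := by ring)
    have e : (-W (R' + 1)) ^ 3 * (T - (R' + 1)) = P (R' + 1) := by
      rw [hT, add_sub_cancel_left, mul_div_cancel₀ _ hc.ne']
    linarith [hP T trivial (by linarith)]
  suffices hJ : J = univ from ⟨hJ, fun r hr => hW r (hJ ▸ trivial) hr⟩
  by_contra hne
  obtain ⟨m, hm⟩ := (ne_univ_iff_exists_notMem J).1 hne
  refine hne (h.univ_of_bounded hR (M := (P R + 4) * Real.exp (2 * (m - R))) fun r hr hRr => ?_)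
  have hrm : r ≤ m := not_lt.1 fun hlt => hm (h.mem_of_le r hr m hlt.le)
  have hcube : ∀ s ∈ J, R ≤ s → W s ^ 3 ≤ 2 * P s + 8 := fun s hs hRs => by
    have h1 := hW s hs hRs
    have h2 := hP s hs hRs
    rcases le_or_gt (W s) 2 with h3 | h3
    · have := pow_le_pow_left₀ h1.le h3 3
      linarith
    · have h4 : W s ^ 3 - P s ≤ W s := not_lt.1 fun h4 => h.not_trapped hs ⟨by linarith, h4⟩
      nlinarith [mul_pos h1 (mul_pos (sub_pos.2 h3) (by linarith : 0 < W s + 2))]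
  have hmono := le_of_hasDerivAt_nonpos hRr (g := fun s => (P s + 4) * Real.exp (-(2 * s)))
    (fun s hs => ((h.3 s (h.mem_of_le r hr s hs.2)).add_const 4).mul
      (((hasDerivAt_id s).const_mul 2).neg.exp)) (fun s hs => by
      have h1 := hcube s (h.mem_of_le r hr s hs.2.le) hs.1.le
      have h2 := Real.exp_pos (-(2 * s))
      simp only [id, mul_one, Pi.neg_apply]
      nlinarith)
  have hPr := hP r hr hRr
  have hPR := hP R hR le_rfl
  rw [abs_of_pos hPr]
  have h1 : P r + 4 ≤ (P R + 4) * Real.exp (2 * (r - R)) := by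
    have h2 := mul_le_mul_of_nonneg_right hmono (Real.exp_pos (2 * r)).le
    rw [mul_assoc, mul_assoc, ← Real.exp_add, ← Real.exp_add] at h2
    have e1 : -(2 * r) + 2 * r = 0 := by ring
    have e2 : -(2 * R) + 2 * r = 2 * (r - R) := by ring
    rwa [e1, e2, Real.exp_zero, mul_one] at h2
  have h2 : (P R + 4) * Real.exp (2 * (r - R)) ≤ (P R + 4) * Real.exp (2 * (m - R)) :=
    mul_le_mul_of_nonneg_left (Real.exp_le_exp.2 (by linarith)) (by linarith)
  linarith

/-- Backwards, every infinitely long solution is eventually monotone and never vertical. -/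
theorem exists_sign (h : IsReversedSolution P W J) :
    J = univ ∧ ∃ e : ℝ, (e = 1 ∨ e = -1) ∧ ∃ R, ∀ r, R ≤ r → 0 < e * P r ∧ 0 < e * W r := by
  -- The value `1 / 4` is the energy at `P = 0`, `|W| = 1`. Above it, a zero of `P` would lie in the
  -- trapping region or in its mirror image.
  obtain ⟨R, hR, hE⟩ := h.exists_energy_gt (1 / 4)
  have hne : ∀ r ∈ J, R ≤ r → P r ≠ 0 := by
    intro r hr hRr h0
    have h1 := hE.trans_le (h.energy_le hr hRr)
    rw [h0] at h1
    have key : ∀ w : ℝ, 1 < w ^ 4 → 0 ≤ w → 1 < w := fun w hw hw0 =>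
      lt_of_pow_lt_pow_left₀ 4 hw0 (by linarith)
    have key' : ∀ w : ℝ, 1 < w → w < w ^ 3 := fun w hw => by
      have : 0 < w * (w + 1) := mul_pos (by linarith) (by linarith)
      nlinarith [mul_pos (sub_pos.2 hw) this]
    rcases le_total 0 (W r) with hw | hw
    · have h2 := key (W r) (by linarith) hw
      exact h.not_trapped hr ⟨h2, by rw [h0, sub_zero]; exact key' _ h2⟩
    · have h2 := key (-W r) (by rw [(by decide : Even 4).neg_pow]; linarith) (by linarith)
      refine h.neg.not_trapped hr ⟨h2, ?_⟩
      simp only [h0, neg_zero, sub_zero]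
      exact key' _ h2
  have hPc : ContinuousOn P {r | r ∈ J ∧ R ≤ r} := fun r hr =>
    (h.3 r hr.1).continuousAt.continuousWithinAt
  rcases lt_or_gt_of_ne (hne R hR le_rfl) with hneg | hpos
  · have hP : ∀ r ∈ J, R ≤ r → 0 < -P r := fun r hr hRr => by
      by_contra! hle
      obtain ⟨t, ht, ht0, -⟩ := exists_first_zero_Icc hRr (g := fun r => -P r)
        (fun s hs => (h.3 s (h.mem_of_le r hr s hs.2)).neg.continuousAt.continuousWithinAt)
        (by linarith) hle
      exact hne t (h.mem_of_le r hr t ht.2) ht.1.le (neg_eq_zero.1 ht0)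
    obtain ⟨hJ, hW⟩ := h.neg.eventually_pos_of_slope_pos hR hP
    refine ⟨hJ, -1, Or.inr rfl, R, fun r hr => ⟨?_, ?_⟩⟩
    · simpa using hP r (hJ ▸ trivial) hr
    · simpa using hW r hr
  · have hP : ∀ r ∈ J, R ≤ r → 0 < P r := fun r hr hRr => by
      by_contra! hle
      obtain ⟨t, ht, ht0, -⟩ := exists_first_zero_Icc hRr
        (fun s hs => (h.3 s (h.mem_of_le r hr s hs.2)).continuousAt.continuousWithinAt) hpos hle
      exact hne t (h.mem_of_le r hr t ht.2) ht.1.le ht0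
    obtain ⟨hJ, hW⟩ := h.eventually_pos_of_slope_pos hR hP
    refine ⟨hJ, 1, Or.inl rfl, R, fun r hr => ⟨?_, ?_⟩⟩
    · simpa using hP r (hJ ▸ trivial) hr
    · simpa using hW r hr

end IsReversedSolution

/-! ### From solutions of unit speed to graphs -/

namespace IsFlow

variable {x y θ : ℝ → ℝ}

/-- At `θ = ±π/2` the turning rate is `∓1`, directed into the strip. Both ends are barriers, so a
vertical tangent is left at once and never recurs later. -/
theorem angle_mem_of_lt (h : IsFlow x y θ) {s₀ s : ℝ}
    (h0 : θ s₀ ∈ Icc (-(Real.pi / 2)) (Real.pi / 2)) (hs : s₀ < s) :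
    θ s ∈ Ioo (-(Real.pi / 2)) (Real.pi / 2) := by
  constructor
  · have := pos_of_hasDerivAt_of_barrier (g := fun s => θ s - -(Real.pi / 2)) (a := s₀) (b := s)
      (fun r _ => (h.hasDerivAt_angle r).sub_const _) (sub_nonneg.2 h0.1) (fun r _ hr => by
        rw [sub_eq_zero.1 hr]
        norm_num) s ⟨hs, le_rfl⟩
    exact sub_pos.1 this
  · have := pos_of_hasDerivAt_of_barrier (g := fun s => Real.pi / 2 - θ s) (a := s₀) (b := s)
      (fun r _ => (h.hasDerivAt_angle r).const_sub _) (sub_nonneg.2 h0.2) (fun r _ hr => by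
        rw [← sub_eq_zero.1 hr]
        simp) s ⟨hs, le_rfl⟩
    exact sub_pos.1 this

theorem strictMonoOn_fst (h : IsFlow x y θ) {J : Set ℝ} (hJ : OrdConnected J)
    (hθ : ∀ s ∈ J, θ s ∈ Ioo (-(Real.pi / 2)) (Real.pi / 2)) : StrictMonoOn x J :=
  fun _ ha _ hb hab => lt_of_hasDerivAt_pos hab (fun r _ => h.hasDerivAt_fst r)
    (fun r hr => Real.cos_pos_of_mem_Ioo (hθ r (hJ.out ha hb (Ioo_subset_Icc_self hr))))

/-- The abscissa becomes the parameter and `tan θ` the slope. Since `dθ/dx = θ' / cos θ`, dividing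
by `cos² θ` once more turns `-(sin θ + y cos θ)³` into `-(f + p)³`. -/
theorem exists_isGraphSolution (h : IsFlow x y θ) {J : Set ℝ} (hJo : IsOpen J)
    (hJ : OrdConnected J) (hθ : ∀ s ∈ J, θ s ∈ Ioo (-(Real.pi / 2)) (Real.pi / 2))
    (hne : ∀ s ∈ J, ¬(y s = 0 ∧ θ s = 0)) :
    ∃ f p : ℝ → ℝ, (∀ s ∈ J, f (x s) = y s ∧ p (x s) = Real.tan (θ s)) ∧
      IsGraphSolution f p (x '' J) ∧ IsOpen (x '' J) := by
  have hmono := h.strictMonoOn_fst hJ hθ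
  set ξ := Function.invFunOn x J with hξ
  have hξx : ∀ s ∈ J, ξ (x s) = s := fun s hs => hmono.injOn.leftInvOn_invFunOn hs
  have hnear : ∀ s ∈ J, ∀ U ∈ 𝓝 s, x '' (U ∩ J) ∈ 𝓝 (x s) := by
    intro s hs U hU
    obtain ⟨a, b, hab, hsub⟩ := mem_nhds_iff_exists_Ioo_subset.1 (inter_mem hU (hJo.mem_nhds hs))
    obtain ⟨a', ha', ha's⟩ := exists_between hab.1
    obtain ⟨b', hsb', hb'⟩ := exists_between hab.2
    have hsub' : Icc a' b' ⊆ U ∩ J := fun r hr => hsub ⟨ha'.trans_le hr.1, hr.2.trans_lt hb'⟩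
    have hle : a' ≤ b' := (ha's.trans hsb').le
    refine mem_of_superset (Ioo_mem_nhds
      (hmono (hsub' (left_mem_Icc.2 hle)).2 hs ha's) (hmono hs (hsub' (right_mem_Icc.2 hle)).2 hsb'))
      (Subset.trans (intermediate_value_Ioo hle h.continuous_fst.continuousOn)
        (image_mono (Ioo_subset_Icc_self.trans hsub')))
  have hopen : IsOpen (x '' J) := by
    rw [isOpen_iff_mem_nhds]
    rintro _ ⟨s, hs, rfl⟩
    simpa using hnear s hs univ univ_mem
  have hξc : ∀ s ∈ J, ContinuousAt ξ (x s) := fun s hs => by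
    rw [ContinuousAt, hξx s hs]
    intro U hU
    refine mem_map.2 (mem_of_superset (hnear s hs U hU) ?_)
    rintro _ ⟨r, hr, rfl⟩
    rw [mem_preimage, hξx r hr.2]
    exact hr.1
  have hξd : ∀ s ∈ J, HasDerivAt ξ (Real.cos (θ s))⁻¹ (x s) := fun s hs => by
    refine HasDerivAt.of_local_left_inverse (f := x) (hξc s hs) ?_
      (Real.cos_pos_of_mem_Ioo (hθ s hs)).ne' ?_
    · rw [hξx s hs]
      exact h.hasDerivAt_fst s
    · filter_upwards [hopen.mem_nhds (mem_image_of_mem x hs)]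
      rintro _ ⟨r, hr, rfl⟩
      rw [hξx r hr]
  refine ⟨fun t => y (ξ t), fun t => Real.tan (θ (ξ t)), fun s hs => ?_, ⟨?_, ?_, ?_⟩, hopen⟩
  · simp only [hξx s hs, and_self]
  · rintro _ ⟨s, hs, rfl⟩
    have h1 := hξx s hs
    have h2 := (h.hasDerivAt_snd s).comp_of_eq (x s) (hξd s hs) h1.symm
    simp only [h1]
    rw [Real.tan_eq_sin_div_cos, div_eq_mul_inv]
    exact h2
  · rintro _ ⟨s, hs, rfl⟩
    have h1 := hξx s hs
    have hc := (Real.cos_pos_of_mem_Ioo (hθ s hs)).ne'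
    have h2 := ((Real.hasDerivAt_tan hc).comp s (h.hasDerivAt_angle s)).comp_of_eq
      (x s) (hξd s hs) h1.symm
    simp only [h1]
    convert! h2 using 1
    rw [Real.tan_eq_sin_div_cos]
    field_simp
    ring
  · rintro _ ⟨s, hs, rfl⟩ ⟨h1, h2⟩
    simp only [hξx s hs] at h1 h2
    refine hne s hs ⟨h1, ?_⟩
    rw [Real.tan_eq_sin_div_cos, div_eq_zero_iff] at h2
    have h3 := h2.resolve_right (Real.cos_pos_of_mem_Ioo (hθ s hs)).ne'
    have h4 := hθ s hs
    exact Real.sin_eq_zero_iff_of_lt_of_lt (by linarith [h4.1, Real.pi_pos])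
      (by linarith [h4.2, Real.pi_pos]) |>.1 h3

/-- A solution that turns to the right runs off to infinity in the horizontal direction. -/
theorem tendsto_fst (h : IsFlow x y θ) {J : Set ℝ} (hJ : OrdConnected J) {s₀ : ℝ}
    (hs₀ : Ici s₀ ⊆ J) (hθ : ∀ s ∈ J, θ s ∈ Ioo (-(Real.pi / 2)) (Real.pi / 2)) {f p : ℝ → ℝ}
    (hfp : ∀ s ∈ J, f (x s) = y s ∧ p (x s) = Real.tan (θ s))
    (hS : IsGraphSolution f p (x '' J)) : Tendsto x atTop atTop := by
  have hmono := h.strictMonoOn_fst hJ hθ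
  set E := p (x s₀) ^ 2 / 2 + (f (x s₀) + p (x s₀)) ^ 4 / 4 with hE
  -- The energy bounds `|tan θ|` by `2 E + 2`; together with `1 ≤ cos θ + |sin θ|` this keeps the
  -- horizontal speed away from zero.
  have hcos : ∀ s, s₀ ≤ s → 1 / (1 + (2 * E + 2)) ≤ Real.cos (θ s) := fun s hs => by
    have hsub : Icc (x s₀) (x s) ⊆ x '' J :=
      (intermediate_value_Icc hs h.continuous_fst.continuousOn).trans
        (image_mono (Icc_subset_Ici_self.trans hs₀))
    have hle := (hS.mono hsub).energy_le
      (hmono.monotoneOn (hs₀ (mem_Ici.2 le_rfl)) (hs₀ hs) hs)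
    have h1 := (abs_le_of_energy_le hle).1
    rw [(hfp s (hs₀ hs)).2] at h1
    have hc := Real.cos_pos_of_mem_Ioo (hθ s (hs₀ hs))
    rw [div_le_iff₀ (by linarith [abs_nonneg (Real.tan (θ s))])]
    have h2 : |Real.sin (θ s)| ≤ (2 * E + 2) * Real.cos (θ s) := by
      rwa [Real.tan_eq_sin_div_cos, abs_div, abs_of_pos hc, div_le_iff₀ hc] at h1
    have h3 : 1 ≤ Real.cos (θ s) + |Real.sin (θ s)| := by
      have h4 := Real.sin_sq_add_cos_sq (θ s)
      have h5 := Real.cos_le_one (θ s)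
      have h6 := Real.abs_sin_le_one (θ s)
      have h7 := abs_nonneg (Real.sin (θ s))
      rw [← sq_abs (Real.sin (θ s))] at h4
      nlinarith
    linarith
  have hc0 : 0 < 1 / (1 + (2 * E + 2)) := by
    have : 0 ≤ E := by positivity
    positivity
  have hle : ∀ s, s₀ ≤ s → x s₀ + 1 / (1 + (2 * E + 2)) * (s - s₀) ≤ x s := fun s hs => by
    have := mul_sub_le_of_le_hasDerivAt hs (fun r _ => h.hasDerivAt_fst r)
      (fun r hr => hcos r hr.1.le)
    linarith
  refine tendsto_atTop_mono' atTop ((eventually_ge_atTop s₀).mono hle) ?_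
  exact tendsto_atTop_add_const_left _ _
    ((tendsto_atTop_add_const_right _ (-s₀) tendsto_id).const_mul_atTop hc0)

end IsFlow

namespace IsGraphSolution

variable {f p : ℝ → ℝ} {I : Set ℝ}

theorem contDiffOn (h : IsGraphSolution f p I) (hI : IsOpen I) : ContDiffOn ℝ 2 f I := by
  have hfc : ContinuousOn f I := fun t ht => (h.1 t ht).continuousAt.continuousWithinAt
  have hpc : ContinuousOn p I := fun t ht => (h.2 t ht).continuousAt.continuousWithinAt
  have hp : ContDiffOn ℝ 1 p I := by
    rw [show (1 : WithTop ℕ∞) = 0 + 1 by norm_num, contDiffOn_succ_iff_deriv_of_isOpen hI]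
    refine ⟨fun t ht => (h.2 t ht).differentiableAt.differentiableWithinAt, by simp, ?_⟩
    rw [contDiffOn_zero]
    exact ((hfc.add hpc).pow 3).neg.congr fun t ht => (h.2 t ht).deriv
  rw [show (2 : WithTop ℕ∞) = 1 + 1 by norm_num, contDiffOn_succ_iff_deriv_of_isOpen hI]
  exact ⟨fun t ht => (h.1 t ht).differentiableAt.differentiableWithinAt, by simp,
    hp.congr fun t ht => (h.1 t ht).deriv⟩

theorem comp_add_const (h : IsGraphSolution f p univ) (c : ℝ) :
    IsGraphSolution (fun t => f (t + c)) (fun t => p (t + c)) univ :=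
  ⟨fun t _ => (h.1 (t + c) trivial).comp_add_const t c,
    fun t _ => (h.2 (t + c) trivial).comp_add_const t c, fun t _ => h.3 (t + c) trivial⟩

/-- A solution on the line that is eventually increasing and concave backwards is of the third
kind, up to a translation. -/
theorem exists_isOscillatingEntire (h : IsGraphSolution f p univ) {T : ℝ}
    (hT : ∀ t ≤ T, 0 < p t ∧ 0 < f t + p t) :
    ∃ c, IsOscillatingEntire fun t => f (t + c) := by
  obtain ⟨b, hTb, hpb, hfb, hp, hw⟩ := (h.mono (subset_univ (Ici T))).exists_max
    (hT T le_rfl).2.le (hT T le_rfl).1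
  have hp' : ∀ t, t < b → 0 < p t := fun t ht => by
    rcases le_or_gt t T with h1 | h1
    · exact (hT t h1).1
    · exact hp t ⟨h1.le, ht⟩
  have hw' : ∀ t, t < b → 0 < f t + p t := fun t ht => by
    rcases le_or_gt t T with h1 | h1
    · exact (hT t h1).2
    · exact hw t ⟨h1, ht.le⟩
  -- The first maximum is moved to `1`, since the sequences have to be positive.
  have hg := h.comp_add_const (b - 1)
  obtain ⟨x, y, z, hx0, hosc, hinf, hzero⟩ := hg.exists_oscillates isOpen_univ
    (subset_univ (Ici 1)) one_pos (by simpa using hpb) (by simpa using hfb)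
    (fun t _ ht => hw' _ (by linarith))
  refine ⟨b - 1, contDiffOn_univ.1 (hg.contDiffOn isOpen_univ), ?_, x, y, z, hosc, ?_,
    by simpa using hinf, by simpa [hx0] using hzero⟩
  -- Left of `T` the graph is concave, so it lies below its tangent at `T`, which has positive
  -- slope.
  · have hle : ∀ t ≤ T, f t ≤ f T + p T * (t - T) := fun t ht => by
      have := mul_sub_le_of_le_hasDerivAt ht (fun r _ => h.1 r trivial) (c := p T) (fun r hr =>
        le_of_hasDerivAt_nonpos hr.2.le (fun q _ => h.2 q trivial) (fun q hq =>
          neg_nonpos.2 (pow_pos (hT q hq.2.le).2 3).le))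
      linarith
    have hlim : Tendsto f atBot atBot := by
      refine tendsto_atBot_mono' atBot ((eventually_le_atBot T).mono hle) ?_
      exact tendsto_atBot_add_const_left _ _
        ((tendsto_atBot_add_const_right _ (-T) tendsto_id).const_mul_atBot (hT T le_rfl).1)
    exact hlim.comp (tendsto_atBot_add_const_right _ (b - 1) tendsto_id)
  · rw [hx0]
    exact fun s _ t ht hst => lt_of_hasDerivAt_pos (g := fun t => f (t + (b - 1))) hst
      (fun r _ => hg.1 r trivial) (fun r hr => hp' _ (by linarith [hr.2, mem_Iic.1 ht]))

end IsGraphSolution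

theorem shiftReflect_eq_iff {c e : ℝ} (he : e = 1 ∨ e = -1) {p q : Plane} :
    shiftReflect c e p = q ↔ p 0 = q 0 - c ∧ p 1 = e * q 1 := by
  have he2 : e * e = 1 := by rcases he with rfl | rfl <;> norm_num
  constructor
  · rintro rfl
    simp [shiftReflect, ← mul_assoc, he2]
  · rintro ⟨h0, h1⟩
    refine Plane.ext ?_ ?_
    · simp [shiftReflect, h0]
    · simp [shiftReflect, h1, ← mul_assoc, he2]

/-- Unit speed for all negative times makes the reversed graph infinitely long, so `exists_sign`
shows that it lies over the whole line. The sign found there decides about the reflection. -/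
theorem IsFlow.exists_isOscillatingEntire {x y θ : ℝ → ℝ} (h : IsFlow x y θ)
    (hθ : ∀ s, θ s ∈ Ioo (-(Real.pi / 2)) (Real.pi / 2)) (hne : ∀ s, ¬(y s = 0 ∧ θ s = 0)) :
    ∃ c e : ℝ, (e = 1 ∨ e = -1) ∧ ∃ f, IsOscillatingEntire f ∧
      shiftReflect c e '' range (planeCurve x y) = graphOver univ f := by
  obtain ⟨f, p, hfp, hS, -⟩ := h.exists_isGraphSolution isOpen_univ ordConnected_univ
    (fun s _ => hθ s) (fun s _ => hne s)
  have hmono : StrictMono x :=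
    strictMonoOn_univ.1 (h.strictMonoOn_fst ordConnected_univ fun s _ => hθ s)
  have htop := h.tendsto_fst ordConnected_univ (subset_univ (Ici 0)) (fun s _ => hθ s) hfp hS
  rw [image_univ] at hS
  have hup : ∀ t ∈ range x, ∀ t', t ≤ t' → t' ∈ range x := by
    rintro _ ⟨s, rfl⟩ t' ht'
    obtain ⟨s', hs', hle⟩ := ((eventually_ge_atTop s).and (htop.eventually_ge_atTop t')).exists
    obtain ⟨r, -, hr⟩ := intermediate_value_Icc hs' h.continuous_fst.continuousOn ⟨ht', hle⟩
    exact ⟨r, hr⟩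
  have hrev : IsReversedSolution (fun r => p (-r)) (fun r => f (-r) + p (-r))
      {r | -r ∈ range x} := by
    refine ⟨fun r hr r' hle => hup _ hr _ (neg_le_neg hle), ⟨-x 0, 0, by simp⟩,
      fun r hr => ?_, fun r hr => ?_, fun r hr h0 => hS.3 _ hr ⟨?_, h0.1⟩,
      fun R hR Λ Λ' hΛ hbdd => ?_⟩
    · convert! (hS.2 (-r) hr).comp r (hasDerivAt_neg r) using 1
      ring
    · convert! (hS.hasDerivAt_add hr).comp r (hasDerivAt_neg r) using 1
      ring
    · have := h0.2
      rw [h0.1, add_zero] at this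
      exact this
    · obtain ⟨s₀, hs₀⟩ := hR
      obtain ⟨B, hB⟩ := hbdd
      have hmem : ∀ s ≤ s₀, -x s ∈ {r | -r ∈ range x} ∧ R ≤ -x s := fun s hs => by
        refine ⟨⟨s, by simp⟩, ?_⟩
        have := hmono.monotone hs
        linarith
      -- Backwards along the curve `Λ` grows at least at unit rate in `s`, so at this time it would
      -- exceed its supposed bound `B`.
      set s := s₀ - (B - Λ (-x s₀) + 1) with hs
      have hBs₀ : Λ (-x s₀) ≤ B := hB ⟨_, hmem s₀ le_rfl, rfl⟩
      have hss₀ : s ≤ s₀ := by linarith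
      have := mul_sub_le_of_le_hasDerivAt hss₀ (g := fun s => -Λ (-x s)) (c := 1)
        (fun r hr => ((hΛ _ (hmem r hr.2).1 (hmem r hr.2).2).1.comp r
          (h.hasDerivAt_fst r).neg).neg) (fun r hr => by
          have h1 := (hΛ _ (hmem r hr.2.le).1 (hmem r hr.2.le).2).2
          rw [neg_neg, (hfp r trivial).2] at h1
          have hc := Real.cos_pos_of_mem_Ioo (hθ r)
          have h2 := mul_le_mul_of_nonneg_right h1 hc.le
          rw [Real.tan_eq_sin_div_cos, abs_div, abs_of_pos hc, add_mul,
            div_mul_cancel₀ _ hc.ne'] at h2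
          have h4 := Real.sin_sq_add_cos_sq (θ r)
          have h5 := Real.cos_le_one (θ r)
          have h6 := Real.abs_sin_le_one (θ r)
          have h7 := abs_nonneg (Real.sin (θ r))
          rw [← sq_abs (Real.sin (θ r))] at h4
          nlinarith)
      have hBs : Λ (-x s) ≤ B := hB ⟨_, hmem s hss₀, rfl⟩
      linarith
  obtain ⟨huniv, e, he, R, hR⟩ := hrev.exists_sign
  have hsurj : ∀ t, t ∈ range x := fun t => by
    have : -t ∈ {r | -r ∈ range x} := huniv ▸ trivial
    simpa using this
  have hSu : IsGraphSolution f p univ := hS.mono fun t _ => hsurj t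
  have hSe : IsGraphSolution (fun t => e * f t) (fun t => e * p t) univ := by
    rcases he with rfl | rfl
    · simpa using hSu
    · simpa using hSu.neg
  obtain ⟨c, hc⟩ := hSe.exists_isOscillatingEntire (T := -R) (fun t ht => by
    have := hR (-t) (by linarith)
    rw [neg_neg, mul_add] at this
    exact this)
  refine ⟨-c, e, he, _, hc, ?_⟩
  ext q
  constructor
  · rintro ⟨_, ⟨s, rfl⟩, hq⟩
    obtain ⟨h0, h1⟩ := (shiftReflect_eq_iff he).1 hq
    have he2 : e * e = 1 := by rcases he with rfl | rfl <;> norm_num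
    rw [planeCurve_zero, sub_neg_eq_add] at h0
    rw [planeCurve_one] at h1
    refine ⟨trivial, ?_⟩
    simp only [← h0, (hfp s trivial).1, h1, ← mul_assoc, he2, one_mul]
  · rintro ⟨-, hq⟩
    obtain ⟨s, hs⟩ := hsurj (q 0 + c)
    have he2 : e * e = 1 := by rcases he with rfl | rfl <;> norm_num
    refine ⟨_, ⟨s, rfl⟩, (shiftReflect_eq_iff he).2 ⟨?_, ?_⟩⟩
    · rw [planeCurve_zero, hs, sub_neg_eq_add]
    · simp only [planeCurve_one, hq, ← hs, (hfp s trivial).1, ← mul_assoc, he2, one_mul]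

/-! ### Solutions with a vertical tangent -/

namespace IsFlow

variable {x y θ : ℝ → ℝ}

theorem add_const_fst (h : IsFlow x y θ) (c : ℝ) : IsFlow (fun s => x s + c) y θ :=
  ⟨fun s => (h.1 s).add_const c, h.2, h.3⟩

/-- Reflection in the `x`-axis. -/
theorem reflect (h : IsFlow x y θ) : IsFlow x (fun s => -y s) (fun s => -θ s) := by
  refine ⟨fun s => ?_, fun s => ?_, fun s => ?_⟩
  · rw [Real.cos_neg]
    exact h.1 s
  · rw [Real.sin_neg]
    exact (h.2 s).neg
  · rw [Real.sin_neg, Real.cos_neg]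
    convert! (h.3 s).neg using 1
    ring

/-- Reflection in the `x`-axis, together with a change of orientation. -/
theorem reverseReflect (h : IsFlow x y θ) :
    IsFlow (fun s => x (-s)) (fun s => -y (-s)) (fun s => Real.pi - θ (-s)) := by
  refine ⟨fun s => ?_, fun s => ?_, fun s => ?_⟩
  · convert! (h.1 (-s)).comp s (hasDerivAt_neg s) using 1
    rw [Real.cos_pi_sub]
    ring
  · convert! ((h.2 (-s)).comp s (hasDerivAt_neg s)).neg using 1
    rw [Real.sin_pi_sub]
    ring
  · convert! ((h.3 (-s)).comp s (hasDerivAt_neg s)).const_sub Real.pi using 1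
    rw [Real.sin_pi_sub, Real.cos_pi_sub]
    ring

/-- After a change of the origin and of the orientation of the parameter, the initial angle is in
`(-π/2, π/2]`. -/
theorem exists_normalized (h : IsFlow x y θ) (s₀ : ℝ) :
    ∃ x' y' θ', IsFlow x' y' θ' ∧ range (planeCurve x' y') = range (planeCurve x y) ∧
      θ' 0 ∈ Ioc (-(Real.pi / 2)) (Real.pi / 2) ∧
      (Real.cos (θ' 0) = 0 ↔ Real.cos (θ s₀) = 0) ∧
      ((∀ s, Real.cos (θ s) ≠ 0) → ∀ s, Real.cos (θ' s) ≠ 0) := by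
  obtain ⟨k, hk, -⟩ := existsUnique_sub_zsmul_mem_Ioc Real.pi_pos (θ s₀) (-(Real.pi / 2))
  have hk' : θ s₀ - k * Real.pi ∈ Ioc (-(Real.pi / 2)) (Real.pi / 2) := by
    simp only [zsmul_eq_mul] at hk
    constructor
    · exact hk.1
    · linarith [hk.2]
  have hcos : ∀ s, Real.cos (θ s - k * Real.pi) = 0 ↔ Real.cos (θ s) = 0 := fun s => by
    rw [Real.cos_sub_int_mul_pi, mul_eq_zero]
    exact or_iff_right (zpow_ne_zero k (by norm_num))
  -- Subtracting an odd multiple of `π` from the angle reverses the tangent, so in that case the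
  -- parameter has to run backwards.
  rcases k.even_or_odd with he | ho
  · have hs : ∀ a, Real.sin (a - k * Real.pi) = Real.sin a := fun a => by
      rw [Real.sin_sub_int_mul_pi, he.neg_one_zpow, one_mul]
    have hc : ∀ a, Real.cos (a - k * Real.pi) = Real.cos a := fun a => by
      rw [Real.cos_sub_int_mul_pi, he.neg_one_zpow, one_mul]
    refine ⟨fun s => x (s + s₀), fun s => y (s + s₀), fun s => θ (s + s₀) - k * Real.pi,
      ⟨fun s => ?_, fun s => ?_, fun s => ?_⟩, ?_, by simpa using hk', by simpa using hcos s₀,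
      fun hne s => (hcos _).not.2 (hne _)⟩
    · rw [hc]
      exact (h.1 (s + s₀)).comp_add_const s s₀
    · rw [hs]
      exact (h.2 (s + s₀)).comp_add_const s s₀
    · rw [hs, hc]
      exact ((h.3 (s + s₀)).comp_add_const s s₀).sub_const _
    · exact (Equiv.addRight s₀).surjective.range_comp (planeCurve x y)
  · have hs : ∀ a, Real.sin (a - k * Real.pi) = -Real.sin a := fun a => by
      rw [Real.sin_sub_int_mul_pi, ho.neg_one_zpow, neg_one_mul]
    have hc : ∀ a, Real.cos (a - k * Real.pi) = -Real.cos a := fun a => by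
      rw [Real.cos_sub_int_mul_pi, ho.neg_one_zpow, neg_one_mul]
    have hd : ∀ s, HasDerivAt (fun s => s₀ - s) (-1) s := fun s => by
      simpa using (hasDerivAt_id s).const_sub s₀
    refine ⟨fun s => x (s₀ - s), fun s => y (s₀ - s), fun s => θ (s₀ - s) - k * Real.pi,
      ⟨fun s => ?_, fun s => ?_, fun s => ?_⟩, ?_, by simpa using hk', by simpa using hcos s₀,
      fun hne s => (hcos _).not.2 (hne _)⟩
    · rw [hc]
      convert! (h.1 (s₀ - s)).comp s (hd s) using 1
      ring
    · rw [hs]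
      convert! (h.2 (s₀ - s)).comp s (hd s) using 1
      ring
    · rw [hs, hc]
      convert! ((h.3 (s₀ - s)).comp s (hd s)).sub_const _ using 1
      ring
    · exact (Equiv.subLeft s₀).surjective.range_comp (planeCurve x y)

/-- The `x`-axis is itself a flow curve, so uniqueness applies. -/
theorem eq_zero_of_eq_zero (h : IsFlow x y θ) {s₀ : ℝ} (h0 : y s₀ = 0 ∧ θ s₀ = 0) :
    (∀ s, y s = 0) ∧ (∀ s, θ s = 0) ∧ ∀ s, x s = s + x 0 := by
  have hline : IsFlow (fun s => s + x 0) (fun _ => 0) (fun _ => 0) := by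
    refine ⟨fun s => ?_, fun s => ?_, fun s => ?_⟩
    · simpa using (hasDerivAt_id s).add_const (x 0)
    · simpa using hasDerivAt_const s (0 : ℝ)
    · simpa using hasDerivAt_const s (0 : ℝ)
  obtain ⟨rfl, rfl⟩ := h.eq_of_pair_eq hline h0.1 h0.2
  have := h.fst_eq hline (s₀ := 0) (by simp)
  exact ⟨fun _ => rfl, fun _ => rfl, congrFun this⟩

theorem exists_isBranch (h : IsFlow x y θ) (hθ0 : θ 0 = Real.pi / 2) (hx0 : x 0 = 0) :
    ∃ (f : ℝ → ℝ) (x' y' z' : ℕ → ℝ), IsBranch f x' y' z' ∧ (∀ s, 0 ≤ s → f (x s) = y s) ∧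
      x '' Ici 0 = Ici 0 ∧ (0 ≤ f 0 → {t | 0 < t ∧ f t = 0} = range z') ∧
      (f 0 < 0 → ∃ z₀, 0 < z₀ ∧ z₀ < x' 0 ∧ {t | 0 < t ∧ f t = 0} = insert z₀ (range z')) := by
  have hπ := Real.pi_pos
  have hθ : ∀ s ∈ Ioi (0 : ℝ), θ s ∈ Ioo (-(Real.pi / 2)) (Real.pi / 2) := fun s hs =>
    h.angle_mem_of_lt (by rw [hθ0]; exact ⟨by linarith, le_rfl⟩) hs
  have hne : ∀ s ∈ Ioi (0 : ℝ), ¬(y s = 0 ∧ θ s = 0) := fun s _ h0 => by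
    have := (h.eq_zero_of_eq_zero h0).2.1 0
    linarith
  obtain ⟨f₀, p, hfp, hS₀, -⟩ := h.exists_isGraphSolution isOpen_Ioi ordConnected_Ioi hθ hne
  have htop := h.tendsto_fst ordConnected_Ioi (s₀ := 1) (fun s hs => mem_Ioi.2 (zero_lt_one.trans_le (mem_Ici.1 hs)))
    hθ hfp hS₀
  have hxpos : ∀ s, 0 < s → 0 < x s := fun s hs => hx0 ▸ lt_of_hasDerivAt_pos hs
    (fun r _ => h.1 r) (fun r hr => Real.cos_pos_of_mem_Ioo (hθ r hr.1))
  have hsurj : ∀ t, 0 ≤ t → ∃ s, 0 ≤ s ∧ x s = t := fun t ht => by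
    obtain ⟨s', hs', hle⟩ := ((eventually_ge_atTop 0).and (htop.eventually_ge_atTop t)).exists
    obtain ⟨r, hr, hr'⟩ := intermediate_value_Icc hs' h.continuous_fst.continuousOn
      ⟨hx0.trans_le ht, hle⟩
    exact ⟨r, hr.1, hr'⟩
  have himage : x '' Ici 0 = Ici 0 := by
    ext t
    constructor
    · rintro ⟨s, hs, rfl⟩
      rcases (mem_Ici.1 hs).eq_or_lt with rfl | hs
      · exact hx0.ge
      · exact (hxpos s hs).le
    · intro ht
      obtain ⟨s, hs, rfl⟩ := hsurj t ht
      exact ⟨s, hs, rfl⟩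
  have himage' : x '' Ioi 0 = Ioi 0 := by
    ext t
    constructor
    · rintro ⟨s, hs, rfl⟩
      exact hxpos s hs
    · intro ht
      obtain ⟨s, hs, rfl⟩ := hsurj t (le_of_lt ht)
      refine ⟨s, hs.lt_of_ne ?_, rfl⟩
      rintro rfl
      exact absurd ht (by simp [hx0])
  -- The graph solution is determined only over positive abscissas; the starting height `y 0` is put
  -- in at `0`.
  set f : ℝ → ℝ := fun t => if 0 < t then f₀ t else y 0 with hf
  have hff₀ : ∀ t, 0 < t → f t = f₀ t := fun t ht => if_pos ht
  have hfx : ∀ s, 0 ≤ s → f (x s) = y s := fun s hs => by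
    rcases hs.eq_or_lt with rfl | hs
    · simp [hf, hx0]
    · rw [hff₀ _ (hxpos s hs), (hfp s hs).1]
  have hf0 : f 0 = y 0 := by simp [hf]
  have hS : IsGraphSolution f p (Ioi 0) := by
    rw [himage'] at hS₀
    refine ⟨fun t ht => (hS₀.1 t ht).congr_of_eventuallyEq ?_, fun t ht => ?_, fun t ht => ?_⟩
    · filter_upwards [Ioi_mem_nhds ht] with r hr
      exact hff₀ r hr
    · rw [hff₀ t ht]
      exact hS₀.2 t ht
    · rw [hff₀ t ht]
      exact hS₀.3 t ht
  -- the behaviour at the starting point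
  have hnear : 𝓝[>] (0 : ℝ) ≤ map x (𝓝[>] 0) := by
    intro U hU
    obtain ⟨δ, hδ, hsub⟩ := mem_nhdsGT_iff_exists_Ioo_subset.1 (mem_map.1 hU)
    refine mem_of_superset (Ioo_mem_nhdsGT (hxpos δ hδ)) fun t ht => ?_
    obtain ⟨s, hs, rfl⟩ := intermediate_value_Ioo (le_of_lt hδ) h.continuous_fst.continuousOn
      (hx0.symm ▸ ht)
    exact hsub hs
  have hflim : Tendsto f (𝓝[>] 0) (𝓝 (f 0)) := by
    refine Tendsto.mono_left ?_ hnear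
    rw [tendsto_map'_iff, hf0]
    refine ((h.continuous_snd.tendsto 0).mono_left nhdsWithin_le_nhds).congr' ?_
    filter_upwards [self_mem_nhdsWithin] with s hs
    exact (hfx s (le_of_lt hs)).symm
  have hplim : Tendsto p (𝓝[>] 0) atTop := by
    refine Tendsto.mono_left ?_ hnear
    rw [tendsto_map'_iff]
    have h1 : Tendsto θ (𝓝[>] 0) (𝓝[<] (Real.pi / 2)) := by
      refine tendsto_nhdsWithin_iff.2 ⟨?_, ?_⟩
      · exact hθ0 ▸ (h.continuous_angle.tendsto 0).mono_left nhdsWithin_le_nhds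
      · filter_upwards [self_mem_nhdsWithin] with s hs
        exact (hθ s hs).2
    refine (Real.tendsto_tan_pi_div_two.comp h1).congr' ?_
    filter_upwards [self_mem_nhdsWithin] with s hs
    exact (hfp s hs).2.symm
  have hfc : ContinuousOn f (Ici 0) := by
    intro t ht
    rcases (mem_Ici.1 ht).eq_or_lt with rfl | ht
    · exact continuousWithinAt_Ioi_iff_Ici.1 hflim
    · exact (hS.1 t ht).continuousAt.continuousWithinAt
  have hslope : Tendsto (fun t => (f t - f 0) / t) (𝓝[>] 0) atTop := by
    rw [tendsto_atTop]
    intro M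
    obtain ⟨δ, hδ, hsub⟩ := mem_nhdsGT_iff_exists_Ioo_subset.1 (hplim.eventually_ge_atTop M)
    filter_upwards [Ioo_mem_nhdsGT hδ] with t ht
    obtain ⟨r, hr, hslope⟩ := exists_hasDerivAt_eq_slope f p ht.1
      (hfc.mono Icc_subset_Ici_self) (fun r hr => hS.1 r hr.1)
    rw [sub_zero] at hslope
    rw [← hslope]
    exact hsub ⟨hr.1, hr.2.trans ht.2⟩
  -- Near the start `p` tends to `+∞` while `f` stays bounded, so `p` and `f + p` are positive
  -- there, and the search for the maximum can begin at `δ / 2`.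
  obtain ⟨δ, hδ, hδsub⟩ := mem_nhdsGT_iff_exists_Ioo_subset.1
    ((hplim.eventually_gt_atTop 0).and ((hflim.add_atTop hplim).eventually_gt_atTop 0))
  have hδ0 : (0 : ℝ) < δ := hδ
  obtain ⟨b, hδb, hpb, hfb, hpos, hwpos⟩ :=
    (hS.mono (J := Ici (δ / 2)) fun t ht => (half_pos hδ0).trans_le ht).exists_max
    (hδsub ⟨half_pos hδ0, half_lt_self hδ0⟩).2.le (hδsub ⟨half_pos hδ0, half_lt_self hδ0⟩).1
  have hb0 : 0 < b := (half_pos hδ0).trans hδb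
  have hpos' : ∀ t, 0 < t → t < b → 0 < p t := fun t ht htb => by
    rcases le_or_gt (δ / 2) t with h1 | h1
    · exact hpos t ⟨h1, htb⟩
    · exact (hδsub ⟨ht, h1.trans (half_lt_self hδ0)⟩).1
  have hwpos' : ∀ t ∈ Ioi (0 : ℝ), t < b → 0 < f t + p t := fun t ht htb => by
    rcases lt_or_ge (δ / 2) t with h1 | h1
    · exact hwpos t ⟨h1, htb.le⟩
    · exact (hδsub ⟨ht, h1.trans_lt (half_lt_self hδ0)⟩).2
  obtain ⟨x', y', z', hx', hosc, hinf, hzero⟩ := hS.exists_oscillates isOpen_Ioi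
    (fun t ht => hb0.trans_le ht) hb0 hpb hfb hwpos'
  have hmono : StrictMonoOn f (Icc 0 b) := by
    refine strictMonoOn_of_hasDerivWithinAt_pos (convex_Icc 0 b) (hfc.mono Icc_subset_Ici_self)
      (f' := p) (fun t ht => ?_) fun t ht => ?_
    · rw [interior_Icc] at ht
      exact (hS.1 t ht.1).hasDerivWithinAt
    · rw [interior_Icc] at ht
      exact hpos' t ht.1 ht.2
  have hz'pos : ∀ t ∈ range z', b < t ∧ f t = 0 := fun t ht => by
    rw [← hzero] at ht
    exact ht
  have hlate : ∀ t, b ≤ t → f t = 0 → t ∈ range z' := fun t hbt h0 => by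
    rw [← hzero]
    refine ⟨hbt.lt_of_ne ?_, h0⟩
    rintro rfl
    exact hfb.ne' h0
  refine ⟨f, x', y', z', ⟨hfc, hS.contDiffOn isOpen_Ioi, hslope, hosc, hinf⟩, hfx, himage,
    fun hf0 => ?_, fun hf0 => ?_⟩
  · ext t
    refine ⟨fun ⟨ht, h0⟩ => ?_, fun ht => ⟨hb0.trans (hz'pos t ht).1, (hz'pos t ht).2⟩⟩
    rcases le_or_gt b t with hbt | htb
    · exact hlate t hbt h0
    · have := hmono (left_mem_Icc.2 hb0.le) ⟨ht.le, htb.le⟩ ht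
      linarith
  · obtain ⟨z₀, hz₀, hfz₀⟩ := intermediate_value_Ioo hb0.le (hfc.mono Icc_subset_Ici_self)
      (show (0 : ℝ) ∈ Ioo (f 0) (f b) from ⟨hf0, hfb⟩)
    refine ⟨z₀, hz₀.1, hx' ▸ hz₀.2, ?_⟩
    ext t
    constructor
    · rintro ⟨ht, h0⟩
      rcases le_or_gt b t with hbt | htb
      · exact Or.inr (hlate t hbt h0)
      · exact Or.inl (hmono.injOn ⟨ht.le, htb.le⟩ (Ioo_subset_Icc_self hz₀) (h0.trans hfz₀.symm))
    · rintro (rfl | ht)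
      · exact ⟨hz₀.1, hfz₀⟩
      · exact ⟨hb0.trans (hz'pos t ht).1, (hz'pos t ht).2⟩

/-- A solution with a vertical tangent at height `y 0 ≥ 0` consists of two branches. -/
theorem exists_isBranchPair (h : IsFlow x y θ) (hθ0 : θ 0 = Real.pi / 2) (hx0 : x 0 = 0)
    (hy0 : 0 ≤ y 0) :
    ∃ f₁ f₂, IsBranchPair f₁ f₂ ∧ f₁ 0 = y 0 ∧ range (planeCurve x y) = twoBranchCurve f₁ f₂ := by
  obtain ⟨f₁, x₁, y₁, z₁, hB₁, hf₁, him₁, hpos₁, -⟩ := h.exists_isBranch hθ0 hx0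
  have h' := h.reverseReflect
  have hθ0' : Real.pi - θ (-0) = Real.pi / 2 := by
    rw [neg_zero, hθ0]
    ring
  obtain ⟨f₂, x₂, y₂, z₂, hB₂, hf₂, him₂, hpos₂, hneg₂⟩ :=
    h'.exists_isBranch hθ0' (by simpa using hx0)
  have e₁ : f₁ 0 = y 0 := by rw [← hf₁ 0 le_rfl, hx0]
  have e₂ : f₂ 0 = -y 0 := by simpa [hx0] using hf₂ 0 le_rfl
  refine ⟨f₁, f₂, ⟨e₁ ▸ hy0, by rw [e₁, e₂, neg_neg], ⟨x₁, y₁, z₁, hB₁, hpos₁ (e₁ ▸ hy0)⟩,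
    ⟨x₂, y₂, z₂, hB₂, fun h0 => hpos₂ h0.ge, hneg₂⟩, fun h0 => ?_⟩, e₁, ?_⟩
  · rw [e₁] at h0
    -- A vertical start on the axis is fixed by reflection with reversal, so uniqueness gives the
    -- symmetry.
    obtain ⟨hy, hθ⟩ := h.eq_of_pair_eq h' (s₀ := 0) (by simp [h0]) (by rw [hθ0', hθ0])
    have h'' : IsFlow (fun s => x (-s)) y θ := by
      have := h'
      rwa [← hy, ← hθ] at this
    have hx := h.fst_eq h'' (s₀ := 0) (by simp)
    intro t ht
    rw [← him₁] at ht
    obtain ⟨s, hs, rfl⟩ := ht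
    have h1 := hf₂ s hs
    rw [← congrFun hx s, ← congrFun hy s] at h1
    rw [h1, hf₁ s hs]
  · ext q
    constructor
    · rintro ⟨s, rfl⟩
      rcases le_total 0 s with hs | hs
      · refine Or.inl ⟨him₁ ▸ mem_image_of_mem x hs, ?_⟩
        simp [hf₁ s hs]
      · have hs' : 0 ≤ -s := neg_nonneg.2 hs
        refine Or.inr ⟨?_, ?_⟩
        · have := mem_image_of_mem (fun s => x (-s)) (mem_Ici.2 hs')
          rw [him₂] at this
          simpa using this
        · have := hf₂ (-s) hs'
          simp only [neg_neg] at this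
          simp [this]
    · rintro (⟨hq0, hq1⟩ | ⟨hq0, hq1⟩)
      · rw [← him₁] at hq0
        obtain ⟨s, hs, hxs⟩ := hq0
        refine ⟨s, Plane.ext hxs ?_⟩
        rw [planeCurve_one, hq1, ← hxs, hf₁ s hs]
      · rw [← him₂] at hq0
        obtain ⟨s, hs, hxs⟩ := hq0
        refine ⟨-s, Plane.ext hxs ?_⟩
        simp only [planeCurve_one, hq1, ← hxs, hf₂ s hs, neg_neg]

theorem range_eq_axisLine (h : IsFlow x y θ) {s₀ : ℝ} (h0 : y s₀ = 0 ∧ θ s₀ = 0) :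
    range (planeCurve x y) = axisLine := by
  obtain ⟨hy, -, hx⟩ := h.eq_zero_of_eq_zero h0
  ext q
  constructor
  · rintro ⟨s, rfl⟩
    exact hy s
  · intro hq
    refine ⟨q 0 - x 0, Plane.ext ?_ ?_⟩
    · rw [planeCurve_zero, hx, sub_add_cancel]
    · rw [planeCurve_one, hy]
      exact (show q 1 = 0 from hq).symm

theorem angle_mem_of_cos_ne_zero (h : IsFlow x y θ)
    (h0 : θ 0 ∈ Ioc (-(Real.pi / 2)) (Real.pi / 2)) (hc : ∀ s, Real.cos (θ s) ≠ 0) (s : ℝ) :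
    θ s ∈ Ioo (-(Real.pi / 2)) (Real.pi / 2) := by
  have hne : ∀ s, θ s ≠ Real.pi / 2 := fun s hs => hc s (by rw [hs, Real.cos_pi_div_two])
  have hne' : ∀ s, θ s ≠ -(Real.pi / 2) := fun s hs =>
    hc s (by rw [hs, Real.cos_neg, Real.cos_pi_div_two])
  constructor
  · by_contra! hle
    obtain ⟨r, hr⟩ := mem_range_of_exists_le_of_exists_ge h.continuous_angle ⟨s, hle⟩ ⟨0, h0.1.le⟩
    exact hne' r hr
  · by_contra! hle
    obtain ⟨r, hr⟩ := mem_range_of_exists_le_of_exists_ge h.continuous_angle ⟨0, h0.2⟩ ⟨s, hle⟩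
    exact hne r hr

/-- The three kinds of complete solutions. -/
theorem classification (h : IsFlow x y θ) :
    ∃ c ε : ℝ, (ε = 1 ∨ ε = -1) ∧
      (shiftReflect c ε '' range (planeCurve x y) = axisLine ∨
        (∃ f₁ f₂ : ℝ → ℝ, IsBranchPair f₁ f₂ ∧
          shiftReflect c ε '' range (planeCurve x y) = twoBranchCurve f₁ f₂) ∨
        (∃ f : ℝ → ℝ, IsOscillatingEntire f ∧
          shiftReflect c ε '' range (planeCurve x y) = graphOver univ f)) := by
  by_cases hv : ∃ s₀, Real.cos (θ s₀) = 0
  · obtain ⟨s₀, hs₀⟩ := hv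
    obtain ⟨x', y', θ', h', hr, hmem, hcos, -⟩ := h.exists_normalized s₀
    have hθ0 : θ' 0 = Real.pi / 2 := by
      by_contra hne
      exact (Real.cos_pos_of_mem_Ioo ⟨hmem.1, hmem.2.lt_of_ne hne⟩).ne' (hcos.2 hs₀)
    have h1 := h'.add_const_fst (-x' 0)
    rw [← hr]
    rcases le_total 0 (y' 0) with hy | hy
    · obtain ⟨f₁, f₂, hB, -, hR⟩ := h1.exists_isBranchPair hθ0 (by simp) hy
      refine ⟨-x' 0, 1, Or.inl rfl, Or.inr (Or.inl ⟨f₁, f₂, hB, ?_⟩)⟩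
      rw [← hR, ← range_comp]
      congr 1
      ext1 s
      exact Plane.ext rfl (one_mul _)
    -- Reflection with reversal keeps the angle `π/2` and makes the starting height nonnegative.
    · obtain ⟨f₁, f₂, hB, -, hR⟩ := h1.reverseReflect.exists_isBranchPair
        (by simp only [neg_zero, hθ0]; ring) (by simp) (by simpa using hy)
      refine ⟨-x' 0, -1, Or.inr rfl, Or.inr (Or.inl ⟨f₁, f₂, hB, ?_⟩)⟩
      rw [← hR, ← range_comp, ← (Equiv.neg ℝ).surjective.range_comp]
      congr 1
      ext1 s
      refine Plane.ext rfl (neg_one_mul _)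
  · push Not at hv
    obtain ⟨x', y', θ', h', hr, hmem, -, hcos⟩ := h.exists_normalized 0
    have hθ := h'.angle_mem_of_cos_ne_zero hmem (hcos hv)
    rw [← hr]
    by_cases h0 : ∃ s, y' s = 0 ∧ θ' s = 0
    · obtain ⟨s, hs⟩ := h0
      refine ⟨0, 1, Or.inl rfl, Or.inl ?_⟩
      rw [h'.range_eq_axisLine hs]
      have : shiftReflect 0 1 = id := by
        ext1 p
        exact Plane.ext (add_zero _) (one_mul _)
      rw [this, image_id]
    · push Not at h0
      obtain ⟨c, e, he, f, hf, hR⟩ := h'.exists_isOscillatingEntire hθ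
        (fun s hs => h0 s hs.1 hs.2)
      exact ⟨c, e, he, Or.inr (Or.inr ⟨f, hf, hR⟩)⟩

end IsFlow

/-! ### Existence of an entire graph -/

theorem angleField_neg (z : ℝ × ℝ) : angleField (-z) = -angleField z := by
  refine Prod.ext ?_ ?_
  · simp [angleField]
  · simp only [angleField, Prod.fst_neg, Prod.snd_neg, Real.sin_neg, Real.cos_neg]
    ring

/-- Start on a circle of initial data that is invariant under `z ↦ -z`. Leaving the strip backwards
at the top and leaving it at the bottom are open, mutually exclusive conditions, interchanged by
this symmetry; by connectedness some initial value satisfies neither. -/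
theorem exists_isFlow_angle_mem :
    ∃ x y θ, IsFlow x y θ ∧ (∀ s, θ s ∈ Ioo (-(Real.pi / 2)) (Real.pi / 2)) ∧
      ∀ s, ¬(y s = 0 ∧ θ s = 0) := by
  choose Φ hΦ0 hΦ using exists_flow_angleField
  have hflow : ∀ z, IsFlow _ (fun s => (Φ z s).1) (fun s => (Φ z s).2) := fun z =>
    IsFlow.of_pair (hΦ z) 0
  have hneg : ∀ z s, Φ (-z) s = -Φ z s := fun z s => by
    refine congrFun (eq_of_hasDerivAt_smul locallyLipschitz_angleField (σ := fun _ => 1)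
      continuous_const (t₀ := 0) (f := Φ (-z)) (g := fun s => -Φ z s) (fun s => ?_) (fun s => ?_)
      ?_) s
    · simpa using hΦ (-z) s
    · rw [angleField_neg, one_smul]
      exact (hΦ z s).neg
    · rw [hΦ0, hΦ0]
  -- The circle avoids the trivial solution, and its angles satisfy `|sin φ| ≤ 1 < π / 2`, so every
  -- start lies inside the strip.
  set γ : ℝ → ℝ × ℝ := fun φ => (Real.cos φ, Real.sin φ) with hγ
  have hγc : Continuous γ := Real.continuous_cos.prodMk Real.continuous_sin
  have hγπ : ∀ φ, γ (φ + Real.pi) = -γ φ := fun φ => by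
    simp [hγ, Real.cos_add_pi, Real.sin_add_pi]
  have hstart : ∀ φ, (Φ (γ φ) 0).2 ∈ Ioo (-(Real.pi / 2)) (Real.pi / 2) := fun φ => by
    have h1 := Real.sin_le_one φ
    have h2 := Real.neg_one_le_sin φ
    have h3 := Real.pi_gt_three
    rw [hΦ0]
    constructor <;> simp only [hγ] <;> linarith
  set U : Set ℝ := {φ | ∃ s < 0, Real.pi / 2 < (Φ (γ φ) s).2} with hU
  set D : Set ℝ := {φ | ∃ s < 0, (Φ (γ φ) s).2 < -(Real.pi / 2)} with hD
  have hcont : ∀ s, Continuous fun φ => (Φ (γ φ) s).2 := fun s =>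
    continuous_snd.comp ((continuous_flow_angleField hΦ0 hΦ s).comp hγc)
  have hUo : IsOpen U := by
    have : U = ⋃ s ∈ Iio (0 : ℝ), {φ | Real.pi / 2 < (Φ (γ φ) s).2} := by
      ext φ
      simp [hU]
    rw [this]
    exact isOpen_biUnion fun s _ => isOpen_lt continuous_const (hcont s)
  have hDo : IsOpen D := by
    have : D = ⋃ s ∈ Iio (0 : ℝ), {φ | (Φ (γ φ) s).2 < -(Real.pi / 2)} := by
      ext φ
      simp [hD]
    rw [this]
    exact isOpen_biUnion fun s _ => isOpen_lt (hcont s) continuous_const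
  have hUD : ∀ φ, φ ∈ U ↔ φ + Real.pi ∈ D := fun φ => by
    simp only [hU, hD, mem_ofPred_eq, hγπ, hneg, Prod.snd_neg, neg_lt_neg_iff]
  have hπ := Real.pi_pos
  -- To get from above `π/2` to below `-π/2` the angle would have to pass `π/2`, after which the
  -- strip confines it.
  have hkey : ∀ φ, ∀ s₁ s₂, s₁ < s₂ → s₂ < 0 → Real.pi / 2 < (Φ (γ φ) s₁).2 →
      ¬(Φ (γ φ) s₂).2 < -(Real.pi / 2) := by
    intro φ s₁ s₂ h12 h20 h1 h2
    obtain ⟨r, hr, hr0⟩ := intermediate_value_Icc' h12.le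
      (hflow (γ φ)).continuous_angle.continuousOn
      (show Real.pi / 2 ∈ Icc _ _ from ⟨by linarith, h1.le⟩)
    simp only at hr0
    have hr2 : r < s₂ := hr.2.lt_of_ne (by rintro rfl; linarith)
    have := ((hflow (γ φ)).angle_mem_of_lt (by rw [hr0]; exact ⟨by linarith, le_rfl⟩) hr2).1
    linarith
  have hkey' : ∀ φ, ∀ s₁ s₂, s₁ < s₂ → s₂ < 0 → (Φ (γ φ) s₁).2 < -(Real.pi / 2) →
      ¬Real.pi / 2 < (Φ (γ φ) s₂).2 := by
    intro φ s₁ s₂ h12 h20 h1 h2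
    refine hkey (φ + Real.pi) s₁ s₂ h12 h20 ?_ ?_ <;>
      rw [hγπ, hneg, Prod.snd_neg] <;> linarith
  have hdisj : ∀ φ, φ ∈ U → φ ∉ D := by
    rintro φ ⟨s₁, h1, h1'⟩ ⟨s₂, h2, h2'⟩
    rcases lt_trichotomy s₁ s₂ with hlt | rfl | hlt
    · exact hkey φ s₁ s₂ hlt h2 h1' h2'
    · linarith
    · exact hkey' φ s₂ s₁ hlt h1 h2' h1'
  obtain ⟨φ, hφU, hφD⟩ : ∃ φ, φ ∉ U ∧ φ ∉ D := by
    by_contra! hcov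
    have hcover : univ ⊆ U ∪ D := fun φ _ => by
      by_cases hφ : φ ∈ U
      · exact Or.inl hφ
      · exact Or.inr (hcov φ hφ)
    have hUne : (univ ∩ U).Nonempty := by
      rcases hcover (mem_univ Real.pi) with h0 | h0
      · exact ⟨_, trivial, h0⟩
      · exact ⟨0, trivial, (hUD 0).2 (by rwa [zero_add])⟩
    have hDne : (univ ∩ D).Nonempty := by
      obtain ⟨φ, -, hφ⟩ := hUne
      exact ⟨_, trivial, (hUD φ).1 hφ⟩
    obtain ⟨φ, -, hφU, hφD⟩ := isPreconnected_univ U D hUo hDo hcover hUne hDne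
    exact hdisj φ hφU hφD
  refine ⟨_, _, _, hflow (γ φ), fun s => ?_, fun s hs => ?_⟩
  · rcases lt_or_ge s 0 with hs | hs
    -- Avoiding `U` and `D` gives only the closed strip; starting one unit of time earlier makes it
    -- open.
    · refine (hflow (γ φ)).angle_mem_of_lt (s₀ := s - 1) ⟨?_, ?_⟩ (by linarith)
      · by_contra! hlt
        exact hφD ⟨s - 1, by linarith, hlt⟩
      · by_contra! hlt
        exact hφU ⟨s - 1, by linarith, hlt⟩
    · rcases hs.eq_or_lt with rfl | hs
      · exact hstart φ
      · exact (hflow (γ φ)).angle_mem_of_lt (Ioo_subset_Icc_self (hstart φ)) hs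
  · obtain ⟨h1, h2, -⟩ := (hflow (γ φ)).eq_zero_of_eq_zero hs
    have h3 := h1 0
    have h4 := h2 0
    simp only [hΦ0, hγ] at h3 h4
    have := Real.sin_sq_add_cos_sq φ
    rw [h3, h4] at this
    norm_num at this

/-! ### The classification theorem. -/

theorem mainTheorem4 :
    -- Up to a horizontal translation and the reflection in the x-axis, each complete solution
    -- is of one of the three kinds.
    (∀ Y : ℝ → Plane, IsMaximalSolution contractB translateC Y →
      ∃ c ε : ℝ, (ε = 1 ∨ ε = -1) ∧
        (shiftReflect c ε '' range Y = axisLine ∨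
          (∃ f₁ f₂ : ℝ → ℝ, IsBranchPair f₁ f₂ ∧
            shiftReflect c ε '' range Y = twoBranchCurve f₁ f₂) ∨
          (∃ f : ℝ → ℝ, IsOscillatingEntire f ∧
            shiftReflect c ε '' range Y = graphOver univ f))) ∧
    -- Each solution is an arc of a complete one.
    (∀ Y : ℝ → Plane, IsSolution contractB translateC Y →
      ∃ (Z : ℝ → Plane) (φ : ℝ → ℝ),
        IsMaximalSolution contractB translateC Z ∧ IsArcOf Y Z φ) ∧
    -- The three kinds occur, the second one with every starting height.
    (∃ Y : ℝ → Plane, IsMaximalSolution contractB translateC Y ∧ range Y = axisLine) ∧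
    (∀ a : ℝ, 0 ≤ a → ∃ (Y : ℝ → Plane) (f₁ f₂ : ℝ → ℝ),
      IsMaximalSolution contractB translateC Y ∧ IsBranchPair f₁ f₂ ∧ f₁ 0 = a ∧
        range Y = twoBranchCurve f₁ f₂) ∧
    (∃ (Y : ℝ → Plane) (f : ℝ → ℝ),
      IsMaximalSolution contractB translateC Y ∧ IsOscillatingEntire f ∧
        range Y = graphOver univ f) := by
  refine ⟨fun Y hY => ?_, fun Y hY => ?_, ?_, fun a ha => ?_, ?_⟩
  · obtain ⟨x, y, θ, h, hr⟩ := hY.exists_isFlow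
    rw [hr]
    exact h.classification
  · obtain ⟨x, y, θ, φ, h, hφ⟩ := hY.exists_isFlow
    exact ⟨_, φ, h.isMaximalSolution, hφ⟩
  · obtain ⟨x, y, θ, h, -, hy, hθ⟩ := IsFlow.exists_eq 0 0 0
    exact ⟨_, h.isMaximalSolution, h.range_eq_axisLine ⟨hy, hθ⟩⟩
  · obtain ⟨x, y, θ, h, hx, hy, hθ⟩ := IsFlow.exists_eq 0 a (Real.pi / 2)
    obtain ⟨f₁, f₂, hB, h0, hr⟩ := h.exists_isBranchPair hθ hx (hy ▸ ha)
    exact ⟨_, f₁, f₂, h.isMaximalSolution, hB, h0.trans hy, hr⟩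
  · obtain ⟨x, y, θ, h, hθ, hne⟩ := exists_isFlow_angle_mem
    obtain ⟨c, e, he, f, hf, hr⟩ := h.exists_isOscillatingEntire hθ hne
    -- The image itself has to be the graph, so the translation and the reflection are absorbed into
    -- the solution.
    have key : ∃ y' θ', IsFlow x y' θ' ∧ ∀ s, y' s = e * y s := by
      rcases he with rfl | rfl
      · exact ⟨y, θ, h, fun s => (one_mul _).symm⟩
      · exact ⟨_, _, h.reflect, fun s => (neg_one_mul _).symm⟩
    obtain ⟨y', θ', h', hy'⟩ := key
    refine ⟨_, f, (h'.add_const_fst c).isMaximalSolution, hf, ?_⟩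
    rw [← hr, ← range_comp]
    congr 1
    ext1 s
    exact Plane.ext rfl (hy' s)
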